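/- Let $p$ be a prime and $A$ a finite set. Let $R$ be a commutative ring (respectively, a commutative $\mathbb{Z}_p$-algebra) that is fully residually $\mathbb{Z}_p$, i.e. for every finite subset $C\subset R$ there is a ring homomorphism (respectively, a $\mathbb{Z}_p$-algebra homomorphism) $R\to\mathbb{Z}_p$ that is injective on $C$. (Then $R$ is a domain of characteristic $0$.) Let $R^{bin}$ be its binomial closure: inside the localisation of $R$ at the nonzero integers put $R_0=R$, let $R_{i+1}$ be the subring generated by $R_i$ and all $\binom{\alpha}{n}=\alpha(\alpha-1)\cdots(\alpha-n+1)/n!$ with $\alpha\in R_i$, $n\ge 0$, and let $R^{bin}=\bigcup_i R_i$. For a binomial ring $S$, a Hall $S$-group of class at most $c$ is a nilpotent group $G$ of class at most $c$ with a map $G\times S\to G$, $(g,\lambda)\mapsto g^\lambda$, such that $g^0=1$, $g^1=g$, $g^{\lambda+\mu}=g^\lambda g^\mu$, $g^{\lambda\mu}=(g^\lambda)^\mu$, $y^{-1}x^\lambda y=(y^{-1}xy)^\lambda$, and $$x_1^\lambda\cdots x_n^\lambda=(x_1\cdots x_n)^\lambda\,\tau_2(x)^{\binom{\lambda}{2}}\cdots\tau_m(x)^{\binom{\lambda}{m}}\qquad(m\ge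 c),$$ where the Petresco words $\tau_k$ in the free group on $a_1,\dots,a_n$ are defined recursively by $a_1^i\cdots a_n^i=\tau_1^{\binom i1}\tau_2^{\binom i2}\cdots\tau_i^{\binom ii}$ (since $\tau_k$ lies in the $k$-th term of the lower central series, all $m\ge c$ give the same condition). Let $F(A,S,c)$ be the free Hall $S$-group of class $c$ on $A$, let $\mathbb{F}(A,S)=\varprojlim_c F(A,S,c)$ be the free pro-Hall $S$-group, and let $\mathbb{F}$ be the free pro-$p$ group on $A$. Then the abstract group $\mathbb{F}(A,R^{bin})$ is fully residually $\mathbb{F}$: for every finite $C\subset\mathbb{F}(A,R^{bin})$ there is a group homomorphism $\mathbb{F}(A,R^{bin})\to\mathbb{F}$ that is injective on $C$. More precisely, fix any linear order on the formal commutators in $A$ in which commutators of smaller weight come first; the basic commutators are the letters $a\in A$ and the commutators $[u,v]$ with $u,v$ basic, $u<v$, and $s\le u$ in case $v=[s,t]$ (where $[x,y]=x^{-1}y^{-1}xy$). Every $g\in\mathbb{F}(A,R^{bin})$ can be written uniquely as an infinite ordered product $g=\prod_b b^{\alpha_b}$ over the basic commutators, with $\alpha_b\in R^{bin}$, and for every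 finite $C$ there are a ring homomorphism $\varphi:R^{bin}\to\mathbb{Z}_p$ and a group homomorphism $\tilde\varphi:\mathbb{F}(A,R^{bin})\to\mathbb{F}$ that is injective on $C$ and satisfies $$\tilde\varphi\Big(\prod_b b^{\alpha_b}\Big)=\prod_b b^{\varphi(\alpha_b)}\quad\text{for all exponents }(\alpha_b).$$ If $R$ is a $\mathbb{Z}_p$-algebra that is fully residually $\mathbb{Z}_p$ as a $\mathbb{Z}_p$-algebra, then $\varphi$ can be taken to be the identity on $\mathbb{Z}_p$, and the maps $\tilde\varphi$ to be $\mathbb{F}$-homomorphisms: there is a homomorphism $\iota:\mathbb{F}\to\mathbb{F}(A,R^{bin})$, not depending on $C$, with $\iota\big(\prod_b b^{\beta_b}\big)=\prod_b b^{\beta_b}$ for all $\beta_b\in\mathbb{Z}_p$, such that $\tilde\varphi\circ\iota=\mathrm{id}_{\mathbb{F}}$ for all the chosen $\tilde\varphi$. -/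

import Mathlib

open scoped Nat nonZeroDivisors

/-! ### Residual properties -/

/-- The commutative ring `R` is fully residually `S` (discriminated by `S`): every finite subset of
`R` is mapped injectively by some ring homomorphism `R → S`. -/
def FullyResiduallyRing (R S : Type*) [CommRing R] [CommRing S] : Prop :=
  ∀ C : Finset R, ∃ f : R →+* S, Set.InjOn f (C : Set R)

/-- The `K`-algebra `R` is fully residually `S` as a `K`-algebra. -/
def FullyResiduallyAlg (K R S : Type*) [CommRing K] [CommRing R] [CommRing S]
    [Algebra K R] [Algebra K S] : Prop :=
  ∀ C : Finset R, ∃ f : R →ₐ[K] S, Set.InjOn f (C : Set R)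

/-- The abstract group `G` is fully residually `H`. -/
def FullyResiduallyGroup (G H : Type*) [Group G] [Group H] : Prop :=
  ∀ C : Finset G, ∃ f : G →* H, Set.InjOn f (C : Set G)

/-! ### The binomial closure of a ring -/

namespace BinClosure

variable (R : Type*) [CommRing R]

/-- The localisation of `R` at (the image of) the nonzero integers. -/
abbrev Loc : Type _ := Localization (Algebra.algebraMapSubmonoid R ℤ⁰)

/-- The recursive stages `R = R₀ ≤ R₁ ≤ …` inside the localisation: `Rᵢ₊₁` is generated by `Rᵢ`
and all binomial coefficients `α(α-1)⋯(α-n+1)/n!` with `α ∈ Rᵢ`. (The coefficients of the elements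
of `Rᵢ₋₁` already lie in `Rᵢ`, so it does not matter whether they are listed again.) -/
def stage : ℕ → Subring (Loc R)
  | 0 => (algebraMap R (Loc R)).range
  | i + 1 => Subring.closure ((stage i : Set (Loc R)) ∪
      {x | ∃ α ∈ stage i, ∃ n : ℕ, (n ! : Loc R) * x = ∏ j ∈ Finset.range n, (α - (j : Loc R))})

/-- The binomial closure of `R`, the union of the stages. -/
def carrier : Subring (Loc R) := ⨆ i, stage R i

lemma isUnit_natCast {n : ℕ} (hn : n ≠ 0) : IsUnit (n : Loc R) := by
  have h := IsLocalization.map_units (Loc R)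
    (⟨algebraMap ℤ R (n : ℤ), Algebra.mem_algebraMapSubmonoid_of_mem
      (⟨(n : ℤ), mem_nonZeroDivisors_of_ne_zero (by exact_mod_cast hn)⟩ : ℤ⁰)⟩ :
      Algebra.algebraMapSubmonoid R ℤ⁰)
  simpa using h

lemma stage_mono : Monotone (stage R) :=
  monotone_nat_of_le_succ fun _ _ hx => Subring.subset_closure (Or.inl hx)

lemma mem_carrier {x : Loc R} : x ∈ carrier R ↔ ∃ i, x ∈ stage R i :=
  Subring.mem_iSup_of_directed (stage_mono R).directed_le

lemma exists_multichoose (r : carrier R) (n : ℕ) :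
    ∃ y : carrier R, (n ! : carrier R) * y = ∏ j ∈ Finset.range n, (r + (j : carrier R)) := by
  obtain ⟨r, hr⟩ := r
  obtain ⟨i, hi⟩ := (mem_carrier R).1 hr
  obtain ⟨u, hu⟩ := isUnit_natCast R (Nat.factorial_ne_zero n)
  set α : Loc R := r + (n : Loc R) - 1 with hα
  have hαi : α ∈ stage R i := sub_mem (add_mem hi (natCast_mem _ n)) (one_mem _)
  have key : ∏ j ∈ Finset.range n, (α - (j : Loc R)) =
      ∏ j ∈ Finset.range n, (r + (j : Loc R)) := by
    rw [← Finset.prod_range_reflect]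
    refine Finset.prod_congr rfl fun j hj => ?_
    have hj' : j + 1 ≤ n := Finset.mem_range.1 hj
    have : ((n - 1 - j : ℕ) : Loc R) = (n : Loc R) - 1 - j := by
      rw [Nat.sub_sub, Nat.cast_sub (by omega)]; push_cast; ring
    rw [this, hα]; ring
  set y : Loc R := ↑u⁻¹ * ∏ j ∈ Finset.range n, (r + (j : Loc R)) with hy
  have hmul : (n ! : Loc R) * y = ∏ j ∈ Finset.range n, (r + (j : Loc R)) := by
    rw [hy, ← hu, Units.mul_inv_cancel_left]
  have hyS : y ∈ stage R (i + 1) :=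
    Subring.subset_closure (Or.inr ⟨α, hαi, n, by rw [hmul, key]⟩)
  refine ⟨⟨y, (mem_carrier R).2 ⟨i + 1, hyS⟩⟩, Subtype.ext ?_⟩
  push_cast
  exact hmul

end BinClosure

/-- The binomial closure of the ring `R`. -/
abbrev BinClosure (R : Type*) [CommRing R] : Type _ := ↥(BinClosure.carrier R)

/-- The canonical map of a ring to its binomial closure. -/
def BinClosure.of (R : Type*) [CommRing R] : R →+* BinClosure R :=
  (algebraMap R (BinClosure.Loc R)).codRestrict (BinClosure.carrier R) fun r =>
    (BinClosure.mem_carrier R).2 ⟨0, r, rfl⟩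

/-- The binomial closure has all binomial coefficients. -/
noncomputable instance (R : Type*) [CommRing R] : BinomialRing (BinClosure R) where
  toIsAddTorsionFree := ⟨fun n hn x y h => by
    have h' : (n : BinClosure R) * x = (n : BinClosure R) * y := by simpa using h
    refine Subtype.ext ((BinClosure.isUnit_natCast R hn).mul_left_cancel ?_)
    simpa using congrArg (Subtype.val) h'⟩
  multichoose r n := (BinClosure.exists_multichoose R r n).choose
  factorial_nsmul_multichoose r n := by
    rw [nsmul_eq_mul, (BinClosure.exists_multichoose R r n).choose_spec]
    induction n with
    | zero => simp
    | succ n ih =>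
      rw [Finset.prod_range_succ, ih, ascPochhammer_succ_right, Polynomial.smeval_mul]
      simp [Polynomial.smeval_add, Polynomial.smeval_natCast]

/-! ### Hall `R`-groups -/

/-- The Petresco words `τᵢ` in the free group on `a₁, …, aₙ`, determined by
`a₁ⁱ⋯aₙⁱ = τ₁^(i choose 1) τ₂^(i choose 2) ⋯ τᵢ^(i choose i)`. (Here `τ₀ = 1`.) -/
def petrescoWord (n : ℕ) (i : ℕ) : FreeGroup (Fin n) :=
  ((List.ofFn fun k : Fin i => petrescoWord n k ^ i.choose k).prod)⁻¹ *
    (List.ofFn fun j : Fin n => FreeGroup.of j ^ i).prod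
termination_by i
decreasing_by exact k.2

/-- `G`, with the exponentiation `G × R → G`, is a Hall `R`-group of nilpotency class at most `c`,
where `R` is a binomial ring. In `petresco` the product of Petresco words may be stopped at any
upper bound `m` of the class, since the `k`-th Petresco word lies in the `k`-th term of the lower
central series. -/
structure IsHallGroup (R : Type*) [CommRing R] [BinomialRing R] (c : ℕ) (G : Type*) [Group G]
    [Pow G R] : Prop where
  nilpotent : (⊤ : Subgroup G).lowerCentralSeries c = ⊥
  rpow_zero : ∀ g : G, g ^ (0 : R) = 1
  rpow_one : ∀ g : G, g ^ (1 : R) = g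
  rpow_add : ∀ (g : G) (r s : R), g ^ (r + s) = g ^ r * g ^ s
  rpow_mul : ∀ (g : G) (r s : R), g ^ (r * s) = (g ^ r) ^ s
  conj_rpow : ∀ (x y : G) (r : R), y⁻¹ * x ^ r * y = (y⁻¹ * x * y) ^ r
  petresco : ∀ m, c ≤ m → ∀ (n : ℕ) (x : Fin n → G) (r : R),
    (List.ofFn fun i => x i ^ r).prod = (List.ofFn x).prod ^ r *
      ((List.Ico 2 (m + 1)).map fun k =>
        FreeGroup.lift x (petrescoWord n k) ^ Ring.choose r k).prod

/-! ### Free Hall `R`-groups -/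

/-- Formal terms in the language of groups with exponents from `R`, in the variables `A`. -/
inductive HallTerm (R A : Type*)
  | of : A → HallTerm R A
  | one : HallTerm R A
  | mul : HallTerm R A → HallTerm R A → HallTerm R A
  | inv : HallTerm R A → HallTerm R A
  | rpow : HallTerm R A → R → HallTerm R A

namespace HallTerm

variable {R A : Type*}

instance : One (HallTerm R A) := ⟨one⟩
instance : Mul (HallTerm R A) := ⟨mul⟩
instance : Inv (HallTerm R A) := ⟨inv⟩
instance : Pow (HallTerm R A) R := ⟨rpow⟩

/-- Substitution of terms into a group word. -/
def evalWord {n : ℕ} (x : Fin n → HallTerm R A) (w : FreeGroup (Fin n)) : HallTerm R A :=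
  (w.toWord.map fun y => cond y.2 (x y.1) (x y.1)⁻¹).prod

/-- The left-normed commutator `[x₀, x₁, …, x_k]`. -/
def leftNormed (x : ℕ → HallTerm R A) : ℕ → HallTerm R A
  | 0 => x 0
  | k + 1 => leftNormed x k * x (k + 1) * (leftNormed x k)⁻¹ * (x (k + 1))⁻¹

/-- The congruence on terms generated by the laws of groups and the laws of Hall `R`-groups of
class at most `c`. -/
inductive Rel [CommRing R] [BinomialRing R] (c : ℕ) : HallTerm R A → HallTerm R A → Prop
  | refl (s) : Rel c s s
  | symm {s t} : Rel c s t → Rel c t s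
  | trans {s t u} : Rel c s t → Rel c t u → Rel c s u
  | mul_congr {s s' t t'} : Rel c s s' → Rel c t t' → Rel c (s * t) (s' * t')
  | inv_congr {s s'} : Rel c s s' → Rel c s⁻¹ s'⁻¹
  | rpow_congr {s s'} (r : R) : Rel c s s' → Rel c (s ^ r) (s' ^ r)
  | mul_assoc (s t u) : Rel c (s * t * u) (s * (t * u))
  | one_mul (s) : Rel c (1 * s) s
  | mul_one (s) : Rel c (s * 1) s
  | inv_mul_cancel (s) : Rel c (s⁻¹ * s) 1
  | nilpotent (x : ℕ → HallTerm R A) : Rel c (leftNormed x c) 1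
  | rpow_zero (s) : Rel c (s ^ (0 : R)) 1
  | rpow_one (s) : Rel c (s ^ (1 : R)) s
  | rpow_add (s) (q r : R) : Rel c (s ^ (q + r)) (s ^ q * s ^ r)
  | rpow_mul (s) (q r : R) : Rel c (s ^ (q * r)) ((s ^ q) ^ r)
  | conj_rpow (s t) (r : R) : Rel c (t⁻¹ * s ^ r * t) ((t⁻¹ * s * t) ^ r)
  | petresco (m : ℕ) (hm : c ≤ m) (n : ℕ) (x : Fin n → HallTerm R A) (r : R) :
      Rel c (List.ofFn fun i => x i ^ r).prod ((List.ofFn x).prod ^ r *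
        ((List.Ico 2 (m + 1)).map fun k =>
          evalWord x (petrescoWord n k) ^ Ring.choose r k).prod)

end HallTerm

section FreeHall

variable (R : Type*) [CommRing R] [BinomialRing R] (A : Type*) (c : ℕ)

/-- Terms up to the laws of Hall `R`-groups of class at most `c`. -/
def hallSetoid : Setoid (HallTerm R A) :=
  ⟨HallTerm.Rel c, HallTerm.Rel.refl, HallTerm.Rel.symm, HallTerm.Rel.trans⟩

/-- The free Hall `R`-group of class `c` on `A`. -/
def FreeHall : Type _ := Quotient (hallSetoid R A c)

end FreeHall

namespace FreeHall

variable {R : Type*} [CommRing R] [BinomialRing R] {A : Type*} {c : ℕ}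

/-- The class of a term. -/
def mk (s : HallTerm R A) : FreeHall R A c := Quotient.mk (hallSetoid R A c) s

lemma sound {s t : HallTerm R A} (h : HallTerm.Rel c s t) : (mk s : FreeHall R A c) = mk t :=
  Quotient.sound h

lemma mk_surjective : Function.Surjective (mk : HallTerm R A → FreeHall R A c) :=
  Quotient.mk_surjective

/-- The free generators. -/
def of (a : A) : FreeHall R A c := mk (HallTerm.of a)

instance : Group (FreeHall R A c) where
  one := mk 1
  mul := Quotient.map₂ (· * ·) fun _ _ h _ _ h' => HallTerm.Rel.mul_congr h h'
  inv := Quotient.map (·⁻¹) fun _ _ h => HallTerm.Rel.inv_congr h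
  mul_assoc := by
    rintro ⟨s⟩ ⟨t⟩ ⟨u⟩; exact sound (HallTerm.Rel.mul_assoc s t u)
  one_mul := by rintro ⟨s⟩; exact sound (HallTerm.Rel.one_mul s)
  mul_one := by rintro ⟨s⟩; exact sound (HallTerm.Rel.mul_one s)
  inv_mul_cancel := by rintro ⟨s⟩; exact sound (HallTerm.Rel.inv_mul_cancel s)

/-- Exponentiation in the free Hall group. -/
instance : Pow (FreeHall R A c) R :=
  ⟨fun g r => Quotient.map (· ^ r) (fun _ _ h => HallTerm.Rel.rpow_congr r h) g⟩

lemma mk_one : (mk 1 : FreeHall R A c) = 1 := rfl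
lemma mk_mul (s t : HallTerm R A) : (mk (s * t) : FreeHall R A c) = mk s * mk t := rfl
lemma mk_inv (s : HallTerm R A) : (mk s⁻¹ : FreeHall R A c) = (mk s)⁻¹ := rfl
lemma mk_rpow (s : HallTerm R A) (r : R) : (mk (s ^ r) : FreeHall R A c) = mk s ^ r := rfl

lemma mk_prod (l : List (HallTerm R A)) : (mk l.prod : FreeHall R A c) = (l.map mk).prod := by
  induction l with
  | nil => rfl
  | cons s l ih => rw [List.prod_cons, mk_mul, ih, List.map_cons, List.prod_cons]

lemma mk_evalWord {n : ℕ} (x : Fin n → HallTerm R A) (w : FreeGroup (Fin n)) :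
    (mk (HallTerm.evalWord x w) : FreeHall R A c) = FreeGroup.lift (fun i => mk (x i)) w := by
  conv_rhs => rw [← FreeGroup.mk_toWord (x := w)]
  rw [FreeGroup.lift_mk, HallTerm.evalWord, mk_prod, List.map_map]
  congr 2
  funext y
  rcases y with ⟨i, _ | _⟩ <;> rfl

end FreeHall

/-- If all left-normed commutators of weight `c + 1` vanish, the group is nilpotent of class at
most `c`. -/
lemma lowerCentralSeries_eq_bot_of_leftNormed {G : Type*} [Group G] (L : (ℕ → G) → ℕ → G)
    (hL0 : ∀ x, L x 0 = x 0)
    (hL : ∀ x k, L x (k + 1) = L x k * x (k + 1) * (L x k)⁻¹ * (x (k + 1))⁻¹)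
    {c : ℕ} (h : ∀ x, L x c = 1) : (⊤ : Subgroup G).lowerCentralSeries c = ⊥ := by
  have hconj : ∀ (g : G) (x : ℕ → G) (k : ℕ), g * L x k * g⁻¹ = L (fun i => g * x i * g⁻¹) k := by
    intro g x k
    induction k with
    | zero => rw [hL0, hL0]
    | succ k ih => rw [hL, hL, ← ih]; group
  have hcongr : ∀ (x y : ℕ → G) (k : ℕ), (∀ i ≤ k, x i = y i) → L x k = L y k := by
    intro x y k hxy
    induction k with
    | zero => rw [hL0, hL0, hxy 0 le_rfl]
    | succ k ih => rw [hL, hL, ih fun i hi => hxy i (by omega), hxy (k + 1) le_rfl]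
  have key : ∀ k, (⊤ : Subgroup G).lowerCentralSeries k ≤
      Subgroup.closure {g | ∃ x, L x k = g} := by
    intro k
    induction k with
    | zero => exact fun g _ => Subgroup.subset_closure ⟨fun _ => g, hL0 _⟩
    | succ k ih =>
      set H := Subgroup.closure {g | ∃ x, L x (k + 1) = g} with hH
      have hn : H.Normal := by
        refine ⟨fun n hn g => ?_⟩
        rw [hH] at hn
        induction hn using Subgroup.closure_induction with
        | mem y hy =>
          obtain ⟨x, rfl⟩ := hy
          exact Subgroup.subset_closure ⟨_, (hconj g x (k + 1)).symm⟩
        | one => simp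
        | mul a b _ _ ha hb =>
          have : g * (a * b) * g⁻¹ = (g * a * g⁻¹) * (g * b * g⁻¹) := by group
          exact this ▸ mul_mem ha hb
        | inv a _ ha =>
          have : g * a⁻¹ * g⁻¹ = (g * a * g⁻¹)⁻¹ := by group
          exact this ▸ inv_mem ha
      rw [Subgroup.lowerCentralSeries_succ, Subgroup.commutator_le]
      intro p hp q _
      have hp' := ih hp
      clear hp
      rw [commutatorElement_def]
      induction hp' using Subgroup.closure_induction with
      | mem g hg =>
        obtain ⟨x, rfl⟩ := hg
        refine Subgroup.subset_closure ⟨fun i => if i = k + 1 then q else x i, ?_⟩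
        rw [hL, hcongr _ x k fun i hi => if_neg (by omega), if_pos rfl]
      | one => simp
      | mul a b _ _ ha hb =>
        have : a * b * q * (a * b)⁻¹ * q⁻¹ =
            (a * (b * q * b⁻¹ * q⁻¹) * a⁻¹) * (a * q * a⁻¹ * q⁻¹) := by group
        exact this ▸ mul_mem (hn.conj_mem _ hb a) ha
      | inv a _ ha =>
        have : a⁻¹ * q * a⁻¹⁻¹ * q⁻¹ = a⁻¹ * (a * q * a⁻¹ * q⁻¹)⁻¹ * a⁻¹⁻¹ := by group
        exact this ▸ hn.conj_mem _ (inv_mem ha) a⁻¹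
  rw [eq_bot_iff]
  refine (key c).trans ?_
  rw [Subgroup.closure_le]
  rintro _ ⟨x, rfl⟩
  simp [h x]

namespace IsHallGroup

lemma mono {R : Type*} [CommRing R] [BinomialRing R] {c d : ℕ} {G : Type*} [Group G] [Pow G R]
    (h : IsHallGroup R c G) (hcd : c ≤ d) : IsHallGroup R d G where
  nilpotent := eq_bot_iff.2 (h.nilpotent ▸ Subgroup.lowerCentralSeries_antitone (⊤ : Subgroup G) hcd)
  rpow_zero := h.rpow_zero
  rpow_one := h.rpow_one
  rpow_add := h.rpow_add
  rpow_mul := h.rpow_mul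
  conj_rpow := h.conj_rpow
  petresco m hm := h.petresco m (hcd.trans hm)

end IsHallGroup

namespace FreeHall

section

variable (R : Type*) [CommRing R] [BinomialRing R] (A : Type*) (c : ℕ)

/-- The free Hall `R`-group of class `c` is a Hall `R`-group of class at most `c`. -/
theorem isHallGroup : IsHallGroup R c (FreeHall R A c) where
  nilpotent := by
    let L : (ℕ → FreeHall R A c) → ℕ → FreeHall R A c := fun x k =>
      Nat.rec (x 0) (fun k y => y * x (k + 1) * y⁻¹ * (x (k + 1))⁻¹) k
    refine lowerCentralSeries_eq_bot_of_leftNormed L (fun _ => rfl) (fun _ _ => rfl) fun x => ?_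
    choose y hy using fun i => mk_surjective (x i)
    have : ∀ k, L x k = mk (HallTerm.leftNormed y k) := by
      intro k
      induction k with
      | zero => exact (hy 0).symm
      | succ k ih =>
        change L x k * x (k + 1) * (L x k)⁻¹ * (x (k + 1))⁻¹ = _
        rw [ih, ← hy (k + 1)]; rfl
    rw [this]
    exact sound (HallTerm.Rel.nilpotent y)
  rpow_zero := by rintro ⟨s⟩; exact sound (HallTerm.Rel.rpow_zero s)
  rpow_one := by rintro ⟨s⟩; exact sound (HallTerm.Rel.rpow_one s)
  rpow_add := by rintro ⟨s⟩ q r; exact sound (HallTerm.Rel.rpow_add s q r)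
  rpow_mul := by rintro ⟨s⟩ q r; exact sound (HallTerm.Rel.rpow_mul s q r)
  conj_rpow := by rintro ⟨s⟩ ⟨t⟩ r; exact sound (HallTerm.Rel.conj_rpow s t r)
  petresco := by
    intro m hm n x r
    choose y hy using fun i => mk_surjective (x i)
    obtain rfl : (fun i => mk (y i)) = x := funext hy
    have h := sound (HallTerm.Rel.petresco m hm n y r)
    simp only [mk_mul, mk_rpow, mk_prod, List.map_ofFn, List.map_map, Function.comp_def,
      mk_evalWord] at h
    exact h

end

section lift

variable {R : Type*} {A : Type*} {G : Type*} [Group G] [Pow G R]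

/-- The value of a term in a group with exponents. -/
def termValue (f : A → G) : HallTerm R A → G
  | .of a => f a
  | .one => 1
  | .mul s t => termValue f s * termValue f t
  | .inv s => (termValue f s)⁻¹
  | .rpow s r => termValue f s ^ r

lemma termValue_prod (f : A → G) (l : List (HallTerm R A)) :
    termValue f l.prod = (l.map (termValue f)).prod := by
  induction l with
  | nil => rfl
  | cons s l ih =>
    rw [List.prod_cons, List.map_cons, List.prod_cons, ← ih]; rfl

lemma termValue_evalWord (f : A → G) {n : ℕ} (x : Fin n → HallTerm R A) (w : FreeGroup (Fin n)) :
    termValue f (HallTerm.evalWord x w) = FreeGroup.lift (fun i => termValue f (x i)) w := by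
  conv_rhs => rw [← FreeGroup.mk_toWord (x := w)]
  rw [FreeGroup.lift_mk, HallTerm.evalWord, termValue_prod, List.map_map]
  congr 2
  funext y
  rcases y with ⟨i, _ | _⟩ <;> rfl

lemma termValue_leftNormed_mem (f : A → G) (x : ℕ → HallTerm R A) (k : ℕ) :
    termValue f (HallTerm.leftNormed x k) ∈ (⊤ : Subgroup G).lowerCentralSeries k := by
  induction k with
  | zero => trivial
  | succ k ih => exact Subgroup.commutator_mem_commutator ih (Subgroup.mem_top _)

variable [CommRing R] [BinomialRing R] {c : ℕ}

lemma termValue_eq_of_rel (hG : IsHallGroup R c G) (f : A → G) {s t : HallTerm R A}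
    (h : HallTerm.Rel c s t) : termValue f s = termValue f t := by
  induction h with
  | refl s => rfl
  | symm _ ih => exact ih.symm
  | trans _ _ ih ih' => exact ih.trans ih'
  | mul_congr _ _ ih ih' => exact congrArg₂ (· * ·) ih ih'
  | inv_congr _ ih => exact congrArg (·⁻¹) ih
  | rpow_congr r _ ih => exact congrArg (· ^ r) ih
  | mul_assoc s t u => exact mul_assoc _ _ _
  | one_mul s => exact one_mul _
  | mul_one s => exact mul_one _
  | inv_mul_cancel s => exact inv_mul_cancel _
  | nilpotent x =>
    have h := termValue_leftNormed_mem f x c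
    rw [hG.nilpotent, Subgroup.mem_bot] at h
    exact h
  | rpow_zero s => exact hG.rpow_zero _
  | rpow_one s => exact hG.rpow_one _
  | rpow_add s q r => exact hG.rpow_add _ q r
  | rpow_mul s q r => exact hG.rpow_mul _ q r
  | conj_rpow s t r => exact hG.conj_rpow _ _ r
  | petresco m hm n x r =>
    have h := hG.petresco m hm n (fun i => termValue f (x i)) r
    change _ = termValue f (List.ofFn x).prod ^ r * termValue f (List.prod _)
    simp only [termValue_prod, List.map_ofFn, List.map_map, Function.comp_def]
    refine h.trans (congrArg₂ (· * ·) rfl (congrArg List.prod (List.map_congr_left fun k _ => ?_)))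
    exact congrArg (· ^ Ring.choose r k) (termValue_evalWord f x _).symm

/-- The universal property of the free Hall `R`-group: the homomorphism to a Hall `R`-group of
class at most `c` that extends a given map on the generators. -/
def lift (hG : IsHallGroup R c G) (f : A → G) : FreeHall R A c →* G where
  toFun := Quotient.lift (termValue f) fun _ _ h => termValue_eq_of_rel hG f h
  map_one' := rfl
  map_mul' := by rintro ⟨s⟩ ⟨t⟩; rfl

lemma lift_of (hG : IsHallGroup R c G) (f : A → G) (a : A) :
    lift hG f (of a : FreeHall R A c) = f a := rfl

lemma lift_rpow (hG : IsHallGroup R c G) (f : A → G) (g : FreeHall R A c) (r : R) :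
    lift hG f (g ^ r) = lift hG f g ^ r := by
  obtain ⟨s, rfl⟩ := mk_surjective g; rfl

end lift

/-- The natural homomorphism `F(A, R, c + 1) → F(A, R, c)`, which fixes the generators. -/
def transition (R : Type*) [CommRing R] [BinomialRing R] (A : Type*) (c : ℕ) :
    FreeHall R A (c + 1) →* FreeHall R A c :=
  lift ((isHallGroup R A c).mono c.le_succ) of

end FreeHall

/-! ### The free pro-Hall `R`-group -/

/-- The free pro-Hall `R`-group on `A`, the inverse limit of the free Hall `R`-groups `F(A, R, c)`
(with the trivial group in degree `c = 0`). -/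
def proHall (R : Type*) [CommRing R] [BinomialRing R] (A : Type*) :
    Subgroup (∀ c, FreeHall R A c) where
  carrier := {g | ∀ c, FreeHall.transition R A c (g (c + 1)) = g c}
  one_mem' _ := map_one _
  mul_mem' hg hh c := by rw [Pi.mul_apply, map_mul, hg c, hh c]; rfl
  inv_mem' hg c := by rw [Pi.inv_apply, map_inv, hg c]; rfl

/-- The free pro-Hall `R`-group on `A`. -/
abbrev ProHall (R : Type*) [CommRing R] [BinomialRing R] (A : Type*) : Type _ := ↥(proHall R A)

/-! ### The free pro-`p` group -/

/-- The normal subgroups of `p`-power index in the free group on `A`. -/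
abbrev PIndex (p : ℕ) (A : Type*) : Type _ :=
  {N : Subgroup (FreeGroup A) // N.Normal ∧ ∃ k : ℕ, N.index = p ^ k}

instance (p : ℕ) (A : Type*) (N : PIndex p A) : N.1.Normal := N.2.1

/-- The free pro-`p` group on a finite set `A`, as the inverse limit of the finite `p`-quotients of
the free group on `A`. -/
def freeProP (p : ℕ) (A : Type*) : Subgroup (∀ N : PIndex p A, FreeGroup A ⧸ N.1) where
  carrier := {g | ∀ (N M : PIndex p A) (h : N.1 ≤ M.1),
    QuotientGroup.map N.1 M.1 (MonoidHom.id _) h (g N) = g M}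
  one_mem' _ _ _ := map_one _
  mul_mem' hg hh N M h := by rw [Pi.mul_apply, map_mul, hg N M h, hh N M h]; rfl
  inv_mem' hg N M h := by rw [Pi.inv_apply, map_inv, hg N M h]; rfl

/-- The free pro-`p` group on `A`. -/
abbrev FreeProP (p : ℕ) (A : Type*) : Type _ := ↥(freeProP p A)

namespace FreeProP

/-- The canonical map from the free group to the free pro-`p` group. -/
def ofFreeGroup (p : ℕ) (A : Type*) : FreeGroup A →* FreeProP p A where
  toFun w := ⟨fun _ => (w : FreeGroup A ⧸ _), fun _ _ _ => rfl⟩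
  map_one' := rfl
  map_mul' _ _ := rfl

/-- The power `g ^ β` with a `p`-adic integer exponent: in a finite quotient of order `p ^ k` it is
the power with exponent `β` modulo `p ^ k`. -/
noncomputable def padicPow {p : ℕ} [Fact p.Prime] {A : Type*} (g : FreeProP p A) (β : ℤ_[p]) :
    FreeProP p A :=
  ⟨fun N => g.1 N ^ β.appr (Nat.log p N.1.index), by
    intro N M h
    have hp : 1 < p := (Fact.out : p.Prime).one_lt
    obtain ⟨k, hk⟩ := N.2.2
    obtain ⟨l, hl⟩ := M.2.2
    have hlk : l ≤ k := (Nat.pow_dvd_pow_iff_le_right hp).1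
      (by rw [← hk, ← hl]; exact Subgroup.index_dvd_of_le h)
    have hM : g.1 M ^ p ^ l = 1 := by
      rw [← hl, Subgroup.index_eq_card]; exact pow_card_eq_one'
    obtain ⟨d, hd⟩ := β.dvd_appr_sub_appr l k hlk
    change _ = g.1 M ^ β.appr (Nat.log p M.1.index)
    rw [map_pow, g.2 N M h, hk, hl, Nat.log_pow hp, Nat.log_pow hp,
      ← Nat.sub_add_cancel (β.appr_mono hlk), pow_add, hd, pow_mul, hM, one_pow, one_mul]⟩

end FreeProP

/-! ### Basic commutators and normal forms -/

/-- The value of a formal (bracketed) commutator in a group, with `[x, y] = x⁻¹y⁻¹xy`. -/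
def commValue {G : Type*} [Group G] {A : Type*} (f : A → G) : FreeMagma A → G
  | .of a => f a
  | .mul u v => (commValue f u)⁻¹ * (commValue f v)⁻¹ * commValue f u * commValue f v

lemma finite_length_le {A : Type*} [Finite A] (c : ℕ) : {t : FreeMagma A | t.length ≤ c}.Finite := by
  induction c with
  | zero =>
    refine Set.finite_empty.subset fun t ht => ?_
    have := t.length_pos
    simp only [Set.mem_ofPred_eq] at ht
    omega
  | succ c ih =>
    refine ((Set.finite_range FreeMagma.of).union (ih.image2 FreeMagma.mul ih)).subset ?_
    rintro (a | ⟨u, v⟩) ht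
    · exact Or.inl ⟨a, rfl⟩
    · have hu := u.length_pos
      have hv := v.length_pos
      have ht' : u.length + v.length ≤ c + 1 := ht
      exact Or.inr ⟨u, by simp only [Set.mem_ofPred_eq]; omega, v,
        by simp only [Set.mem_ofPred_eq]; omega, rfl⟩

section Basic

variable {A : Type*} [LinearOrder (FreeMagma A)]

/-- Hall's basic commutators with respect to a linear order of the formal commutators: the letters
are basic, and `[u, v]` is basic if `u` and `v` are, `u < v`, and `s ≤ u` in case `v = [s, t]`. -/
def IsBasic : FreeMagma A → Prop
  | .of _ => True
  | .mul u v => IsBasic u ∧ IsBasic v ∧ u < v ∧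
      match v with
      | .of _ => True
      | .mul s _ => s ≤ u

variable (A) in
/-- The type of basic commutators on `A`. -/
abbrev BasicComm : Type _ := {b : FreeMagma A // IsBasic b}

variable (A) in
/-- The basic commutators of weight at most `c`, in increasing order. -/
noncomputable def basicList [Finite A] (c : ℕ) : List (BasicComm A) :=
  (((finite_length_le (A := A) c).preimage
    (Subtype.val_injective (p := IsBasic)).injOn).toFinset).sort (· ≤ ·)

variable [Finite A]

/-- `g = ∏ b ^ α_b`, the ordered product over all basic commutators `b`, in the free pro-Hall
`R`-group: modulo commutators of weight greater than `c`, the element `g` is the product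
over the basic commutators of weight at most `c`, for each `c`. -/
def IsHallNormalForm {R : Type*} [CommRing R] [BinomialRing R] (g : ProHall R A)
    (α : BasicComm A → R) : Prop :=
  ∀ c, g.1 c = ((basicList A c).map fun b => commValue FreeHall.of b.1 ^ α b).prod

/-- `h = ∏ b ^ β_b`, the ordered product over all basic commutators `b`, in the free pro-`p` group:
the products over the basic commutators of weight at most `c` converge to `h` as `c → ∞`, that is,
in each finite `p`-quotient they are eventually equal to `h`. -/
def IsPadicNormalForm {p : ℕ} [Fact p.Prime] (h : FreeProP p A) (β : BasicComm A → ℤ_[p]) : Prop :=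
  ∀ N : PIndex p A, ∀ᶠ c in Filter.atTop, h.1 N =
    (((basicList A c).map fun b => FreeProP.padicPow
      (commValue (fun a => FreeProP.ofFreeGroup p A (FreeGroup.of a)) b.1) (β b)).prod).1 N

end Basic

/-! A homomorphism `f : S →+* ℤ_[p]` of binomial rings respects binomial coefficients, so it induces
a homomorphism from the free pro-Hall group over `S` to the one over `ℤ_[p]` that applies `f` to
every exponent of a normal form. The latter group is the free pro-`p` group. Two different elements
differ in some exponent, so a finite set is mapped injectively as soon as `f` separates finitely
many exponents. Three points carry this argument.

Rings. A homomorphism `R →+* ℤ_[p]` extends to the binomial closure because `ℤ_[p]` is itself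
binomial (`BinClosure.exists_extend`). Multiplication by nonzero integers moves a finite separation
problem from the closure back to `R` (`BinClosure.exists_finset_injOn`).

Normal forms. For existence, the lower central series is closed up under exponentiation
(`hallSeries`), and a Jacobi-type argument shows that the basic commutators of each weight span the
corresponding factor (`hallSeries_le_levelSubgroup_of_generates`). Uniqueness is tested over `ℤ_[p]`
in finite `p`-groups. The Magnus map `a ↦ 1 + a` into truncated noncommutative series over `ℤ/p^e`
sends a basic commutator to `1` plus its Lie element plus higher terms, and the basic Lie elements
of a given weight are independent by Lazard elimination (`injective_lift_lieValue`,
`exists_levelProd_ne`).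

Comparison. Finite `p`-quotients of the free group are Hall groups over `ℤ_[p]`: the Petresco
identity for natural exponents follows from `petrescoWord_mem`, and it passes to `p`-adic exponents
by density and continuity (`isHallGroup_padicInt`). The resulting map to the free pro-`p` group is
injective because finite `p`-quotients determine the exponents, and surjective because the space of
exponent families is compact. -/

open scoped commutatorElement

/-! ### Commutators of subgroups -/

namespace Subgroup

lemma commutator_le_iff_map_mk_eq_bot {G : Type*} [Group G] (M : Subgroup G) [M.Normal]
    (H K : Subgroup G) :
    ⁅H, K⁆ ≤ M ↔ ⁅H.map (QuotientGroup.mk' M), K.map (QuotientGroup.mk' M)⁆ = ⊥ := by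
  rw [← map_commutator, map_eq_bot_iff, QuotientGroup.ker_mk']

/-- The three subgroups lemma modulo a normal subgroup. -/
lemma commutator_commutator_le_of_rotate {G : Type*} [Group G] {M : Subgroup G} [M.Normal]
    {H₁ H₂ H₃ : Subgroup G} (h1 : ⁅⁅H₂, H₃⁆, H₁⁆ ≤ M) (h2 : ⁅⁅H₃, H₁⁆, H₂⁆ ≤ M) :
    ⁅⁅H₁, H₂⁆, H₃⁆ ≤ M := by
  rw [commutator_le_iff_map_mk_eq_bot, map_commutator] at *
  exact commutator_commutator_eq_bot_of_rotate h1 h2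

lemma map_mem_top_lowerCentralSeries {G H : Type*} [Group G] [Group H] (f : G →* H) {n : ℕ} {x : G}
    (hx : x ∈ (⊤ : Subgroup G).lowerCentralSeries n) :
    f x ∈ (⊤ : Subgroup H).lowerCentralSeries n :=
  lowerCentralSeries_mono n le_top (map_lowerCentralSeries (⊤ : Subgroup G) f n ▸
    mem_map_of_mem f hx)

/-- Induction on `i` for all `j` at once: the three subgroups lemma trades a commutator with `⊤` in
the first argument for one in the second argument or on the outside. -/
lemma commutator_top_lowerCentralSeries_le {G : Type*} [Group G] (i j : ℕ) :
    ⁅(⊤ : Subgroup G).lowerCentralSeries i, (⊤ : Subgroup G).lowerCentralSeries j⁆ ≤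
      (⊤ : Subgroup G).lowerCentralSeries (i + j + 1) := by
  induction i generalizing j with
  | zero => rw [commutator_comm, Nat.zero_add]; exact le_rfl
  | succ i ih =>
    rw [lowerCentralSeries_succ]
    refine commutator_commutator_le_of_rotate ?_ ?_
    · rw [commutator_comm, commutator_comm ⊤]
      exact (ih (j + 1)).trans_eq (congrArg _ (by omega))
    · rw [commutator_comm ((⊤ : Subgroup G).lowerCentralSeries j)]
      exact (commutator_mono (ih j) le_rfl).trans_eq
        ((lowerCentralSeries_succ _ _).symm.trans (congrArg _ (by omega)))

end Subgroup

/-! ### Polynomial sequences in filtered groups and the Hall–Petresco theorem -/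

section PolySeq

variable {G : Type*} [Group G]

/-- The difference `n ↦ f(n)⁻¹ f(n+1)` of a sequence. -/
def seqDiff (f : ℕ → G) : ℕ → G := f⁻¹ * fun n => f (n + 1)

lemma seqDiff_apply (f : ℕ → G) (n : ℕ) : seqDiff f n = (f n)⁻¹ * f (n + 1) := rfl

/-- The sequence `f` is polynomial with respect to the filtration `H`, shifted by `s`, as far as
its first `k` differences are concerned: the `j`-th difference has values in `H (s + j)`. -/
def IsPolySeq (H : ℕ → Subgroup G) : ℕ → ℕ → (ℕ → G) → Prop
  | 0, s, f => ∀ n, f n ∈ H s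
  | k + 1, s, f => (∀ n, f n ∈ H s) ∧ IsPolySeq H k (s + 1) (seqDiff f)

namespace IsPolySeq

variable {H : ℕ → Subgroup G} {k s t : ℕ} {f g : ℕ → G}

lemma mono_left (h : IsPolySeq H (k + 1) s f) : IsPolySeq H k s f := by
  induction k generalizing s f with
  | zero => exact h.1
  | succ k ih => exact ⟨h.1, ih h.2⟩

lemma mono_right (hH : Antitone H) (hts : t ≤ s) (h : IsPolySeq H k s f) : IsPolySeq H k t f := by
  induction k generalizing s t f with
  | zero => exact fun n => hH hts (h n)
  | succ k ih => exact ⟨fun n => hH hts (h.1 n), ih (Nat.succ_le_succ hts) h.2⟩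

lemma const_one : IsPolySeq H k s 1 := by
  induction k generalizing s with
  | zero => exact fun _ => one_mem _
  | succ k ih =>
    refine ⟨fun _ => one_mem _, ?_⟩
    convert ih using 1
    funext n
    simp [seqDiff_apply]

/-- Polynomial sequences are closed under products, inverses and commutators. -/
lemma closure_aux (hH : Antitone H) (hc : ∀ i j, ⁅H i, H j⁆ ≤ H (i + j)) (k : ℕ) :
    (∀ s f g, IsPolySeq H k s f → IsPolySeq H k s g → IsPolySeq H k s (f * g)) ∧
    (∀ s f, IsPolySeq H k s f → IsPolySeq H k s f⁻¹) ∧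
    (∀ s t f g, IsPolySeq H k s f → IsPolySeq H k t g → IsPolySeq H k (s + t) (f * g * f⁻¹ * g⁻¹)) := by
  -- The three statements need each other: the difference of a product or an inverse involves a
  -- conjugate, and a conjugate is a commutator times the sequence.
  induction k with
  | zero =>
    exact ⟨fun s f g hf hg n => mul_mem (hf n) (hg n), fun s f hf n => inv_mem (hf n),
      fun s t f g hf hg n => hc s t (Subgroup.commutator_mem_commutator (hf n) (hg n))⟩
  | succ k ih =>
    obtain ⟨hmul, hinv, hcomm⟩ := ih
    have hconj : ∀ {s t f g}, IsPolySeq H k s f → IsPolySeq H k t g →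
        IsPolySeq H k t (f * g * f⁻¹) := by
      intro s t f g hf hg
      have : f * g * f⁻¹ = f * g * f⁻¹ * g⁻¹ * g := by group
      rw [this]
      exact hmul _ _ _ ((hcomm _ _ _ _ hf hg).mono_right hH (by omega)) hg
    refine ⟨fun s f g hf hg => ⟨fun n => mul_mem (hf.1 n) (hg.1 n), ?_⟩,
      fun s f hf => ⟨fun n => inv_mem (hf.1 n), ?_⟩, fun s t f g hf hg =>
      ⟨fun n => hc s t (Subgroup.commutator_mem_commutator (hf.1 n) (hg.1 n)), ?_⟩⟩
    · have : seqDiff (f * g) = g⁻¹ * seqDiff f * g⁻¹⁻¹ * seqDiff g := by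
        funext n; simp [seqDiff_apply, mul_assoc]
      rw [this]
      exact hmul _ _ _ (hconj (hinv _ _ hg.mono_left) hf.2) hg.2
    · have : seqDiff f⁻¹ = f * (seqDiff f)⁻¹ * f⁻¹ := by
        funext n; simp [seqDiff_apply, mul_assoc]
      rw [this]
      exact hconj hf.mono_left (hinv _ _ hf.2)
    · let X := f * g * f⁻¹ * g⁻¹
      set d := seqDiff f with hd
      set e := seqDiff g with he
      -- Expansion with `f (n + 1) = f n * d n` and `g (n + 1) = g n * e n`. Each factor is a
      -- conjugate of a commutator containing `d` or `e`, which supplies the additional shift by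
      -- one.
      have key : seqDiff X = ((X⁻¹ * f) * ((d * g * d⁻¹ * g⁻¹) * (g * (d * e * d⁻¹ * e⁻¹) * g⁻¹)) *
          (X⁻¹ * f)⁻¹) * (g * (f * e * f⁻¹ * e⁻¹) * g⁻¹) := by
        funext n
        simp only [seqDiff_apply, X, hd, he, Pi.mul_apply, Pi.inv_apply]
        group
      change IsPolySeq H k _ (seqDiff X)
      rw [key]
      have hf' := hf.mono_left
      have hg' := hg.mono_left
      refine hmul _ _ _ ?_ (hconj hg' ((hcomm _ _ _ _ hf' hg.2).mono_right hH (by omega)))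
      have h1 : IsPolySeq H k (s + t + 1) ((d * g * d⁻¹ * g⁻¹) * (g * (d * e * d⁻¹ * e⁻¹) * g⁻¹)) :=
        hmul _ _ _ ((hcomm _ _ _ _ hf.2 hg').mono_right hH (by omega))
          (hconj hg' ((hcomm _ _ _ _ hf.2 hg.2).mono_right hH (by omega)))
      have hX : IsPolySeq H k 0 (X⁻¹ * f) :=
        hmul _ _ _ (hinv _ _ ((hcomm _ _ _ _ hf' hg').mono_right hH (by omega)))
          (hf'.mono_right hH (by omega))
      exact hconj hX h1

/-- By Pascal's rule the difference of `n ↦ x ^ n.choose (l + 1)` is `n ↦ x ^ n.choose l`, so `l`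
drops by one while the shift grows by one. For `l = 0` the sequence is constant. -/
lemma pow_choose (hH : Antitone H) {x : G} {l : ℕ} (hx : x ∈ H (s + l)) :
    IsPolySeq H k s fun n => x ^ n.choose l := by
  induction k generalizing s l with
  | zero => exact fun n => pow_mem (hH (Nat.le_add_right _ _) hx) _
  | succ k ih =>
    refine ⟨fun n => pow_mem (hH (Nat.le_add_right _ _) hx) _, ?_⟩
    cases l with
    | zero =>
      convert! const_one using 1
      funext n
      simp [seqDiff_apply]
    | succ l =>
      have h := ih (s := s + 1) (l := l) (by rwa [add_assoc, add_comm 1 l])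
      convert! h using 1
      funext n
      rw [seqDiff_apply, Nat.choose_succ_succ, Nat.succ_eq_add_one, pow_add,
        (Commute.pow_pow_self x _ _).eq, inv_mul_cancel_left]

/-- If `f` is trivial before `k`, its `k`-th difference at `0` is `f k`. -/
lemma apply_mem_of_eq_one (h : IsPolySeq H k s f) (h1 : ∀ i < k, f i = 1) : f k ∈ H (s + k) := by
  induction k generalizing s f with
  | zero => exact h 0
  | succ k ih =>
    have := ih h.2 fun i hi => by
      rw [seqDiff_apply, h1 i (by omega), h1 (i + 1) (by omega), inv_one, one_mul]
    rw [seqDiff_apply, h1 k (by omega), inv_one, one_mul] at this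
    convert this using 2
    omega

end IsPolySeq

end PolySeq

section Petresco

/-- The case `m = i + 1` is the defining recursion; the further factors have exponent `0`. -/
lemma prod_petrescoWord_pow_choose (n i m : ℕ) (h : i < m) :
    (List.ofFn fun k : Fin m => petrescoWord n k ^ i.choose k).prod =
      (List.ofFn fun j : Fin n => FreeGroup.of j ^ i).prod := by
  induction m, h using Nat.le_induction with
  | base =>
    rw [List.ofFn_succ', List.concat_eq_append, List.prod_append]
    simp only [Fin.val_castSucc, Fin.val_last, Nat.choose_self, pow_one, List.prod_singleton]
    conv_lhs => rw [petrescoWord.eq_1 n i]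
    rw [mul_inv_cancel_left]
  | succ m hm ih =>
    rw [List.ofFn_succ', List.concat_eq_append, List.prod_append]
    simp only [Fin.val_castSucc, Fin.val_last, List.prod_singleton]
    rw [ih, Nat.choose_eq_zero_of_lt (by omega), pow_zero, mul_one]

/-- **Hall–Petresco theorem**: the `k`-th Petresco word lies in the `k`-th term of the lower
central series (the indices of Mathlib's lower central series start with `0`). -/
theorem petrescoWord_mem (n k : ℕ) :
    petrescoWord n k ∈ (⊤ : Subgroup (FreeGroup (Fin n))).lowerCentralSeries (k - 1) := by
  induction k using Nat.strong_induction_on with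
  | _ k ih =>
    -- Truncated subtraction makes both `H 0` and `H 1` the whole group, so `H s` is the `s`-th term
    -- in the classical numbering.
    let H : ℕ → Subgroup (FreeGroup (Fin n)) := fun s =>
      (⊤ : Subgroup (FreeGroup (Fin n))).lowerCentralSeries (s - 1)
    have hH : Antitone H := fun a b hab => Subgroup.lowerCentralSeries_antitone _ (by omega)
    have hc : ∀ i j, ⁅H i, H j⁆ ≤ H (i + j) := by
      intro i j
      cases i with
      | zero => exact (Subgroup.commutator_le_right _ _).trans_eq (by simp [H])
      | succ i =>
        cases j with
        | zero => exact Subgroup.commutator_le_left _ _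
        | succ j =>
          refine (Subgroup.commutator_top_lowerCentralSeries_le _ _).trans_eq ?_
          exact congrArg _ (by omega)
    obtain ⟨hmul, hinv, -⟩ := IsPolySeq.closure_aux hH hc k
    have hprod : ∀ (m : ℕ) (F : Fin m → ℕ → FreeGroup (Fin n)),
        (∀ j, IsPolySeq H k 0 (F j)) → IsPolySeq H k 0 fun i => (List.ofFn fun j => F j i).prod := by
      intro m F hF
      induction m with
      | zero => exact (IsPolySeq.const_one : IsPolySeq H k 0 (1 : ℕ → FreeGroup (Fin n)))
      | succ m ih =>
        simp only [List.ofFn_succ, List.prod_cons]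
        exact hmul _ _ _ (hF 0) (ih _ fun j => hF j.succ)
    -- `Q` measures the failure of the recursion when only the words of index below `k` are used: it
    -- is trivial before `k`, and its value at `k` is the `k`-th Petresco word.
    let Q : ℕ → FreeGroup (Fin n) := (fun i => (List.ofFn fun l : Fin k =>
      petrescoWord n l ^ i.choose l).prod)⁻¹ * fun i =>
        (List.ofFn fun j : Fin n => FreeGroup.of j ^ i).prod
    have hQ : IsPolySeq H k 0 Q := by
      refine hmul _ _ _ (hinv _ _ (hprod _ (fun (l : Fin k) i => petrescoWord n l ^ i.choose l)
        fun l => ?_)) (hprod _ (fun j i => FreeGroup.of j ^ i) fun j => ?_)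
      · exact IsPolySeq.pow_choose hH (by rw [Nat.zero_add]; exact ih l l.2)
      · have : IsPolySeq H k 0 fun i => (FreeGroup.of j : FreeGroup (Fin n)) ^ i.choose 1 :=
          IsPolySeq.pow_choose hH (Subgroup.mem_top _)
        simpa using this
    have h1 : ∀ i < k, Q i = 1 := fun i hi => by
      change (List.ofFn fun l : Fin k => petrescoWord n l ^ i.choose l).prod⁻¹ * _ = 1
      rw [prod_petrescoWord_pow_choose n i k hi, inv_mul_cancel]
    have := hQ.apply_mem_of_eq_one h1
    rw [Nat.zero_add] at this
    have hk : Q k = petrescoWord n k := by rw [petrescoWord]; rfl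
    rwa [hk] at this

/-- In a group of class at most `c`, the Petresco words of index greater than `c` vanish. -/
lemma lift_petrescoWord_eq_one {G : Type*} [Group G] {c : ℕ}
    (hG : (⊤ : Subgroup G).lowerCentralSeries c = ⊥) {n k : ℕ} (hk : c < k) (x : Fin n → G) :
    FreeGroup.lift x (petrescoWord n k) = 1 := by
  have h := Subgroup.lowerCentralSeries_antitone (⊤ : Subgroup G) (show c ≤ k - 1 by omega)
    (Subgroup.map_mem_top_lowerCentralSeries (FreeGroup.lift x) (petrescoWord_mem n k))
  rwa [hG, Subgroup.mem_bot] at h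

/-- The Petresco identity for natural exponents in a nilpotent group. -/
lemma prod_pow_eq_petresco {G : Type*} [Group G] {c : ℕ}
    (hG : (⊤ : Subgroup G).lowerCentralSeries c = ⊥) {m : ℕ} (hm : c ≤ m) (n : ℕ) (x : Fin n → G)
    (i : ℕ) :
    (List.ofFn fun j => x j ^ i).prod = (List.ofFn x).prod ^ i *
      ((List.Ico 2 (m + 1)).map fun k =>
        FreeGroup.lift x (petrescoWord n k) ^ i.choose k).prod := by
  -- The bound exceeds `i`, so the identity is exact, and exceeds `m`, beyond which nilpotency kills
  -- the factors. The summand `2` ensures that the factors of index `0` and `1` can be split off.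
  have key := congrArg (FreeGroup.lift x)
    (prod_petrescoWord_pow_choose n i (max i m + 2) (by omega))
  rw [map_list_prod, map_list_prod, List.map_ofFn, List.map_ofFn] at key
  simp only [Function.comp_def, map_pow, FreeGroup.lift_apply_of] at key
  let g : ℕ → G := fun k => FreeGroup.lift x (petrescoWord n k) ^ i.choose k
  have h1 : (List.ofFn fun k : Fin (max i m + 2) => g k) = (List.range (max i m + 2)).map g := by
    rw [List.ofFn_eq_map, ← List.map_coe_finRange_eq_range, List.map_map]; rfl
  have h2 : ∀ M, m + 1 ≤ M → ((List.Ico 2 M).map g).prod = ((List.Ico 2 (m + 1)).map g).prod := by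
    intro M hM
    induction M, hM using Nat.le_induction with
    | base => rfl
    | succ M hM ih =>
      by_cases h : 2 ≤ M
      · rw [List.Ico.succ_top h, List.map_append, List.prod_append, ih]
        simp [g, lift_petrescoWord_eq_one hG (show c < M by omega)]
      · rw [List.Ico.eq_nil_of_le (by omega), List.Ico.eq_nil_of_le (by omega)]
  have h0 : petrescoWord n 0 = 1 := by rw [petrescoWord]; simp
  have h01 : petrescoWord n 1 = (List.ofFn fun j : Fin n => FreeGroup.of j).prod := by
    rw [petrescoWord]; simp [h0]
  rw [← key, h1, ← h2 (max i m + 2) (by omega), ← List.Ico.zero_bot,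
    List.Ico.eq_cons (by omega), List.Ico.eq_cons (by omega)]
  simp [g, h0, h01, map_list_prod, List.map_ofFn, Function.comp_def]

end Petresco

/-! ### Subgroups of Hall groups that are closed under exponentiation -/

/-- A commuting pair kills all Petresco words except the first one. -/
lemma lift_petrescoWord_of_commute {G : Type*} [Group G] {x y : G} (h : Commute x y) (k : ℕ) :
    FreeGroup.lift ![x, y] (petrescoWord 2 k) = if k = 1 then x * y else 1 := by
  induction k using Nat.strong_induction_on with
  | _ k ih =>
    rw [petrescoWord, map_mul, map_inv, map_list_prod, map_list_prod, List.map_ofFn, List.map_ofFn]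
    simp only [Function.comp_def, map_pow, FreeGroup.lift_apply_of]
    have : (fun i : Fin k => FreeGroup.lift ![x, y] (petrescoWord 2 i) ^ k.choose i) =
        fun i : Fin k => (if (i : ℕ) = 1 then x * y else 1) ^ k.choose i := by
      funext i
      rw [ih i i.2]
    rw [this]
    match k with
    | 0 => simp
    | 1 => simp
    | k + 2 => simp [List.ofFn_succ, h.mul_pow, List.ofFn_const, mul_assoc]

/-- A subgroup closed under exponentiation with exponents in `S`. -/
def IsPowClosed (S : Type*) {G : Type*} [Group G] [Pow G S] (H : Subgroup G) : Prop :=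
  ∀ x ∈ H, ∀ r : S, x ^ r ∈ H

/-- The elements that commute with `y` modulo the normal subgroup `M`. -/
def centralizerMod {G : Type*} [Group G] (M : Subgroup G) [M.Normal] (y : G) : Subgroup G :=
  (Subgroup.centralizer {(y : G ⧸ M)}).comap (QuotientGroup.mk' M)

lemma mem_centralizerMod {G : Type*} [Group G] {M : Subgroup G} [M.Normal] {x y : G} :
    x ∈ centralizerMod M y ↔ Commute (x : G ⧸ M) (y : G ⧸ M) := by
  simp only [centralizerMod, Subgroup.mem_comap, Subgroup.mem_centralizer_singleton_iff]
  rfl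

lemma mem_centralizerMod_iff_commutator {G : Type*} [Group G] {M : Subgroup G} [M.Normal]
    {x y : G} : x ∈ centralizerMod M y ↔ ⁅x, y⁆ ∈ M := by
  rw [mem_centralizerMod, ← commutatorElement_eq_one_iff_commute, ← QuotientGroup.eq_one_iff]
  rfl

lemma mem_centralizerMod_iff_inv {G : Type*} [Group G] {M : Subgroup G} [M.Normal]
    {x y : G} : x ∈ centralizerMod M y ↔ x⁻¹ * y⁻¹ * x * y ∈ M := by
  rw [mem_centralizerMod, ← QuotientGroup.eq_one_iff, ← Commute.inv_inv_iff,
    ← commutatorElement_eq_one_iff_commute, commutatorElement_def, inv_inv, inv_inv]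
  rfl

namespace IsHallGroup

variable {S : Type*} [CommRing S] [BinomialRing S] {c : ℕ} {G : Type*} [Group G] [Pow G S]

lemma one_rpow (hG : IsHallGroup S c G) (r : S) : (1 : G) ^ r = 1 := by
  rw [← hG.rpow_zero 1, ← hG.rpow_mul, zero_mul]

lemma rpow_neg (hG : IsHallGroup S c G) (x : G) (r : S) : x ^ (-r) = (x ^ r)⁻¹ := by
  rw [eq_inv_iff_mul_eq_one, ← hG.rpow_add, neg_add_cancel, hG.rpow_zero]

lemma inv_rpow (hG : IsHallGroup S c G) (x : G) (r : S) : x⁻¹ ^ r = (x ^ r)⁻¹ := by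
  have h : x⁻¹ = x ^ (-1 : S) := by rw [hG.rpow_neg, hG.rpow_one]
  rw [h, ← hG.rpow_mul, neg_one_mul, hG.rpow_neg]

/-- Exponentiation distributes over the product of two elements which commute modulo a normal
subgroup closed under exponentiation. -/
lemma mk_mul_rpow (hG : IsHallGroup S c G) {M : Subgroup G} [M.Normal] (hM : IsPowClosed S M)
    {x y : G} (h : Commute (x : G ⧸ M) (y : G ⧸ M)) (r : S) :
    (((x * y) ^ r : G) : G ⧸ M) = ((x ^ r : G) : G ⧸ M) * ((y ^ r : G) : G ⧸ M) := by
  -- Modulo `M` the pair commutes, so its Petresco words of index at least `2` lie in `M`, and so do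
  -- their powers because `M` is closed under exponentiation.
  have hp := hG.petresco c le_rfl 2 ![x, y] r
  simp only [List.ofFn_succ, List.ofFn_zero, List.prod_cons, List.prod_nil, mul_one,
    Matrix.cons_val_zero, Matrix.cons_val_succ] at hp
  rw [← QuotientGroup.mk_mul, hp, QuotientGroup.mk_mul, left_eq_mul, QuotientGroup.eq_one_iff]
  refine Subgroup.list_prod_mem _ fun z hz => ?_
  obtain ⟨k, hk, rfl⟩ := List.mem_map.1 hz
  refine hM _ ?_ _
  rw [← QuotientGroup.eq_one_iff]
  have h1 : ((FreeGroup.lift ![x, y] (petrescoWord 2 k) : G) : G ⧸ M) =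
      FreeGroup.lift ![(x : G ⧸ M), (y : G ⧸ M)] (petrescoWord 2 k) := by
    change ((QuotientGroup.mk' M).comp (FreeGroup.lift ![x, y])) _ = _
    congr 1
    ext i
    fin_cases i <;> simp
  rw [h1, lift_petrescoWord_of_commute h, if_neg]
  have := (List.Ico.mem.1 hk).1
  omega

/-- Conjugating `x ^ r` by `y` gives `(x * m) ^ r` with `m ∈ M`, and `m` is trivial modulo `M`, so
the power splits as `x ^ r` times an element of `M`. This is what makes subgroups defined by
commutator conditions closed under exponentiation. -/
lemma isPowClosed_centralizerMod (hG : IsHallGroup S c G) {M : Subgroup G} [M.Normal]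
    (hM : IsPowClosed S M) (y : G) : IsPowClosed S (centralizerMod M y) := by
  intro x hx r
  have h := mem_centralizerMod_iff_inv.1 hx
  rw [mem_centralizerMod] at hx ⊢
  set m := x⁻¹ * y⁻¹ * x * y with hm
  have hc : y⁻¹ * x ^ r * y = (x * m) ^ r := by
    rw [hG.conj_rpow, hm]; congr 1; group
  have hm1 : (m : G ⧸ M) = 1 := (QuotientGroup.eq_one_iff m).2 h
  have hmr : ((m ^ r : G) : G ⧸ M) = 1 := (QuotientGroup.eq_one_iff _).2 (hM m h r)
  have := congrArg (QuotientGroup.mk (s := M)) hc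
  rw [hG.mk_mul_rpow hM (hm1 ▸ Commute.one_right _), hmr, mul_one] at this
  change (y : G ⧸ M)⁻¹ * ((x ^ r : G) : G ⧸ M) * (y : G ⧸ M) = _ at this
  rw [mul_assoc, inv_mul_eq_iff_eq_mul] at this
  exact this

/-- A subgroup closed under exponentiation generated by a set and a normal closed subgroup. -/
lemma isPowClosed_closure (hG : IsHallGroup S c G) {M : Subgroup G} [M.Normal]
    (hM : IsPowClosed S M) {B : Set G} (hB : ∀ b ∈ B, ∀ r : S, b ^ r ∈ Subgroup.closure B)
    (hMB : M ≤ Subgroup.closure B)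
    (hcomm : ∀ x ∈ Subgroup.closure B, ∀ y ∈ Subgroup.closure B,
      Commute (x : G ⧸ M) (y : G ⧸ M)) :
    IsPowClosed S (Subgroup.closure B) := by
  intro x hx r
  induction hx using Subgroup.closure_induction with
  | mem x hx => exact hB x hx r
  | one => rw [hG.one_rpow]; exact one_mem _
  | mul x y hx hy ihx ihy =>
    have h := hG.mk_mul_rpow hM (hcomm x hx y hy) r
    rw [← QuotientGroup.mk_mul, eq_comm, QuotientGroup.eq] at h
    have := mul_mem (mul_mem ihx ihy) (hMB h)
    rwa [mul_inv_cancel_left] at this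
  | inv x hx ih => rw [hG.inv_rpow]; exact inv_mem ih

end IsHallGroup

/-! ### The lower central series of a Hall group -/

section HallSeries

variable (S : Type*) {G : Type*} [Group G] [Pow G S]

/-- The lower central series of a group with exponents: each term is the smallest normal subgroup
closed under exponentiation that contains the commutators of the preceding term with the group. -/
def hallSeries : ℕ → Subgroup G
  | 0 => ⊤
  | n + 1 => sInf {K | K.Normal ∧ IsPowClosed S K ∧ ⁅hallSeries n, (⊤ : Subgroup G)⁆ ≤ K}

instance hallSeries_normal (n : ℕ) : (hallSeries S n : Subgroup G).Normal := by
  cases n with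
  | zero => exact inferInstanceAs (⊤ : Subgroup G).Normal
  | succ n =>
    refine ⟨fun x hx g => ?_⟩
    rw [hallSeries, Subgroup.mem_sInf] at hx ⊢
    exact fun K hK => hK.1.conj_mem x (hx K hK) g

lemma isPowClosed_hallSeries (n : ℕ) : IsPowClosed S (hallSeries S n : Subgroup G) := by
  cases n with
  | zero => exact fun _ _ _ => Subgroup.mem_top _
  | succ n =>
    intro x hx r
    rw [hallSeries, Subgroup.mem_sInf] at hx ⊢
    exact fun K hK => hK.2.1 x (hx K hK) r

lemma commutator_hallSeries_top_le (n : ℕ) :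
    ⁅(hallSeries S n : Subgroup G), (⊤ : Subgroup G)⁆ ≤ hallSeries S (n + 1) :=
  le_sInf fun _ hK => hK.2.2

variable {S} in
lemma hallSeries_succ_le {n : ℕ} {K : Subgroup G} (hn : K.Normal) (hK : IsPowClosed S K)
    (h : ⁅(hallSeries S n : Subgroup G), (⊤ : Subgroup G)⁆ ≤ K) : hallSeries S (n + 1) ≤ K :=
  sInf_le ⟨hn, hK, h⟩

lemma hallSeries_antitone : Antitone (hallSeries S : ℕ → Subgroup G) :=
  antitone_nat_of_succ_le fun n => hallSeries_succ_le (hallSeries_normal S n) (isPowClosed_hallSeries S n)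
    (Subgroup.commutator_le_left _ _)

variable {S} [CommRing S] [BinomialRing S] {c : ℕ}

namespace IsHallGroup

lemma isPowClosed_upperCentralSeries (hG : IsHallGroup S c G) (n : ℕ) :
    IsPowClosed S (Subgroup.upperCentralSeries G n) := by
  induction n with
  | zero =>
    intro x hx r
    rw [Subgroup.upperCentralSeries_zero, Subgroup.mem_bot] at *
    rw [hx, hG.one_rpow]
  | succ n ih =>
    intro x hx r
    rw [Subgroup.mem_upperCentralSeries_succ_iff] at *
    intro y
    rw [← mem_centralizerMod_iff_commutator]
    exact hG.isPowClosed_centralizerMod ih y x (mem_centralizerMod_iff_commutator.2 (hx y)) r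

/-- Closing up under exponentiation does not destroy nilpotency: the terms of the upper central
series are already closed, so read backwards they bound this series from above. -/
lemma hallSeries_eq_bot (hG : IsHallGroup S c G) : hallSeries S c = (⊥ : Subgroup G) := by
  have htop := Subgroup.lowerCentralSeries_eq_bot_iff_upperCentralSeries_eq_top.1 hG.nilpotent
  have h : ∀ n ≤ c, (hallSeries S n : Subgroup G) ≤ Subgroup.upperCentralSeries G (c - n) := by
    intro n hn
    induction n with
    | zero => rw [Nat.sub_zero, htop]; exact le_top
    | succ n ih =>
      refine hallSeries_succ_le inferInstance (hG.isPowClosed_upperCentralSeries _) ?_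
      refine (Subgroup.commutator_mono (ih (by omega)) le_rfl).trans ?_
      rw [show c - n = c - (n + 1) + 1 by omega]
      exact Subgroup.commutator_upperCentralSeries_top_le G _
  simpa using h c le_rfl

lemma commutator_hallSeries_le (hG : IsHallGroup S c G) (i j : ℕ) :
    ⁅(hallSeries S i : Subgroup G), (hallSeries S j : Subgroup G)⁆ ≤ hallSeries S (i + j + 1) := by
  induction i generalizing j with
  | zero =>
    rw [Subgroup.commutator_comm, Nat.zero_add]
    exact commutator_hallSeries_top_le S j
  | succ i ih =>
    set M : Subgroup G := hallSeries S (i + 1 + j + 1)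
    -- The three subgroups lemma only controls the commutators that generate `hallSeries S (i + 1)`.
    -- The intersection of centralizers modulo `M` is normal and closed under exponentiation, so by
    -- minimality it contains the whole term.
    have key : (hallSeries S (i + 1) : Subgroup G) ≤ ⨅ y : (hallSeries S j : Subgroup G),
        centralizerMod M (y : G) := by
      refine hallSeries_succ_le ⟨fun x hx g => ?_⟩ (fun x hx r => ?_) ?_
      · rw [Subgroup.mem_iInf] at *
        rintro ⟨y, hy⟩
        have := hx ⟨g⁻¹ * y * g, by
          simpa using (hallSeries_normal S j).conj_mem y hy g⁻¹⟩
        rw [mem_centralizerMod] at this ⊢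
        simp only [QuotientGroup.mk_mul, QuotientGroup.mk_inv] at this ⊢
        have h2 := (Commute.conj_iff (g : G ⧸ M)).2 this
        simpa [mul_assoc] using! h2
      · rw [Subgroup.mem_iInf] at *
        exact fun y => hG.isPowClosed_centralizerMod (isPowClosed_hallSeries S _) y x (hx y) r
      · refine le_iInf fun y z hz => mem_centralizerMod_iff_commutator.2 ?_
        have : ⁅⁅(hallSeries S i : Subgroup G), (⊤ : Subgroup G)⁆, (hallSeries S j : Subgroup G)⁆ ≤ M := by
          refine Subgroup.commutator_commutator_le_of_rotate ?_ ?_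
          · rw [Subgroup.commutator_comm ⊤, Subgroup.commutator_comm]
            refine (Subgroup.commutator_mono le_rfl (commutator_hallSeries_top_le S j)).trans
              ((ih (j + 1)).trans_eq (congrArg _ (by omega)))
          · rw [Subgroup.commutator_comm (hallSeries S j)]
            exact (Subgroup.commutator_mono (ih j) le_rfl).trans
              ((commutator_hallSeries_top_le S _).trans_eq (congrArg _ (by omega)))
        exact this (Subgroup.commutator_mem_commutator hz y.2)
    refine Subgroup.commutator_le.2 fun x hx y hy => ?_
    rw [← mem_centralizerMod_iff_commutator]
    exact (Subgroup.mem_iInf.1 (key hx)) ⟨y, hy⟩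

end IsHallGroup

end HallSeries

/-! ### Ordered products of basic commutators -/

section BasicProd

variable {A : Type*} [LinearOrder (FreeMagma A)] [Finite A]

variable (A) in
/-- The basic commutators of weight exactly `w`, in increasing order. -/
noncomputable def levelList (w : ℕ) : List (BasicComm A) :=
  ((((finite_length_le (A := A) w).preimage
    (Subtype.val_injective (p := IsBasic)).injOn).toFinset).filter fun b => b.1.length = w).sort
      (· ≤ ·)

lemma mem_basicList {c : ℕ} {b : BasicComm A} : b ∈ basicList A c ↔ b.1.length ≤ c := by
  simp [basicList]

lemma mem_levelList {w : ℕ} {b : BasicComm A} : b ∈ levelList A w ↔ b.1.length = w := by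
  simp only [levelList, Finset.mem_sort, Finset.mem_filter, Set.Finite.mem_toFinset,
    Set.mem_preimage, Set.mem_ofPred_eq, and_iff_right_iff_imp]
  exact fun h => h.le

lemma nodup_levelList (w : ℕ) : (levelList A w).Nodup := Finset.sort_nodup _ _

lemma basicList_succ (hord : ∀ u v : FreeMagma A, u.length < v.length → u < v) (c : ℕ) :
    basicList A (c + 1) = basicList A c ++ levelList A (c + 1) := by
  refine List.Perm.eq_of_pairwise' (r := (· ≤ ·)) (Finset.pairwise_sort _ _) ?_ ?_
  · refine List.pairwise_append.2 ⟨Finset.pairwise_sort _ _, Finset.pairwise_sort _ _, ?_⟩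
    intro a ha b hb
    rw [mem_basicList] at ha
    rw [mem_levelList] at hb
    exact (hord a.1 b.1 (by omega)).le
  · refine (List.perm_ext_iff_of_nodup (Finset.sort_nodup _ _) ?_).2 fun b => ?_
    · refine List.nodup_append'.2 ⟨Finset.sort_nodup _ _, nodup_levelList _, fun a ha hb => ?_⟩
      rw [mem_basicList] at ha
      rw [mem_levelList] at hb
      omega
    · change b ∈ basicList A (c + 1) ↔ _
      rw [List.mem_append, mem_levelList, mem_basicList, mem_basicList]
      omega

variable {S G : Type*} [Group G] [Pow G S]

/-- The ordered product of powers of the basic commutators of weight at most `c`. -/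
noncomputable def basicProd (f : A → G) (α : BasicComm A → S) (c : ℕ) : G :=
  ((basicList A c).map fun b => commValue f b.1 ^ α b).prod

/-- The ordered product of powers of the basic commutators of weight `w`. -/
noncomputable def levelProd (f : A → G) (α : BasicComm A → S) (w : ℕ) : G :=
  ((levelList A w).map fun b => commValue f b.1 ^ α b).prod

lemma basicProd_succ (hord : ∀ u v : FreeMagma A, u.length < v.length → u < v) (f : A → G)
    (α : BasicComm A → S) (c : ℕ) :
    basicProd f α (c + 1) = basicProd f α c * levelProd f α (c + 1) := by
  rw [basicProd, basicList_succ hord, List.map_append, List.prod_append]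
  rfl

lemma basicProd_congr (f : A → G) {α β : BasicComm A → S} {c : ℕ}
    (h : ∀ b, b.1.length ≤ c → α b = β b) : basicProd f α c = basicProd f β c := by
  refine congrArg List.prod (List.map_congr_left fun b hb => ?_)
  rw [h b (mem_basicList.1 hb)]

lemma levelProd_congr (f : A → G) {α β : BasicComm A → S} {w : ℕ}
    (h : ∀ b, b.1.length = w → α b = β b) : levelProd f α w = levelProd f β w := by
  refine congrArg List.prod (List.map_congr_left fun b hb => ?_)
  rw [h b (mem_levelList.1 hb)]

end BasicProd

/-! ### Homomorphic images of commutators, list products, and commuting modulo a subgroup -/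

lemma map_commValue {G H A : Type*} [Group G] [Group H] (ψ : G →* H) (f : A → G) (t : FreeMagma A) :
    ψ (commValue f t) = commValue (fun a => ψ (f a)) t := by
  induction t with
  | ih1 a => rfl
  | ih2 u v hu hv =>
    change ψ ((commValue f u)⁻¹ * (commValue f v)⁻¹ * commValue f u * commValue f v) = _
    rw [map_mul, map_mul, map_mul, map_inv, map_inv, hu, hv]
    rfl

lemma List.prod_map_mul_of_commute {ι M : Type*} [Monoid M] (l : List ι) (f g : ι → M)
    (h : ∀ i ∈ l, ∀ j ∈ l, Commute (f i) (g j)) :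
    (l.map fun i => f i * g i).prod = (l.map f).prod * (l.map g).prod := by
  induction l with
  | nil => simp
  | cons a l ih =>
    have hc : Commute (l.map f).prod (g a) := by
      refine Commute.list_prod_left _ _ fun x hx => ?_
      obtain ⟨i, hi, rfl⟩ := List.mem_map.1 hx
      exact h i (by simp [hi]) a (by simp)
    rw [List.map_cons, List.prod_cons, List.map_cons, List.prod_cons, List.map_cons,
      List.prod_cons, ih fun i hi j hj => h i (by simp [hi]) j (by simp [hj]), mul_assoc, mul_assoc,
      ← mul_assoc (g a), ← hc.eq, mul_assoc]

lemma List.prod_map_eq_of_nodup {ι M : Type*} [Monoid M] {l : List ι} (hl : l.Nodup) {i : ι}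
    (hi : i ∈ l) {f : ι → M} (hf : ∀ j, j ≠ i → f j = 1) : (l.map f).prod = f i := by
  obtain ⟨l₁, l₂, rfl⟩ := List.append_of_mem hi
  rw [List.nodup_middle, List.nodup_cons, List.mem_append, not_or] at hl
  have h : ∀ l' : List ι, i ∉ l' → (l'.map f).prod = 1 := fun l' hl' =>
    List.prod_eq_one fun x hx => by
      obtain ⟨j, hj, rfl⟩ := List.mem_map.1 hx
      exact hf j fun h => hl' (h ▸ hj)
  rw [List.map_append, List.prod_append, List.map_cons, List.prod_cons, h _ hl.1.1, h _ hl.1.2,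
    one_mul, mul_one]

/-- If `u` commutes with `s` and `t` up to sufficiently central elements, it commutes with the
commutator of `s` and `t`. -/
lemma Commute.commutator_right_of_commute {Q : Type*} [Group Q] {s t u p q z : Q}
    (hp : p = s⁻¹ * u⁻¹ * s * u) (hq : q = t⁻¹ * u⁻¹ * t * u) (hz : z = s⁻¹ * t⁻¹ * s * t)
    (hpt : Commute p t) (hpq : Commute p q) (hqs : Commute q s) (hzp : Commute z p)
    (hzq : Commute z q) : Commute u z := by
  -- Conjugation by `u` replaces `s` by `s * p` and `t` by `t * q`; the remaining hypotheses allow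
  -- `p` and `q` to be moved out of the commutator and cancelled.
  have h1 : u⁻¹ * z * u = (s * p)⁻¹ * (t * q)⁻¹ * (s * p) * (t * q) := by
    rw [hz, hp, hq]; group
  have h2 : (s * p)⁻¹ * (t * q)⁻¹ * (s * p) * (t * q) = p⁻¹ * q⁻¹ * z * (q * p) := by
    have e1 : p * (t * q) = t * q * p := (hpt.mul_right hpq).eq
    have e2 : s⁻¹ * q⁻¹ = q⁻¹ * s⁻¹ := hqs.symm.inv_inv.eq
    calc _ = p⁻¹ * (s⁻¹ * q⁻¹) * t⁻¹ * s * (p * (t * q)) := by group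
      _ = _ := by rw [e1, e2, hz]; group
  have h3 : p⁻¹ * q⁻¹ * z * (q * p) = z := by
    have : z * (q * p) = q * p * z := (hzq.mul_right hzp).eq
    rw [mul_assoc, this]; group
  rw [h2, h3] at h1
  have := congrArg (u * ·) h1
  simp only [← mul_assoc, mul_inv_cancel, one_mul] at this
  exact this.symm

lemma mem_centralizerMod_comm {G : Type*} [Group G] {M : Subgroup G} [M.Normal] {x y : G} :
    x ∈ centralizerMod M y ↔ y ∈ centralizerMod M x := by
  rw [mem_centralizerMod, mem_centralizerMod]
  exact Commute.symm_iff

/-! ### Basic commutators span the factors of the series -/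

section Span

variable (S : Type*) [CommRing S] [BinomialRing S] {c : ℕ} {G : Type*} [Group G] [Pow G S]
  {A : Type*} [LinearOrder (FreeMagma A)] (f : A → G)

omit [LinearOrder (FreeMagma A)] in
lemma commValue_mem_hallSeries {S : Type*} [CommRing S] [BinomialRing S] [Pow G S]
    (hG : IsHallGroup S c G) (f : A → G) (t : FreeMagma A) :
    commValue f t ∈ (hallSeries S (t.length - 1) : Subgroup G) := by
  induction t with
  | ih1 a => exact Subgroup.mem_top _
  | ih2 u v hu hv =>
    have hu' := u.length_pos
    have hv' := v.length_pos
    have h := hG.commutator_hallSeries_le _ _ (Subgroup.commutator_mem_commutator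
      (inv_mem hu) (inv_mem hv))
    rw [commutatorElement_def, inv_inv, inv_inv] at h
    have e : u.length - 1 + (v.length - 1) + 1 = (u * v).length - 1 := by
      change _ = u.length + v.length - 1
      omega
    rwa [e] at h

/-- The subgroup generated by the powers of the basic commutators of weight `n + 1` and the
term of the series that contains the commutators of weight greater than `n + 1`. -/
def levelSubgroup (n : ℕ) : Subgroup G :=
  Subgroup.closure ({x | ∃ b, IsBasic b ∧ b.length = n + 1 ∧ ∃ r : S, commValue f b ^ r = x} ∪
    (hallSeries S (n + 1) : Subgroup G))

variable {S f}

omit [CommRing S] [BinomialRing S] in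
lemma hallSeries_le_levelSubgroup (n : ℕ) : hallSeries S (n + 1) ≤ levelSubgroup S f n :=
  fun _ hx => Subgroup.subset_closure (Or.inr hx)

lemma commValue_mem_levelSubgroup (hG : IsHallGroup S c G) {n : ℕ} {b : FreeMagma A}
    (hb : IsBasic b) (hn : b.length = n + 1) : commValue f b ∈ levelSubgroup S f n :=
  Subgroup.subset_closure (Or.inl ⟨b, hb, hn, 1, hG.rpow_one _⟩)

lemma levelSubgroup_le (hG : IsHallGroup S c G) (n : ℕ) :
    levelSubgroup S f n ≤ hallSeries S n := by
  refine (Subgroup.closure_le _).2 ?_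
  rintro x (⟨b, -, hn, r, rfl⟩ | hx)
  · have := commValue_mem_hallSeries hG f b
    rw [hn, Nat.add_sub_cancel] at this
    exact isPowClosed_hallSeries S n _ this r
  · exact hallSeries_antitone S n.le_succ hx

lemma levelSubgroup_normal (hG : IsHallGroup S c G) (n : ℕ) : (levelSubgroup S f n).Normal := by
  refine ⟨fun x hx g => ?_⟩
  have : g * x * g⁻¹ = ⁅x, g⁆⁻¹ * x := by rw [commutatorElement_def]; group
  rw [this]
  exact mul_mem (inv_mem (hallSeries_le_levelSubgroup n (commutator_hallSeries_top_le S n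
    (Subgroup.commutator_mem_commutator (levelSubgroup_le hG n hx) (Subgroup.mem_top g))))) hx

lemma commute_mk_of_mem_levelSubgroup (hG : IsHallGroup S c G) {n : ℕ} {x y : G}
    (hx : x ∈ levelSubgroup S f n) (hy : y ∈ levelSubgroup S f n) :
    Commute (x : G ⧸ (hallSeries S (n + 1) : Subgroup G)) y := by
  rw [← mem_centralizerMod, mem_centralizerMod_iff_commutator]
  exact hallSeries_antitone S (by omega) (hG.commutator_hallSeries_le n n
    (Subgroup.commutator_mem_commutator (levelSubgroup_le hG n hx) (levelSubgroup_le hG n hy)))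

lemma isPowClosed_levelSubgroup (hG : IsHallGroup S c G) (n : ℕ) :
    IsPowClosed S (levelSubgroup S f n) := by
  refine hG.isPowClosed_closure (isPowClosed_hallSeries S (n + 1)) ?_
    (hallSeries_le_levelSubgroup n) fun x hx y hy => commute_mk_of_mem_levelSubgroup hG hx hy
  rintro x (⟨b, hb, hn, r, rfl⟩ | hx) s
  · exact Subgroup.subset_closure (Or.inl ⟨b, hb, hn, r * s, hG.rpow_mul _ _ _⟩)
  · exact Subgroup.subset_closure (Or.inr (isPowClosed_hallSeries S _ x hx s))

lemma mem_centralizerMod_of_mem_hallSeries (hG : IsHallGroup S c G) {i j n : ℕ} {x y : G}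
    [(levelSubgroup S f n).Normal] (hx : x ∈ (hallSeries S i : Subgroup G))
    (hy : y ∈ (hallSeries S j : Subgroup G)) (h : n ≤ i + j) :
    x ∈ centralizerMod (levelSubgroup S f n) y := by
  rw [mem_centralizerMod_iff_commutator]
  exact hallSeries_le_levelSubgroup n (hallSeries_antitone S (by omega)
    (hG.commutator_hallSeries_le i j (Subgroup.commutator_mem_commutator hx hy)))

/-- Centralizers modulo a closed normal subgroup are closed under exponentiation, so only the basic
commutators among the generators need checking; the deeper part of `levelSubgroup S f i` is settled
by weight. -/
lemma mem_centralizerMod_of_mem_levelSubgroup (hG : IsHallGroup S c G) {i j n : ℕ} {x y : G}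
    [(levelSubgroup S f n).Normal] (hx : x ∈ levelSubgroup S f i)
    (hy : y ∈ (hallSeries S j : Subgroup G)) (h : n ≤ i + 1 + j)
    (hb : ∀ b : FreeMagma A, IsBasic b → b.length = i + 1 →
      commValue f b ∈ centralizerMod (levelSubgroup S f n) y) :
    x ∈ centralizerMod (levelSubgroup S f n) y := by
  refine ((Subgroup.closure_le _).2 ?_ : levelSubgroup S f i ≤ _) hx
  rintro x (⟨b, hb', hn, r, rfl⟩ | hx)
  · exact hG.isPowClosed_centralizerMod (isPowClosed_levelSubgroup hG n) y _ (hb b hb' hn) r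
  · exact mem_centralizerMod_of_mem_hallSeries hG hx hy h

/-- The commutator of two basic commutators is a product of powers of basic commutators, up to
commutators of greater weight. -/
lemma commValue_mem_centralizerMod [Finite A] (hG : IsHallGroup S c G)
    (hord : ∀ u v : FreeMagma A, u.length < v.length → u < v) (n : ℕ)
    [hN : ∀ n, (levelSubgroup S f n).Normal] {u v : FreeMagma A} (hu : IsBasic u) (hv : IsBasic v)
    (huv : u.length + v.length = n + 2) :
    commValue f u ∈ centralizerMod (levelSubgroup S f (n + 1)) (commValue f v) := by
  induction n using Nat.strong_induction_on generalizing u v with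
  | _ n ihn =>
  -- Besides the outer induction on the total weight there is an inner one on the number `k` of
  -- formal commutators of length at most `n + 2` above `u`: the argument passes to pairs whose
  -- members are both larger than `u`.
  have main : ∀ k, ∀ u v : FreeMagma A, IsBasic u → IsBasic v → u.length + v.length = n + 2 →
      u < v → {x : FreeMagma A | x.length ≤ n + 2 ∧ u < x}.ncard = k →
      commValue f u ∈ centralizerMod (levelSubgroup S f (n + 1)) (commValue f v) := by
    intro k
    induction k using Nat.strong_induction_on with
    | _ k ihk =>
    intro u v hu hv huv hlt hk
    have ih : ∀ x y, IsBasic x → IsBasic y → x.length + y.length = n + 2 → u < x → u < y →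
        commValue f x ∈ centralizerMod (levelSubgroup S f (n + 1)) (commValue f y) := by
      have aux : ∀ x y, IsBasic x → IsBasic y → x.length + y.length = n + 2 → u < x → x < y →
          commValue f x ∈ centralizerMod (levelSubgroup S f (n + 1)) (commValue f y) := by
        intro x y hx hy hxy hux hxy'
        refine ihk _ ?_ x y hx hy hxy hxy' rfl
        rw [← hk]
        refine Set.ncard_lt_ncard ?_ ((finite_length_le (A := A) (n + 2)).subset fun x hx => hx.1)
        refine (Set.ssubset_iff_of_subset ?_).2 ⟨x, ⟨by omega, hux⟩, fun h => lt_irrefl _ h.2⟩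
        exact fun z hz => ⟨hz.1, hux.trans hz.2⟩
      intro x y hx hy hxy hux huy
      rcases lt_trichotomy x y with h | rfl | h
      · exact aux x y hx hy hxy hux h
      · exact mem_centralizerMod.2 (Commute.refl _)
      · exact mem_centralizerMod_comm.1 (aux y x hy hx (by omega) huy h)
    by_cases hb : IsBasic (u * v)
    · rw [mem_centralizerMod_iff_inv]
      exact commValue_mem_levelSubgroup hG hb huv
    match v, hv, huv, hlt, hb with
    | .of a, hv, huv, hlt, hb => exact (hb (show IsBasic (FreeMagma.mul u (.of a)) from ⟨hu, hv, hlt, trivial⟩)).elim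
    | .mul s t, hv, huv, hlt, hb =>
      -- Since `[u, [s, t]]` is not basic, `u < s < t`. As in the Jacobi identity, it is reduced to
      -- the brackets of `[s, u]` with `t` and of `[t, u]` with `s`, where every entry exceeds `u`.
      have hus : u < s := by
        by_contra h
        exact hb (show IsBasic (FreeMagma.mul u (.mul s t)) from ⟨hu, hv, hlt, not_lt.1 h⟩)
      obtain ⟨hs, ht, hst, -⟩ := hv
      have hut := hus.trans hst
      have lu := u.length_pos
      have ls := s.length_pos
      have lt := t.length_pos
      change u.length + (s.length + t.length) = n + 2 at huv
      -- The outer induction expands `[x, u]` in basic commutators of the same weight. These are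
      -- longer than `x`, hence larger than `x` in the order, and the inner induction applies to
      -- them.
      have hbr : ∀ x, IsBasic x → x.length + u.length < n + 2 →
          commValue f (x * u) ∈ levelSubgroup S f (x.length + u.length - 1) := by
        intro x hx hxu
        have lx := x.length_pos
        have := ihn (x.length + u.length - 2) (by omega) (u := x) (v := u) hx hu (by omega)
        rw [mem_centralizerMod_iff_inv] at this
        rwa [show x.length + u.length - 2 + 1 = x.length + u.length - 1 by omega] at this
      have hp := hbr s hs (by omega)
      have hq := hbr t ht (by omega)
      have hz := commValue_mem_hallSeries hG f (s * t)
      have ezl : (s * t).length = s.length + t.length := rfl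
      rw [ezl] at hz
      have hp' := levelSubgroup_le hG _ hp
      have hq' := levelSubgroup_le hG _ hq
      rw [mem_centralizerMod]
      refine Commute.commutator_right_of_commute
        (p := ((commValue f (s * u) : G) : G ⧸ levelSubgroup S f (n + 1)))
        (q := ((commValue f (t * u) : G) : G ⧸ levelSubgroup S f (n + 1)))
        (s := ((commValue f s : G) : G ⧸ levelSubgroup S f (n + 1)))
        (t := ((commValue f t : G) : G ⧸ levelSubgroup S f (n + 1)))
        rfl rfl rfl ?_ ?_ ?_ ?_ ?_
      · rw [← mem_centralizerMod]
        refine mem_centralizerMod_of_mem_levelSubgroup hG hp (commValue_mem_hallSeries hG f t)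
          (by omega) fun b hb hbl => ih b t hb ht (by omega) ?_ hut
        exact hus.trans (hord _ _ (by omega))
      · rw [← mem_centralizerMod]
        exact mem_centralizerMod_of_mem_hallSeries hG hp' hq' (by omega)
      · rw [← mem_centralizerMod]
        refine mem_centralizerMod_of_mem_levelSubgroup hG hq (commValue_mem_hallSeries hG f s)
          (by omega) fun b hb hbl => ih b s hb hs (by omega) ?_ hus
        exact hut.trans (hord _ _ (by omega))
      · rw [← mem_centralizerMod]
        exact mem_centralizerMod_of_mem_hallSeries hG hz hp' (by omega)
      · rw [← mem_centralizerMod]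
        exact mem_centralizerMod_of_mem_hallSeries hG hz hq' (by omega)
  rcases lt_trichotomy u v with h | rfl | h
  · exact main _ u v hu hv huv h rfl
  · exact mem_centralizerMod.2 (Commute.refl _)
  · exact mem_centralizerMod_comm.1 (main _ v u hv hu (by omega) h rfl)

/-- If `G` is generated by the values of the letters, the basic commutators of weight `n + 1`
span the corresponding factor of the series. -/
lemma hallSeries_le_levelSubgroup_of_generates [Finite A] (hG : IsHallGroup S c G)
    (hord : ∀ u v : FreeMagma A, u.length < v.length → u < v)
    (hgen : ∀ K : Subgroup G, IsPowClosed S K → (∀ a, f a ∈ K) → K = ⊤) (n : ℕ) :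
    hallSeries S n ≤ levelSubgroup S f n := by
  have hN : ∀ n, (levelSubgroup S f n).Normal := levelSubgroup_normal hG
  have h0 : levelSubgroup S f 0 = ⊤ := hgen _ (isPowClosed_levelSubgroup hG 0) fun a =>
    commValue_mem_levelSubgroup hG (b := .of a) trivial rfl
  induction n with
  | zero => rw [h0]; exact le_top
  | succ n ih =>
    refine hallSeries_succ_le (hN _) (isPowClosed_levelSubgroup hG _) ?_
    refine Subgroup.commutator_le.2 fun x hx y hy => ?_
    rw [← mem_centralizerMod_iff_commutator]
    -- Both arguments of the commutator are reduced to generators: `x` to basic commutators of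
    -- weight `n + 1`, and then `y` to those of weight one, which generate because level `0` is
    -- everything.
    refine mem_centralizerMod_of_mem_levelSubgroup hG (j := 0) (ih hx) (Subgroup.mem_top _)
      (by omega) fun b hb hbl => mem_centralizerMod_comm.1 ?_
    have hyt : y ∈ levelSubgroup S f 0 := h0 ▸ hy
    refine mem_centralizerMod_of_mem_levelSubgroup hG hyt (commValue_mem_hallSeries hG f b)
      (by omega) fun a ha hal => ?_
    exact commValue_mem_centralizerMod hG hord n ha hb (by omega)

variable [Finite A]

lemma mk_levelProd_add (hG : IsHallGroup S c G) (α β : BasicComm A → S) (n : ℕ) :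
    ((levelProd f (α + β) (n + 1) : G) : G ⧸ (hallSeries S (n + 1) : Subgroup G)) =
      (levelProd f α (n + 1) : G) * (levelProd f β (n + 1) : G) := by
  have key : ∀ α : BasicComm A → S,
      ((levelProd f α (n + 1) : G) : G ⧸ (hallSeries S (n + 1) : Subgroup G)) =
      ((levelList A (n + 1)).map fun b => ((commValue f b.1 ^ α b : G) :
        G ⧸ (hallSeries S (n + 1) : Subgroup G))).prod := by
    intro α
    rw [levelProd, ← QuotientGroup.mk'_apply, map_list_prod, List.map_map]
    rfl
  rw [key, key, key, ← List.prod_map_mul_of_commute]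
  · refine congrArg List.prod (List.map_congr_left fun b _ => ?_)
    rw [Pi.add_apply, hG.rpow_add, QuotientGroup.mk_mul]
  · intro b hb b' hb'
    exact commute_mk_of_mem_levelSubgroup (f := f) hG
      (isPowClosed_levelSubgroup hG n _ (commValue_mem_levelSubgroup hG b.2 (mem_levelList.1 hb)) _)
      (isPowClosed_levelSubgroup hG n _
        (commValue_mem_levelSubgroup hG b'.2 (mem_levelList.1 hb')) _)

lemma levelProd_zero (hG : IsHallGroup S c G) (n : ℕ) : levelProd f (0 : BasicComm A → S) n = 1 := by
  refine List.prod_eq_one fun x hx => ?_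
  obtain ⟨b, -, rfl⟩ := List.mem_map.1 hx
  exact hG.rpow_zero _

lemma exists_mk_eq_levelProd (hG : IsHallGroup S c G) {n : ℕ} {x : G}
    (hx : x ∈ levelSubgroup S f n) : ∃ α : BasicComm A → S,
      (x : G ⧸ (hallSeries S (n + 1) : Subgroup G)) = (levelProd f α (n + 1) : G) := by
  classical
  induction hx using Subgroup.closure_induction with
  | mem x hx =>
    rcases hx with ⟨b, hb, hn, r, rfl⟩ | hx
    · refine ⟨Pi.single ⟨b, hb⟩ r, congrArg _ ?_⟩
      rw [levelProd, List.prod_map_eq_of_nodup (nodup_levelList _) (i := ⟨b, hb⟩)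
        (mem_levelList.2 hn), Pi.single_eq_same]
      intro b' hb'
      rw [Pi.single_eq_of_ne hb', hG.rpow_zero]
    · refine ⟨0, ?_⟩
      rw [levelProd_zero hG, (QuotientGroup.eq_one_iff x).2 hx]
      rfl
  | one => exact ⟨0, by rw [levelProd_zero hG]⟩
  | mul x y _ _ hx hy =>
    obtain ⟨α, hα⟩ := hx
    obtain ⟨β, hβ⟩ := hy
    exact ⟨α + β, by rw [mk_levelProd_add hG, QuotientGroup.mk_mul, hα, hβ]⟩
  | inv x _ hx =>
    obtain ⟨α, hα⟩ := hx
    refine ⟨-α, ?_⟩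
    rw [QuotientGroup.mk_inv, hα, inv_eq_iff_mul_eq_one, ← mk_levelProd_add hG, add_neg_cancel,
      levelProd_zero hG]
    rfl

/-- Every element of a Hall group is an ordered product of powers of basic commutators in a
generating set. -/
theorem IsHallGroup.exists_eq_basicProd (hG : IsHallGroup S c G)
    (hord : ∀ u v : FreeMagma A, u.length < v.length → u < v)
    (hgen : ∀ K : Subgroup G, IsPowClosed S K → (∀ a, f a ∈ K) → K = ⊤) (g : G) :
    ∃ α : BasicComm A → S, g = basicProd f α c := by
  -- Successive approximation: the error in the `n`-th term of the series is removed by choosing the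
  -- exponents of weight `n + 1`, and lower exponents stay fixed.
  have h : ∀ n, ∃ α : BasicComm A → S, (basicProd f α n)⁻¹ * g ∈ (hallSeries S n : Subgroup G) := by
    intro n
    induction n with
    | zero => exact ⟨0, Subgroup.mem_top _⟩
    | succ n ih =>
      obtain ⟨α, hα⟩ := ih
      obtain ⟨β, hβ⟩ := exists_mk_eq_levelProd hG
        (hallSeries_le_levelSubgroup_of_generates hG hord hgen n hα)
      refine ⟨fun b => if b.1.length ≤ n then α b else β b, ?_⟩
      rw [basicProd_succ hord, basicProd_congr f (β := α) (fun b hb => if_pos hb),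
        levelProd_congr f (β := β) (fun b hb => if_neg (by omega)), mul_inv_rev, mul_assoc,
        ← QuotientGroup.eq]
      exact hβ.symm
  obtain ⟨α, hα⟩ := h c
  rw [hG.hallSeries_eq_bot, Subgroup.mem_bot, inv_mul_eq_one] at hα
  exact ⟨α, hα.symm⟩

end Span

/-! ### Linear independence of the basic Lie elements in the free associative algebra -/

/-- The value of a formal commutator in an associative ring, with `[x, y] = xy - yx`. -/
def lieValue {B A : Type*} [Ring B] (f : A → B) : FreeMagma A → B
  | .of a => f a
  | .mul u v => lieValue f u * lieValue f v - lieValue f v * lieValue f u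

lemma map_lieValue {B C A : Type*} [Ring B] [Ring C] (g : B →+* C) (f : A → B) (t : FreeMagma A) :
    g (lieValue f t) = lieValue (fun a => g (f a)) t := by
  induction t with
  | ih1 a => rfl
  | ih2 u v hu hv =>
    change g (lieValue f u * lieValue f v - lieValue f v * lieValue f u) = _
    rw [map_sub, map_mul, map_mul, hu, hv]
    rfl

/-- A derivation `D` is the same as an algebra homomorphism `x ↦ x + ε D x` to the trivial
square-zero extension, and homomorphisms from the free algebra may be prescribed on generators. -/
lemma FreeAlgebra.exists_derivation {k X : Type*} [CommRing k] (d : X → FreeAlgebra k X) :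
    ∃ D : FreeAlgebra k X →ₗ[k] FreeAlgebra k X, (∀ x, D (FreeAlgebra.ι k x) = d x) ∧
      ∀ x y, D (x * y) = x * D y + D x * y := by
  let B := FreeAlgebra k X
  let θ : B →ₐ[k] TrivSqZeroExt B B :=
    FreeAlgebra.lift k fun x => TrivSqZeroExt.inl (FreeAlgebra.ι k x) + TrivSqZeroExt.inr (d x)
  have hθ : ∀ x, (θ x).fst = x := by
    intro x
    have : (TrivSqZeroExt.fstHom k B B).comp θ = AlgHom.id k B := by
      ext x
      simp only [θ, Function.comp_apply, AlgHom.comp_apply, FreeAlgebra.lift_ι_apply]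
      simp
      rfl
    exact DFunLike.congr_fun this x
  refine ⟨(TrivSqZeroExt.sndHom B B).restrictScalars k ∘ₗ θ.toLinearMap, fun x => ?_,
    fun x y => ?_⟩
  · simp [θ]
  · simp [hθ]

section LieIndependence

variable {A : Type*} [LinearOrder (FreeMagma A)]

/-- The free generators that remain after the elimination of the basic commutators in `E`. -/
def hallGenerators (E : Finset (FreeMagma A)) : Set (FreeMagma A) :=
  {v | IsBasic v ∧ v ∉ E ∧ ∀ s t, v = .mul s t → s ∈ E}

/-- A set of basic commutators which contains with `b` all smaller basic commutators. -/
def IsLowerBasic (E : Finset (FreeMagma A)) : Prop :=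
  ∀ e ∈ E, IsBasic e ∧ ∀ b, IsBasic b → b < e → b ∈ E

lemma IsBasic.of_mul {u v : FreeMagma A} (h : IsBasic (.mul u v)) :
    IsBasic u ∧ IsBasic v ∧ u < v ∧ ∀ s t, v = .mul s t → s ≤ u := by
  obtain ⟨h1, h2, h3, h4⟩ := h
  refine ⟨h1, h2, h3, ?_⟩
  rintro s t rfl
  exact h4

lemma IsBasic.mul {u v : FreeMagma A} (hu : IsBasic u) (hv : IsBasic v) (huv : u < v)
    (h : ∀ s t, v = .mul s t → s ≤ u) : IsBasic (.mul u v) := by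
  refine ⟨hu, hv, huv, ?_⟩
  cases v with
  | of a => trivial
  | mul s t => exact h s t rfl

variable (k : Type*) [CommRing k]

/-- **Lazard elimination**: the Lie elements that remain after the elimination of finitely many
basic commutators generate a free subalgebra. -/
theorem injective_lift_lieValue
    (hord : ∀ u v : FreeMagma A, u.length < v.length → u < v) (E : Finset (FreeMagma A))
    (hE : IsLowerBasic E) :
    Function.Injective (FreeAlgebra.lift k fun v : hallGenerators E =>
      lieValue (FreeAlgebra.ι k) v.1 : FreeAlgebra k (hallGenerators E) →ₐ[k] FreeAlgebra k A) := by
  classical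
  -- Eliminating the largest element `m` of `insert m E` replaces the generators by those other than
  -- `m` together with their iterated brackets with `m` on the left.
  induction E using Finset.induction_on_max with
  | empty =>
    have hof : ∀ a : A, FreeMagma.of a ∈ hallGenerators (∅ : Finset (FreeMagma A)) := fun a =>
      ⟨trivial, Finset.notMem_empty _, fun s t h => by cases h⟩
    refine Function.LeftInverse.injective
      (g := FreeAlgebra.lift k fun a => FreeAlgebra.ι k ⟨FreeMagma.of a, hof a⟩) fun x => ?_
    rw [← AlgHom.comp_apply]
    refine DFunLike.congr_fun (g := AlgHom.id k _) ?_ x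
    ext ⟨v, hv⟩
    cases v with
    | of a => simp [lieValue]
    | mul s t => exact absurd (hv.2.2 s t rfl) (Finset.notMem_empty _)
  | insert m E hm ih =>
    have hmE : m ∉ E := fun h => lt_irrefl _ (hm m h)
    have hmb : IsBasic m := (hE m (Finset.mem_insert_self _ _)).1
    have hle : ∀ e ∈ insert m E, e ≤ m := fun e he => by
      rcases Finset.mem_insert.1 he with rfl | he
      · exact le_rfl
      · exact (hm e he).le
    have hlow : ∀ b, IsBasic b → b ≤ m → b ∈ insert m E := fun b hb hbm => by
      rcases hbm.eq_or_lt with rfl | h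
      · exact Finset.mem_insert_self _ _
      · exact (hE m (Finset.mem_insert_self _ _)).2 b hb h
    have hE' : IsLowerBasic E := fun e he => ⟨(hE e (Finset.mem_insert_of_mem he)).1,
      fun b hb hbe => (Finset.mem_insert.1 ((hE e (Finset.mem_insert_of_mem he)).2 b hb hbe)).resolve_left
        (hbe.trans (hm e he)).ne⟩
    specialize ih hE'
    have hlen : ∀ s t : FreeMagma A, s < .mul s t := fun s t => hord _ _ (by
      have := t.length_pos
      change s.length < s.length + t.length
      omega)
    have hmX : m ∈ hallGenerators E := by
      refine ⟨hmb, hmE, ?_⟩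
      rintro s t rfl
      exact (Finset.mem_insert.1 (hlow s hmb.of_mul.1 (hlen s t).le)).resolve_left (hlen s t).ne
    have hXE : ∀ v ∈ hallGenerators E, v ≠ m → v ∈ hallGenerators (insert m E) := fun v hv hvm =>
      ⟨hv.1, fun h => (Finset.mem_insert.1 h).elim hvm hv.2.1,
        fun s t h => Finset.mem_insert_of_mem (hv.2.2 s t h)⟩
    have hmul : ∀ v ∈ hallGenerators (insert m E), .mul m v ∈ hallGenerators (insert m E) := by
      intro v hv
      have hmv : m < v := lt_of_not_ge fun h => hv.2.1 (hlow v hv.1 h)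
      refine ⟨hmb.mul hv.1 hmv fun s t h => hle s (hv.2.2 s t h), fun h => ?_, ?_⟩
      · exact absurd (hle _ h) (not_le.2 (hlen m v))
      · rintro s t h
        cases h
        exact Finset.mem_insert_self _ _
    -- `D` plays the role of the bracket with `m`, as a derivation of the free algebra on the new
    -- generators.
    obtain ⟨D, hD, hDmul⟩ := FreeAlgebra.exists_derivation (k := k)
      fun v : hallGenerators (insert m E) => FreeAlgebra.ι k
        (⟨.mul m v.1, hmul v.1 v.2⟩ : hallGenerators (insert m E))
    -- The old free algebra acts on the new one: `m` by the derivation, every other generator by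
    -- left multiplication.
    let ρ : FreeAlgebra k (hallGenerators E) →ₐ[k]
        Module.End k (FreeAlgebra k (hallGenerators (insert m E))) :=
      FreeAlgebra.lift k fun v => if h : v.1 = m then D else
        LinearMap.mulLeft k (FreeAlgebra.ι k ⟨v.1, hXE v.1 v.2 h⟩)
    -- Each new generator lifts to an element of the old free algebra that acts as left
    -- multiplication. For `v = [m, t]` this is because the commutator of `D` with left
    -- multiplication by `t` is left multiplication by `D t`.
    have key : ∀ n, ∀ v : hallGenerators (insert m E), v.1.length = n →
        ∃ z : FreeAlgebra k (hallGenerators E),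
          (FreeAlgebra.lift k fun v : hallGenerators E => lieValue (FreeAlgebra.ι k) v.1 :
            FreeAlgebra k (hallGenerators E) →ₐ[k] FreeAlgebra k A) z =
              lieValue (FreeAlgebra.ι k) v.1 ∧
          ρ z = LinearMap.mulLeft k (FreeAlgebra.ι k v) := by
      intro n
      induction n using Nat.strong_induction_on with
      | _ n ihn =>
      rintro ⟨v, hv⟩ hn
      by_cases h : ∀ s t, v = .mul s t → s ∈ E
      · have hvX : v ∈ hallGenerators E :=
          ⟨hv.1, fun h => hv.2.1 (Finset.mem_insert_of_mem h), h⟩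
        have hvm : v ≠ m := fun h => hv.2.1 (h ▸ Finset.mem_insert_self _ _)
        exact ⟨FreeAlgebra.ι k ⟨v, hvX⟩, by simp, by simp [ρ, hvm]⟩
      · push Not at h
        obtain ⟨s, t, rfl, hs⟩ := h
        have hsm : s = m := (Finset.mem_insert.1 (hv.2.2 s t rfl)).resolve_right hs
        subst hsm
        obtain ⟨hsb, htb, hst, hl⟩ := hv.1.of_mul
        have htX : t ∈ hallGenerators (insert s E) :=
          ⟨htb, fun h => absurd (hle t h) (not_le.2 hst), fun s' t' h =>
            hlow s' (by subst h; exact htb.of_mul.1) (hl s' t' h)⟩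
        obtain ⟨z, hz, hz'⟩ := ihn t.length (by
          have := s.length_pos
          change s.length + t.length = n at hn
          omega) ⟨t, htX⟩ rfl
        refine ⟨FreeAlgebra.ι k ⟨s, hmX⟩ * z - z * FreeAlgebra.ι k ⟨s, hmX⟩, ?_, ?_⟩
        · rw [map_sub, map_mul, map_mul, hz]
          simp [lieValue]
        · rw [map_sub, map_mul, map_mul, hz']
          ext x
          simp [ρ, hDmul, hD]
    choose z hz hz' using fun v : hallGenerators (insert m E) => key _ v rfl
    have h1 : (FreeAlgebra.lift k fun v : hallGenerators (insert m E) =>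
        lieValue (FreeAlgebra.ι k) v.1 : _ →ₐ[k] FreeAlgebra k A) =
        (FreeAlgebra.lift k fun v : hallGenerators E => lieValue (FreeAlgebra.ι k) v.1).comp
          (FreeAlgebra.lift k z) := by
      ext v
      simp [hz]
    have h2 : ρ.comp (FreeAlgebra.lift k z) =
        Algebra.lmul k (FreeAlgebra k (hallGenerators (insert m E))) := by
      ext v x
      simp [hz']
    rw [h1, AlgHom.coe_comp]
    refine ih.comp fun x y hxy => ?_
    -- Acting on `1` recovers an element of the new free algebra from its image in the old one.
    have := DFunLike.congr_fun (congrArg ρ hxy) 1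
    rw [← AlgHom.comp_apply, ← AlgHom.comp_apply, h2] at this
    simpa using this

/-- The basic Lie elements of fixed weight are linearly independent. -/
theorem linearIndependent_lieValue [Finite A]
    (hord : ∀ u v : FreeMagma A, u.length < v.length → u < v) (w : ℕ) :
    LinearIndependent k fun b : {b : BasicComm A // b.1.length = w} =>
      lieValue (FreeAlgebra.ι k) b.1.1 := by
  have hfin : {b : FreeMagma A | IsBasic b ∧ b.length < w}.Finite :=
    (finite_length_le (A := A) w).subset fun b hb => hb.2.le
  -- After eliminating all basic commutators of weight below `w`, those of weight `w` are among the
  -- free generators, since their left factors have smaller weight.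
  let E := hfin.toFinset
  have hE : IsLowerBasic E := by
    intro e he
    have he' := hfin.mem_toFinset.1 he
    refine ⟨he'.1, fun b hb hbe => hfin.mem_toFinset.2 ⟨hb, ?_⟩⟩
    by_contra h
    have := he'.2
    exact absurd (hord e b (by omega)) hbe.not_gt
  have hX : ∀ b : {b : BasicComm A // b.1.length = w}, b.1.1 ∈ hallGenerators E := by
    rintro ⟨⟨b, hb⟩, hw⟩
    refine ⟨hb, fun h => absurd (hfin.mem_toFinset.1 h).2 (by simp [← hw]), ?_⟩
    rintro s t rfl
    refine hfin.mem_toFinset.2 ⟨hb.of_mul.1, ?_⟩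
    have := t.length_pos
    change s.length + t.length = w at hw
    omega
  have h1 : LinearIndependent k fun b : {b : BasicComm A // b.1.length = w} =>
      FreeAlgebra.ι k (⟨b.1.1, hX b⟩ : hallGenerators E) := by
    have := (FreeAlgebra.basisFreeMonoid k (hallGenerators E)).linearIndependent.comp
      (fun b : {b : BasicComm A // b.1.length = w} => FreeMonoid.of ⟨b.1.1, hX b⟩) ?_
    · convert! this using 1
      funext b
      simp [FreeAlgebra.basisFreeMonoid, FreeAlgebra.equivMonoidAlgebraFreeMonoid]
    · intro b b' h
      have := FreeMonoid.of_injective h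
      have h' : b.1.1 = b'.1.1 := congrArg (fun z : hallGenerators E => z.1) this
      exact Subtype.ext (Subtype.ext h')
  have h2 := h1.map' (FreeAlgebra.lift k fun v : hallGenerators E =>
    lieValue (FreeAlgebra.ι k) v.1 : _ →ₐ[k] FreeAlgebra k A).toLinearMap
    (LinearMap.ker_eq_bot.2 (injective_lift_lieValue k hord E hE))
  convert! h2 using 1
  funext b
  simp

end LieIndependence

/-! ### Unipotent groups of filtered rings -/

/-- A descending multiplicative filtration of a ring that vanishes in degree `w + 1`. -/
structure RingFiltration (B : Type*) [Ring B] (w : ℕ) where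
  /-- The terms of the filtration. -/
  term : ℕ → AddSubgroup B
  one_mem_zero : 1 ∈ term 0
  mul_mem_add : ∀ {i j x y}, x ∈ term i → y ∈ term j → x * y ∈ term (i + j)
  antitone : Antitone term
  eq_zero : ∀ {x}, x ∈ term (w + 1) → x = 0

namespace RingFiltration

variable {B : Type*} [Ring B] {w : ℕ} (J : RingFiltration B w)

/-- The units congruent to `1` modulo the term of degree `n + 1`. -/
def units (n : ℕ) : Subgroup Bˣ where
  carrier := {u | (u : B) - 1 ∈ J.term (n + 1) ∧ ((u⁻¹ : Bˣ) : B) - 1 ∈ J.term (n + 1)}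
  one_mem' := by simp [zero_mem]
  mul_mem' := by
    have h : ∀ x y : B, x - 1 ∈ J.term (n + 1) → y - 1 ∈ J.term (n + 1) →
        x * y - 1 ∈ J.term (n + 1) := by
      intro x y hx hy
      have : x * y - 1 = (x - 1) * (y - 1) + (x - 1) + (y - 1) := by noncomm_ring
      rw [this]
      exact add_mem (add_mem (J.antitone (by omega) (J.mul_mem_add hx hy)) hx) hy
    rintro u v ⟨hu, hu'⟩ ⟨hv, hv'⟩
    refine ⟨h _ _ hu hv, ?_⟩
    rw [mul_inv_rev]
    exact h _ _ hv' hu'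
  inv_mem' := fun {u} h => ⟨h.2, by rw [inv_inv]; exact h.1⟩

lemma val_mem_of_mem_units {n : ℕ} {u : Bˣ} (hu : u ∈ J.units n) : (u : B) ∈ J.term 0 := by
  have := add_mem (J.antitone (Nat.zero_le _) hu.1) J.one_mem_zero
  rwa [sub_add_cancel] at this

lemma units_top : J.units w = ⊥ :=
  (Subgroup.eq_bot_iff_forall _).2 fun _ hu => Units.ext (sub_eq_zero.1 (J.eq_zero hu.1))

/-- In `⁅u, v⁆ - 1 = (u * v - v * u) * u⁻¹ * v⁻¹` the ring commutator does not change when `u` and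
`v` are replaced by `u - 1` and `v - 1`, so the degrees add up. -/
lemma val_commutator_sub_one_mem {i j : ℕ} {u v : Bˣ} (hu : u ∈ J.units i) (hv : v ∈ J.units j) :
    ((⁅u, v⁆ : Bˣ) : B) - 1 ∈ J.term (i + j + 1 + 1) := by
  have h : ((⁅u, v⁆ : Bˣ) : B) - 1 = (((u : B) - 1) * ((v : B) - 1) - ((v : B) - 1) * ((u : B) - 1)) *
      ((u⁻¹ * v⁻¹ : Bˣ) : B) := by
    have h1 : ((v : B) * u) * ((u⁻¹ * v⁻¹ : Bˣ) : B) = 1 := by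
      rw [← Units.val_mul, ← Units.val_mul, ← Units.val_one]; congr 1; group
    have h2 : ((u : B) * v) * ((u⁻¹ * v⁻¹ : Bˣ) : B) = (⁅u, v⁆ : Bˣ) := by
      rw [← Units.val_mul, ← Units.val_mul, commutatorElement_def, ← mul_assoc]
    have h3 : ((u : B) - 1) * ((v : B) - 1) - ((v : B) - 1) * ((u : B) - 1) = u * v - v * u := by
      noncomm_ring
    rw [h3, sub_mul, h1, h2]
  rw [h]
  have h3 := J.mul_mem_add hu.1 hv.1
  have h4 := J.mul_mem_add hv.1 hu.1
  rw [show i + 1 + (j + 1) = i + j + 1 + 1 by omega] at h3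
  rw [show j + 1 + (i + 1) = i + j + 1 + 1 by omega] at h4
  rw [show i + j + 1 + 1 = i + j + 1 + 1 + 0 by omega]
  exact J.mul_mem_add (sub_mem h3 h4)
    (J.val_mem_of_mem_units (mul_mem (J.units 0 |>.inv_mem (show u ∈ J.units 0 from
      ⟨J.antitone (by omega) hu.1, J.antitone (by omega) hu.2⟩)) ((J.units 0).inv_mem
        (show v ∈ J.units 0 from ⟨J.antitone (by omega) hv.1, J.antitone (by omega) hv.2⟩))))

lemma commutator_mem_units {i j : ℕ} {u v : Bˣ} (hu : u ∈ J.units i) (hv : v ∈ J.units j) :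
    ⁅u, v⁆ ∈ J.units (i + j + 1) := by
  refine ⟨J.val_commutator_sub_one_mem hu hv, ?_⟩
  rw [commutatorElement_inv, add_comm i j]
  exact J.val_commutator_sub_one_mem hv hu

lemma lowerCentralSeries_units :
    (⊤ : Subgroup (J.units 0)).lowerCentralSeries w = ⊥ := by
  have h : ∀ n, (⊤ : Subgroup (J.units 0)).lowerCentralSeries n ≤
      (J.units n).comap (J.units 0).subtype := by
    intro n
    induction n with
    | zero => exact fun u _ => u.2
    | succ n ih =>
      refine Subgroup.commutator_le.2 fun u hu v _ => ?_
      exact J.commutator_mem_units (ih hu) v.2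
  refine (Subgroup.eq_bot_iff_forall _).2 fun u hu => ?_
  have := h w hu
  rw [Subgroup.mem_comap, J.units_top, Subgroup.mem_bot] at this
  exact Subtype.ext this

/-- `x ^ q - 1` is `x - 1` times `∑ x ^ j`, and because `q = 0` in `B` this sum equals `∑ (x ^ j -
1)`, which has positive degree. -/
lemma pow_mem_units {q : ℕ} (hq : (q : B) = 0) {n : ℕ} {u : Bˣ} (hu : u ∈ J.units n) :
    u ^ q ∈ J.units (n + 1) := by
  have h : ∀ x : B, x - 1 ∈ J.term (n + 1) → x ^ q - 1 ∈ J.term (n + 1 + 1) := by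
    intro x hx
    have h1 : ∀ j, x ^ j - 1 ∈ J.term (n + 1) := by
      intro j
      induction j with
      | zero => simp [zero_mem]
      | succ j ih =>
        have : x ^ (j + 1) - 1 = (x ^ j - 1) * (x - 1) + (x ^ j - 1) + (x - 1) := by
          rw [pow_succ]; noncomm_ring
        rw [this]
        exact add_mem (add_mem (J.antitone (by omega) (J.mul_mem_add ih hx)) ih) hx
    have h2 : ∑ j ∈ Finset.range q, x ^ j ∈ J.term (n + 1) := by
      have : ∑ j ∈ Finset.range q, x ^ j = ∑ j ∈ Finset.range q, (x ^ j - 1) := by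
        simp [Finset.sum_sub_distrib, hq]
      rw [this]
      exact sum_mem fun j _ => h1 j
    rw [← geom_sum_mul]
    exact J.antitone (by omega) (J.mul_mem_add h2 hx)
  refine ⟨?_, ?_⟩
  · rw [Units.val_pow_eq_pow_val]; exact h _ hu.1
  · rw [← inv_pow, Units.val_pow_eq_pow_val]; exact h _ hu.2

lemma isPGroup_units {p e : ℕ} (hq : ((p ^ e : ℕ) : B) = 0) : IsPGroup p (J.units 0) := by
  intro u
  have h : ∀ n, (u : Bˣ) ^ (p ^ e) ^ n ∈ J.units n := by
    intro n
    induction n with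
    | zero => rw [pow_zero, pow_one]; exact u.2
    | succ n ih => rw [pow_succ, pow_mul]; exact J.pow_mem_units hq ih
  refine ⟨e * w, Subtype.ext ?_⟩
  have := h w
  rwa [J.units_top, Subgroup.mem_bot, ← pow_mul] at this

/-- The unit `1 + x`. -/
lemma exists_units_eq_one_add {x : B} (hx : x ∈ J.term 1) : ∃ u : J.units 0, ((u : Bˣ) : B) = 1 + x := by
  have hpow : ∀ n, x ^ n ∈ J.term n := by
    intro n
    induction n with
    | zero => rw [pow_zero]; exact J.one_mem_zero
    | succ n ih => rw [pow_succ]; exact J.mul_mem_add ih hx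
  have h0 : x ^ (w + 1) = 0 := J.eq_zero (hpow _)
  set y := ∑ i ∈ Finset.range (w + 1), (-x) ^ i with hy
  have h1 : (1 + x) * y = 1 := by
    have := mul_neg_geom_sum (-x) (w + 1)
    rw [neg_pow x (w + 1), h0, mul_zero, sub_zero, sub_neg_eq_add] at this
    exact this
  have h2 : y * (1 + x) = 1 := by
    have := geom_sum_mul_neg (-x) (w + 1)
    rw [neg_pow x (w + 1), h0, mul_zero, sub_zero, sub_neg_eq_add] at this
    exact this
  refine ⟨⟨⟨1 + x, y, h1, h2⟩, ?_, ?_⟩, rfl⟩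
  · simpa using hx
  · change y - 1 ∈ _
    rw [hy, Finset.sum_range_succ', pow_zero, add_sub_cancel_right]
    refine sum_mem fun i _ => ?_
    rw [neg_pow]
    rcases neg_one_pow_eq_or B (i + 1) with h | h
    · rw [h, one_mul]; exact J.antitone (by omega) (hpow (i + 1))
    · rw [h, neg_one_mul]; exact neg_mem (J.antitone (by omega) (hpow (i + 1)))

/-- The group commutators of elements `1 + x` have the corresponding Lie elements as leading
terms. -/
lemma commValue_sub_lieValue_mem {A : Type*} {f : A → J.units 0} {x : A → B}
    (hf : ∀ a, ((f a : Bˣ) : B) = 1 + x a) (hx : ∀ a, x a ∈ J.term 1) (t : FreeMagma A) :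
    lieValue x t ∈ J.term t.length ∧ ((commValue f t : J.units 0) : Bˣ) ∈ J.units (t.length - 1) ∧
      (((commValue f t : J.units 0) : Bˣ) : B) - 1 - lieValue x t ∈ J.term (t.length + 1) := by
  induction t with
  | ih1 a =>
    refine ⟨hx a, (f a).2, ?_⟩
    change ((f a : Bˣ) : B) - 1 - x a ∈ _
    rw [hf a, add_sub_cancel_left, sub_self]
    exact zero_mem _
  | ih2 u v hu hv =>
    obtain ⟨hu1, hu2, hu3⟩ := hu
    obtain ⟨hv1, hv2, hv3⟩ := hv
    have lu := u.length_pos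
    have lv := v.length_pos
    change lieValue x u * lieValue x v - lieValue x v * lieValue x u ∈ J.term (u.length + v.length) ∧
      ((commValue f u : J.units 0) : Bˣ)⁻¹ * ((commValue f v : J.units 0) : Bˣ)⁻¹ * ((commValue f u : J.units 0) : Bˣ) * ((commValue f v : J.units 0) : Bˣ) ∈
        J.units (u.length + v.length - 1) ∧
      ((((commValue f u : J.units 0) : Bˣ)⁻¹ * ((commValue f v : J.units 0) : Bˣ)⁻¹ * ((commValue f u : J.units 0) : Bˣ) *
        ((commValue f v : J.units 0) : Bˣ) : Bˣ) : B) - 1 -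
        (lieValue x u * lieValue x v - lieValue x v * lieValue x u) ∈
        J.term (u.length + v.length + 1)
    generalize lieValue x u = X at *
    generalize lieValue x v = Y at *
    generalize ((commValue f u : J.units 0) : Bˣ) = U at *
    generalize ((commValue f v : J.units 0) : Bˣ) = V at *
    generalize u.length = i at *
    generalize v.length = j at *
    refine ⟨sub_mem (J.mul_mem_add hu1 hv1) (add_comm i j ▸ J.mul_mem_add hv1 hu1), ?_, ?_⟩
    · have := J.commutator_mem_units (inv_mem hu2) (inv_mem hv2)
      rw [commutatorElement_def, inv_inv, inv_inv] at this
      rwa [show i - 1 + (j - 1) + 1 = i + j - 1 by omega] at this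
    · set Z := (U⁻¹ * V⁻¹ : Bˣ) with hZ
      have hU1 : (U : B) - 1 ∈ J.term i := by
        have := hu2.1; rwa [Nat.sub_add_cancel lu] at this
      have hV1 : (V : B) - 1 ∈ J.term j := by
        have := hv2.1; rwa [Nat.sub_add_cancel lv] at this
      have hZ1 : (Z : B) - 1 ∈ J.term 1 := by
        have hU0 : U ∈ J.units 0 := ⟨J.antitone (by omega) hu2.1, J.antitone (by omega) hu2.2⟩
        have hV0 : V ∈ J.units 0 := ⟨J.antitone (by omega) hv2.1, J.antitone (by omega) hv2.2⟩
        exact (mul_mem (inv_mem hU0) (inv_mem hV0)).1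
      have e1 : ((Z * U * V : Bˣ) : B) - 1 =
          (Z : B) * (((U : B) - 1) * ((V : B) - 1) - ((V : B) - 1) * ((U : B) - 1)) := by
        have h1 : (Z : B) * ((V : B) * U) = 1 := by
          rw [← Units.val_mul, ← Units.val_mul, ← Units.val_one, hZ]; congr 1; group
        have h2 : (Z : B) * ((U : B) * V) = ((Z * U * V : Bˣ) : B) := by
          rw [← Units.val_mul, ← Units.val_mul, ← mul_assoc]
        have h3 : ((U : B) - 1) * ((V : B) - 1) - ((V : B) - 1) * ((U : B) - 1) = U * V - V * U := by
          noncomm_ring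
        rw [h3, mul_sub, h1, h2]
      rw [e1]
      set P := (U : B) - 1
      set Q := (V : B) - 1
      -- Replacing `Z` by `1`, `P` by `X` and `Q` by `Y` costs only terms of degree at least `i + j
      -- + 1`.
      have e2 : (Z : B) * (P * Q - Q * P) - (X * Y - Y * X) =
          ((Z : B) - 1) * (P * Q - Q * P) + (((P - X) * Q + X * (Q - Y)) -
            ((Q - Y) * P + Y * (P - X))) := by noncomm_ring
      rw [e2]
      have m1 : P * Q - Q * P ∈ J.term (i + j) :=
        sub_mem (J.mul_mem_add hU1 hV1) (add_comm i j ▸ J.mul_mem_add hV1 hU1)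
      refine add_mem (add_comm 1 (i + j) ▸ J.mul_mem_add hZ1 m1) (sub_mem (add_mem ?_ ?_)
        (add_mem ?_ ?_))
      · exact J.antitone (by omega) (J.mul_mem_add hu3 hV1)
      · exact J.antitone (by omega) (J.mul_mem_add hu1 hv3)
      · exact J.antitone (by omega) (J.mul_mem_add hv3 hU1)
      · exact J.antitone (by omega) (J.mul_mem_add hv1 hu3)

end RingFiltration

/-! ### Truncated noncommutative power series -/

section Truncated

variable (k : Type*) [CommRing k] (A : Type*) (w : ℕ)

/-- Truncated noncommutative power series, as functions on the words of length at most `w`. -/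
abbrev TruncSeries : Type _ := {l : List A // l.length ≤ w} → k

variable {A w}

open Classical in
/-- Left multiplication by a letter. -/
noncomputable def letterMul (a : A) : Module.End k (TruncSeries k A w) where
  toFun f l := match l with
    | ⟨[], _⟩ => 0
    | ⟨b :: l, h⟩ => if a = b then f ⟨l, by simp at h; omega⟩ else 0
  map_add' f g := by
    funext ⟨l, h⟩
    cases l with
    | nil => simp
    | cons b l => by_cases hab : a = b <;> simp [hab]
  map_smul' r f := by
    funext ⟨l, h⟩
    cases l with
    | nil => simp
    | cons b l => by_cases hab : a = b <;> simp [hab]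

variable (A w) in
/-- The endomorphisms of truncated series that raise the order by at least `i`. -/
def truncFiltration : RingFiltration (Module.End k (TruncSeries k A w)) w where
  term i :=
    { carrier := {M | ∀ (j : ℕ) (f : TruncSeries k A w), (∀ l, l.1.length < j → f l = 0) →
        ∀ l, l.1.length < j + i → M f l = 0}
      zero_mem' := fun _ _ _ _ _ => rfl
      add_mem' := fun {M N} hM hN j f hf l hl => by
        rw [LinearMap.add_apply, Pi.add_apply, hM j f hf l hl, hN j f hf l hl, add_zero]
      neg_mem' := fun {M} hM j f hf l hl => by
        rw [LinearMap.neg_apply, Pi.neg_apply, hM j f hf l hl, neg_zero] }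
  one_mem_zero _ _ hf l hl := hf l hl
  mul_mem_add {i j M N} hM hN n f hf l hl := hM (n + j) (N f) (hN n f hf) l (by omega)
  antitone i i' hi M hM j f hf l hl := hM j f hf l (by omega)
  eq_zero {M} hM := by
    ext1 f
    funext l
    exact hM 0 f (fun l hl => absurd hl (Nat.not_lt_zero _)) l (by have := l.2; omega)

open Classical in
lemma letterMul_mem (a : A) : letterMul k a ∈ (truncFiltration k A w).term 1 := by
  rintro j f hf ⟨l, hw⟩ hl
  cases l with
  | nil => rfl
  | cons b l =>
    change (if a = b then f ⟨l, _⟩ else 0) = 0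
    split_ifs
    · exact hf _ (by simpa using hl)
    · rfl

open Classical in
-- Acting on the series `1` (the empty word), a monomial returns its own word. So the coefficients
-- of an element of degree `w` can be read off from its action.
lemma lift_letterMul_prod (l : List A) (hl : l.length ≤ w) :
    (FreeAlgebra.lift k (letterMul k : A → Module.End k (TruncSeries k A w)))
      (l.map (FreeAlgebra.ι k)).prod (Pi.single ⟨[], Nat.zero_le _⟩ 1) = Pi.single ⟨l, hl⟩ 1 := by
  induction l with
  | nil => simp
  | cons a l ih =>
    rw [List.map_cons, List.prod_cons, map_mul, FreeAlgebra.lift_ι_apply, Module.End.mul_apply,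
      ih (by simp at hl; omega)]
    funext ⟨l', hl'⟩
    cases l' with
    | nil => simp [letterMul]
    | cons b l' =>
      by_cases hab : a = b <;> simp [letterMul, Pi.single_apply, hab, eq_comm]

variable (A) in
/-- The homogeneous elements of degree `n` in the free algebra. -/
def homogeneousPart (n : ℕ) : Submodule k (FreeAlgebra k A) :=
  Submodule.span k (Set.range fun l : {l : List A // l.length = n} =>
    (l.1.map (FreeAlgebra.ι k)).prod)

lemma mul_mem_homogeneousPart {i j : ℕ} {x y : FreeAlgebra k A} (hx : x ∈ homogeneousPart k A i)
    (hy : y ∈ homogeneousPart k A j) : x * y ∈ homogeneousPart k A (i + j) := by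
  have := Submodule.mul_mem_mul hx hy
  rw [homogeneousPart, homogeneousPart, Submodule.span_mul_span] at this
  refine Submodule.span_mono ?_ this
  rintro _ ⟨_, ⟨l, rfl⟩, _, ⟨l', rfl⟩, rfl⟩
  exact ⟨⟨l.1 ++ l'.1, by rw [List.length_append, l.2, l'.2]⟩, by simp⟩

lemma lieValue_mem_homogeneousPart (t : FreeMagma A) :
    lieValue (FreeAlgebra.ι k) t ∈ homogeneousPart k A t.length := by
  induction t with
  | ih1 a => exact Submodule.subset_span ⟨⟨[a], rfl⟩, by simp [lieValue]⟩
  | ih2 u v hu hv =>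
    refine sub_mem (mul_mem_homogeneousPart k hu hv) ?_
    have := mul_mem_homogeneousPart k hv hu
    rwa [add_comm] at this

lemma eq_zero_of_lift_letterMul_eq_zero {z : FreeAlgebra k A} (hz : z ∈ homogeneousPart k A w)
    (h : FreeAlgebra.lift k (letterMul k : A → Module.End k (TruncSeries k A w)) z = 0) :
    z = 0 := by
  classical
  obtain ⟨c, rfl⟩ := (Finsupp.mem_span_range_iff_exists_finsupp).1 hz
  have hc : c = 0 := by
    ext l
    have h1 := congrFun (DFunLike.congr_fun h (Pi.single ⟨[], Nat.zero_le _⟩ 1)) ⟨l.1, l.2.le⟩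
    rw [Finsupp.sum, map_sum, LinearMap.sum_apply, Finset.sum_apply] at h1
    simp only [map_smul, LinearMap.smul_apply, Pi.smul_apply] at h1
    rw [Finset.sum_congr rfl fun l' _ => by
      rw [lift_letterMul_prod k l'.1 l'.2.le, Pi.single_apply]] at h1
    simpa [← Subtype.ext_iff] using h1
  rw [hc, Finsupp.sum_zero_index]

end Truncated

/-! ### Finite `p`-groups as Hall groups over the `p`-adic integers -/

section PadicHall

variable {p : ℕ} [Fact p.Prime] {Q : Type*} [Group Q]

lemma pow_appr_eq_pow {n : ℕ} {x : Q} (hx : x ^ p ^ n = 1) {β : ℤ_[p]} {m : ℕ}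
    (h : β - m ∈ Ideal.span {(p : ℤ_[p]) ^ n}) : x ^ β.appr n = x ^ m := by
  have h1 := PadicInt.zmod_congr_of_sub_mem_span n β _ _ (PadicInt.appr_spec n β) h
  rw [ZMod.natCast_eq_natCast_iff] at h1
  exact pow_eq_pow_iff_modEq.2 (h1.of_dvd (orderOf_dvd_of_pow_eq_one hx))

/-- Exponentiation with `p`-adic exponents in a group of exponent dividing `p ^ n`. -/
@[reducible] noncomputable def padicPowOfExponent (p : ℕ) [Fact p.Prime] (Q : Type*) [Group Q]
    (n : ℕ) : Pow Q ℤ_[p] := ⟨fun x β => x ^ β.appr n⟩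

/-- A nilpotent group of exponent dividing `p ^ n` is a Hall group over the `p`-adic integers. -/
theorem isHallGroup_padicInt {n c : ℕ} (hn : ∀ x : Q, x ^ p ^ n = 1)
    (hc : (⊤ : Subgroup Q).lowerCentralSeries c = ⊥) :
    @IsHallGroup ℤ_[p] _ _ c Q _ (padicPowOfExponent p Q n) := by
  let _ := padicPowOfExponent p Q n
  have hdef : ∀ (x : Q) (β : ℤ_[p]), x ^ β = x ^ β.appr n := fun _ _ => rfl
  have hnat : ∀ (x : Q) {β : ℤ_[p]} {m : ℕ}, β - m ∈ Ideal.span {(p : ℤ_[p]) ^ n} → x ^ β = x ^ m :=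
    fun x _ _ h => pow_appr_eq_pow (hn x) h
  have hspec := PadicInt.appr_spec (p := p) n
  refine
    { nilpotent := hc
      rpow_zero := fun g => ?_
      rpow_one := fun g => ?_
      rpow_add := fun g r s => ?_
      rpow_mul := fun g r s => ?_
      conj_rpow := fun x y r => ?_
      petresco := fun m hm l x r => ?_ }
  · rw [hnat g (m := 0) (by simp), pow_zero]
  · rw [hnat g (m := 1) (by simp), pow_one]
  · rw [hnat g (m := r.appr n + s.appr n), pow_add, hdef, hdef]
    have := add_mem (hspec r) (hspec s)
    rw [sub_add_sub_comm] at this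
    exact_mod_cast this
  · rw [hnat g (m := r.appr n * s.appr n), pow_mul, hdef, hdef]
    have : r * s - ((r.appr n * s.appr n : ℕ) : ℤ_[p]) =
        r * (s - s.appr n) + s.appr n * (r - r.appr n) := by push_cast; ring
    rw [this]
    exact add_mem (Ideal.mul_mem_left _ _ (hspec s)) (Ideal.mul_mem_left _ _ (hspec r))
  · rw [hdef, hdef]
    have := (MulAut.conj y⁻¹).toMonoidHom.map_pow x (r.appr n)
    simpa using this
  -- Binomial coefficients are continuous on `ℤ_[p]` and the natural numbers are dense, so some
  -- natural `M` has all the relevant binomial coefficients congruent to those of `r` modulo `p ^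
  -- n`. The identity for `M` is then the identity for `r`.
  · have hev : ∀ᶠ γ in nhds r, ∀ k ∈ Finset.range (m + 2),
        ‖Ring.choose r k - Ring.choose γ k‖ < (p : ℝ) ^ (-n : ℤ) := by
      rw [Filter.eventually_all_finset]
      intro k _
      have hcont : Continuous fun γ : ℤ_[p] => ‖Ring.choose r k - Ring.choose γ k‖ :=
        (continuous_const.sub (PadicInt.continuous_choose k)).norm
      refine hcont.tendsto r (Iio_mem_nhds ?_)
      rw [sub_self, norm_zero]
      exact zpow_pos (by exact_mod_cast (Fact.out : p.Prime).pos) _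
    obtain ⟨M, hM⟩ := PadicInt.denseRange_natCast.mem_nhds hev
    have hk : ∀ k < m + 2, Ring.choose r k - ((M.choose k : ℕ) : ℤ_[p]) ∈
        Ideal.span {(p : ℤ_[p]) ^ n} := by
      intro k hk
      rw [← PadicInt.norm_le_pow_iff_mem_span_pow, ← Ring.choose_natCast]
      exact (hM k (Finset.mem_range.2 hk)).le
    have h1 := hk 1 (by omega)
    rw [Ring.choose_one_right, Nat.choose_one_right] at h1
    have h2 : (fun i => x i ^ r) = fun i => x i ^ M := funext fun i => hnat _ h1
    rw [h2, hnat _ h1, prod_pow_eq_petresco hc hm]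
    refine congrArg _ (congrArg List.prod (List.map_congr_left fun k hkm => ?_))
    exact (hnat _ (hk k (by have := (List.Ico.mem.1 hkm).2; omega))).symm

end PadicHall

namespace PIndex

variable {p : ℕ} [Fact p.Prime] {A : Type*} (N : PIndex p A)

noncomputable instance : Pow (FreeGroup A ⧸ N.1) ℤ_[p] :=
  padicPowOfExponent p _ (Nat.log p N.1.index)

lemma rpow_def (x : FreeGroup A ⧸ N.1) (β : ℤ_[p]) :
    x ^ β = x ^ β.appr (Nat.log p N.1.index) := rfl

lemma pow_log_index : p ^ Nat.log p N.1.index = N.1.index := by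
  obtain ⟨k, hk⟩ := N.2.2
  rw [hk, Nat.log_pow (Fact.out : p.Prime).one_lt]

lemma pow_eq_one (x : FreeGroup A ⧸ N.1) : x ^ p ^ Nat.log p N.1.index = 1 := by
  rw [pow_log_index, Subgroup.index_eq_card]
  exact pow_card_eq_one'

lemma exists_lowerCentralSeries_eq_bot :
    ∃ c, (⊤ : Subgroup (FreeGroup A ⧸ N.1)).lowerCentralSeries c = ⊥ := by
  obtain ⟨k, hk⟩ := N.2.2
  rw [Subgroup.index_eq_card] at hk
  have : Finite (FreeGroup A ⧸ N.1) := Nat.finite_of_card_ne_zero (by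
    rw [hk]; exact pow_ne_zero _ (Fact.out : p.Prime).ne_zero)
  exact Subgroup.nilpotent_iff_lowerCentralSeries.1 (IsPGroup.of_card hk).isNilpotent

lemma isHallGroup {c : ℕ} (hc : (⊤ : Subgroup (FreeGroup A ⧸ N.1)).lowerCentralSeries c = ⊥) :
    IsHallGroup ℤ_[p] c (FreeGroup A ⧸ N.1) :=
  isHallGroup_padicInt N.pow_eq_one hc

end PIndex

/-! ### Separation of ordered products in finite `p`-groups -/

namespace RingFiltration

variable {B : Type*} [Ring B] {w : ℕ} (J : RingFiltration B w)

include J in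
-- Products of elements of the top degree vanish, so there `y ↦ 1 + y` turns sums into products.
lemma mul_eq_zero_of_mem (hw : 1 ≤ w) {x y : B} (hx : x ∈ J.term w) (hy : y ∈ J.term w) :
    x * y = 0 := J.eq_zero (J.antitone (by omega) (J.mul_mem_add hx hy))

lemma pow_eq_of_sub_one_mem (hw : 1 ≤ w) {x y : B} (hx : x = 1 + y) (hy : y ∈ J.term w) (n : ℕ) :
    x ^ n = 1 + n • y := by
  induction n with
  | zero => simp
  | succ n ih =>
    rw [pow_succ, ih, hx, mul_add, add_mul, add_mul, mul_one, smul_mul_assoc n y y,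
      J.mul_eq_zero_of_mem hw hy hy, succ_nsmul]
    simp [add_assoc]

lemma list_prod_eq_of_sub_one_mem (hw : 1 ≤ w) {ι : Type*} (l : List ι) {x y : ι → B}
    (hx : ∀ i ∈ l, x i = 1 + y i) (hy : ∀ i ∈ l, y i ∈ J.term w) :
    (l.map x).prod = 1 + (l.map y).sum := by
  have hsum : ∀ l : List ι, (∀ i ∈ l, y i ∈ J.term w) → (l.map y).sum ∈ J.term w := fun l hl =>
    AddSubgroup.list_sum_mem _ fun z hz => by
      obtain ⟨i, hi, rfl⟩ := List.mem_map.1 hz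
      exact hl i hi
  induction l with
  | nil => simp
  | cons a l ih =>
    have hl : ∀ i ∈ l, y i ∈ J.term w := fun i hi => hy i (List.mem_cons_of_mem _ hi)
    rw [List.map_cons, List.prod_cons, List.map_cons, List.sum_cons,
      ih (fun i hi => hx i (List.mem_cons_of_mem _ hi)) hl, hx a List.mem_cons_self, mul_add,
      add_mul, add_mul, J.mul_eq_zero_of_mem hw (hy a List.mem_cons_self) (hsum l hl)]
    simp [add_assoc]

end RingFiltration

section Separation

variable {p : ℕ} [Fact p.Prime] {A : Type*} [LinearOrder (FreeMagma A)] [Finite A]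

/-- The canonical generators of a quotient of the free group. -/
def quotientGen (N : Subgroup (FreeGroup A)) (a : A) : FreeGroup A ⧸ N := (FreeGroup.of a : _)

/-- The basic Lie elements of weight `w` are independent in the free algebra, and nothing
homogeneous of degree `w` is lost in its action on truncated series. -/
lemma natCast_eq_of_sum_smul_lieValue_eq (k : Type*) [CommRing k]
    (hord : ∀ u v : FreeMagma A, u.length < v.length → u < v) {w : ℕ} {c c' : BasicComm A → ℕ}
    (h : ((levelList A w).map fun b => c b •
        lieValue (letterMul k : A → Module.End k (TruncSeries k A w)) b.1).sum =
      ((levelList A w).map fun b => c' b • lieValue (letterMul k) b.1).sum)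
    (b : BasicComm A) (hb : b.1.length = w) : (c b : k) = c' b := by
  classical
  rw [← List.sum_toFinset _ (nodup_levelList _), ← List.sum_toFinset _ (nodup_levelList _),
    ← sub_eq_zero, ← Finset.sum_sub_distrib] at h
  have hind : LinearIndepOn k (fun b : BasicComm A => lieValue (FreeAlgebra.ι k) b.1)
      {b | b.1.length = w} := linearIndependent_lieValue k hord w
  have hz : ∑ b ∈ (levelList A w).toFinset, ((c b : k) - (c' b : k)) •
      lieValue (FreeAlgebra.ι k) b.1 = 0 := by
    refine eq_zero_of_lift_letterMul_eq_zero (w := w) k (sum_mem fun b hb => ?_) ?_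
    · have hb' := mem_levelList.1 (List.mem_toFinset.1 hb)
      exact Submodule.smul_mem _ _ (hb' ▸ lieValue_mem_homogeneousPart k b.1)
    · rw [map_sum, ← h]
      refine Finset.sum_congr rfl fun b _ => ?_
      have h1 := map_lieValue (FreeAlgebra.lift k
        (letterMul k : A → Module.End k (TruncSeries k A w))).toRingHom (FreeAlgebra.ι k) b.1
      have h2 : FreeAlgebra.lift k (letterMul k : A → Module.End k (TruncSeries k A w))
          (lieValue (FreeAlgebra.ι k) b.1) = lieValue (letterMul k) b.1 := by
        refine h1.trans ?_
        simp
      rw [sub_smul, Nat.cast_smul_eq_nsmul, Nat.cast_smul_eq_nsmul, map_sub, map_nsmul, map_nsmul,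
        h2]
  exact sub_eq_zero.1 (linearIndepOn_iff'.1 hind _ _ (fun b hb => mem_levelList.1
    (List.mem_toFinset.1 hb)) hz b (List.mem_toFinset.2 (mem_levelList.2 hb)))

/-- The Magnus map `a ↦ 1 + a` over `ℤ/p^e`, with `e` so large that the two exponents of `b₀` differ
modulo `p ^ e`. Truncation beyond the weight `w` of `b₀` leaves of a basic commutator of weight `w`
only `1` plus its Lie element, so a level product becomes `1` plus a linear combination of
independent elements whose coefficients are the exponents. -/
theorem exists_levelProd_ne (hord : ∀ u v : FreeMagma A, u.length < v.length → u < v)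
    {β β' : BasicComm A → ℤ_[p]} {b₀ : BasicComm A} (hne : β b₀ ≠ β' b₀) :
    ∃ N : PIndex p A,
      (⊤ : Subgroup (FreeGroup A ⧸ N.1)).lowerCentralSeries b₀.1.length = ⊥ ∧
      levelProd (quotientGen N.1) β b₀.1.length ≠ levelProd (quotientGen N.1) β' b₀.1.length := by
  obtain ⟨e, he⟩ : ∃ e, PadicInt.toZModPow e (β b₀) ≠ PadicInt.toZModPow e (β' b₀) := by
    by_contra! h
    exact hne (PadicInt.ext_of_toZModPow.1 h)
  have hw : 1 ≤ b₀.1.length := b₀.1.length_pos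
  set w := b₀.1.length with hwdef
  let k := ZMod (p ^ e)
  let B := Module.End k (TruncSeries k A w)
  let J : RingFiltration B w := truncFiltration k A w
  have : Finite {l : List A // l.length ≤ w} := (List.finite_length_le A w).to_subtype
  have : Finite k := inferInstanceAs (Finite (ZMod (p ^ e)))
  have : Finite B := Finite.of_injective (fun M : B => (M : TruncSeries k A w → TruncSeries k A w))
    DFunLike.coe_injective
  have hq : ((p ^ e : ℕ) : B) = 0 := by
    rw [← map_natCast (algebraMap k B), ZMod.natCast_self, map_zero]
  choose f hf using fun a => J.exists_units_eq_one_add (letterMul_mem k (w := w) a)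
  let g : FreeGroup A →* J.units 0 := FreeGroup.lift f
  have hcard : ∃ n, g.ker.index = p ^ n := by
    rw [Subgroup.index_ker]
    exact IsPGroup.iff_card.1 ((J.isPGroup_units hq).to_subgroup g.range)
  obtain ⟨N, κ, hκ, hκf⟩ : ∃ (N : PIndex p A) (κ : FreeGroup A ⧸ N.1 →* J.units 0),
      Function.Injective κ ∧ ∀ a, κ (quotientGen N.1 a) = f a :=
    ⟨⟨g.ker, inferInstance, hcard⟩, QuotientGroup.kerLift g, QuotientGroup.kerLift_injective g,
      fun _ => FreeGroup.lift_apply_of⟩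
  refine ⟨N, (Subgroup.eq_bot_iff_forall _).2 fun x hx => ?_, fun heq => he ?_⟩
  · have h1 := Subgroup.map_mem_top_lowerCentralSeries κ hx
    rw [J.lowerCentralSeries_units, Subgroup.mem_bot] at h1
    exact hκ (h1.trans (map_one κ).symm)
  · let L : BasicComm A → B := fun b => lieValue (letterMul k) b.1
    have hlead : ∀ b : BasicComm A, b.1.length = w →
        L b ∈ J.term w ∧ (((commValue f b.1 : J.units 0) : Bˣ) : B) = 1 + L b := by
      intro b hb
      obtain ⟨h1, -, h3⟩ := J.commValue_sub_lieValue_mem hf (fun a => letterMul_mem k a) b.1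
      rw [hb] at h1 h3
      refine ⟨h1, ?_⟩
      have := sub_eq_zero.1 (J.eq_zero h3)
      rw [← sub_eq_iff_eq_add']
      exact this
    -- One precision for two purposes: it determines the exponents modulo `p ^ e` as coefficients,
    -- and modulo the index of `N` as exponents in the quotient.
    set M := max e (Nat.log p N.1.index) with hM
    have hcast : ∀ γ : ℤ_[p], ((γ.appr M : ℕ) : k) = PadicInt.toZModPow e γ := by
      intro γ
      have h1 : γ - γ.appr M ∈ RingHom.ker (PadicInt.toZModPow (p := p) e) := by
        rw [PadicInt.ker_toZModPow]
        have := PadicInt.appr_spec M γ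
        rw [Ideal.mem_span_singleton] at this ⊢
        exact (pow_dvd_pow _ (le_max_left _ _)).trans this
      rw [RingHom.mem_ker, map_sub, map_natCast, sub_eq_zero] at h1
      exact h1.symm
    have hval : ∀ γ : BasicComm A → ℤ_[p],
        ((κ (levelProd (quotientGen N.1) γ w) : Bˣ) : B) =
          1 + ((levelList A w).map fun b => (γ b).appr M • L b).sum := by
      intro γ
      rw [levelProd, map_list_prod, List.map_map, ← Subgroup.coe_subtype, ← Units.coeHom_apply,
        map_list_prod, map_list_prod, List.map_map, List.map_map]
      refine J.list_prod_eq_of_sub_one_mem hw _ (fun b hb => ?_) fun b hb => ?_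
      · obtain ⟨h1, h2⟩ := hlead b (mem_levelList.1 hb)
        rw [← J.pow_eq_of_sub_one_mem hw h2 h1]
        have h3 : commValue (quotientGen N.1) b.1 ^ γ b =
            commValue (quotientGen N.1) b.1 ^ (γ b).appr M := by
          refine pow_appr_eq_pow (N.pow_eq_one _) ?_
          have := PadicInt.appr_spec M (γ b)
          rw [Ideal.mem_span_singleton] at this ⊢
          exact (pow_dvd_pow _ (le_max_right _ _)).trans this
        have h4 : κ (commValue (quotientGen N.1) b.1) = commValue f b.1 := by
          rw [map_commValue]
          congr 1
          funext a
          exact hκf a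
        simp only [Function.comp_apply, h3, map_pow, h4]
        rfl
      · exact AddSubgroup.nsmul_mem _ (hlead b (mem_levelList.1 hb)).1 _
    have hsum : ((levelList A w).map fun b => (β b).appr M • L b).sum =
        ((levelList A w).map fun b => (β' b).appr M • L b).sum := by
      have := (hval β).symm.trans (heq ▸ hval β')
      exact add_left_cancel this
    have h0 := natCast_eq_of_sum_smul_lieValue_eq k hord hsum b₀ rfl
    rwa [hcast, hcast] at h0

end Separation

/-! ### Generation and change of the ring of exponents -/

namespace FreeHall

variable {S : Type*} [CommRing S] [BinomialRing S] {A : Type*} {c : ℕ}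

/-- The free generators generate the free Hall group. -/
lemma eq_top_of_isPowClosed {K : Subgroup (FreeHall S A c)} (hK : IsPowClosed S K)
    (hof : ∀ a, of a ∈ K) : K = ⊤ := by
  have h : ∀ t : HallTerm S A, mk t ∈ K := by
    intro t
    induction t with
    | of a => exact hof a
    | one => exact K.one_mem
    | mul s t hs ht => exact K.mul_mem hs ht
    | inv s hs => exact K.inv_mem hs
    | rpow s r hs => exact hK _ hs r
  refine (Subgroup.eq_top_iff' K).2 fun g => ?_
  obtain ⟨t, rfl⟩ := mk_surjective g
  exact h t

/-- Homomorphisms from a free Hall group which are compatible with exponentiation are determined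
by their values at the generators. -/
lemma hom_ext {H : Type*} [Group H] {f g : FreeHall S A c →* H} (e : H → S → H)
    (hf : ∀ x (r : S), f (x ^ r) = e (f x) r) (hg : ∀ x (r : S), g (x ^ r) = e (g x) r)
    (h : ∀ a, f (of a) = g (of a)) : f = g := by
  have htop : f.eqLocus g = ⊤ := eq_top_of_isPowClosed
    (fun x hx r => by
      change f (x ^ r) = g (x ^ r)
      rw [hf, hg, show f x = g x from hx]) h
  ext x
  exact (Subgroup.eq_top_iff' _).1 htop x

end FreeHall

/-- Restriction of the ring of exponents along a homomorphism of binomial rings. -/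
lemma IsHallGroup.restrictScalars {S T : Type*} [CommRing S] [BinomialRing S] [CommRing T]
    [BinomialRing T] (f : S →+* T) {c : ℕ} {G : Type*} [Group G] [Pow G T]
    (hG : IsHallGroup T c G) : @IsHallGroup S _ _ c G _ ⟨fun g r => g ^ f r⟩ :=
  let _ : Pow G S := ⟨fun g r => g ^ f r⟩
  have hdef : ∀ (g : G) (r : S), g ^ r = g ^ f r := fun _ _ => rfl
  { nilpotent := hG.nilpotent
    rpow_zero := fun g => by rw [hdef, map_zero, hG.rpow_zero]
    rpow_one := fun g => by rw [hdef, map_one, hG.rpow_one]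
    rpow_add := fun g r s => by rw [hdef, map_add, hG.rpow_add, hdef, hdef]
    rpow_mul := fun g r s => by rw [hdef, map_mul, hG.rpow_mul, hdef, hdef]
    conj_rpow := fun x y r => by rw [hdef, hG.conj_rpow, hdef]
    petresco := fun m hm n x r => by
      simp only [hdef, Ring.map_choose]
      exact hG.petresco m hm n x (f r) }

section ChangeRing

variable {S T : Type*} [CommRing S] [BinomialRing S] [CommRing T] [BinomialRing T] (f : S →+* T)
  (A : Type*)

/-- The homomorphism of free Hall groups induced by a homomorphism of the rings of exponents. -/
def FreeHall.mapRing (c : ℕ) : FreeHall S A c →* FreeHall T A c :=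
  let _ : Pow (FreeHall T A c) S := ⟨fun g r => g ^ f r⟩
  FreeHall.lift ((FreeHall.isHallGroup T A c).restrictScalars f) FreeHall.of

variable {A}

lemma FreeHall.mapRing_rpow {c : ℕ} (g : FreeHall S A c) (r : S) :
    FreeHall.mapRing f A c (g ^ r) = FreeHall.mapRing f A c g ^ f r :=
  let _ : Pow (FreeHall T A c) S := ⟨fun g r => g ^ f r⟩
  FreeHall.lift_rpow ((FreeHall.isHallGroup T A c).restrictScalars f) FreeHall.of g r

lemma FreeHall.transition_rpow {c : ℕ} (g : FreeHall S A (c + 1)) (r : S) :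
    FreeHall.transition S A c (g ^ r) = FreeHall.transition S A c g ^ r :=
  FreeHall.lift_rpow ((FreeHall.isHallGroup S A c).mono c.le_succ) FreeHall.of g r

lemma FreeHall.transition_mapRing {c : ℕ} (g : FreeHall S A (c + 1)) :
    FreeHall.transition T A c (FreeHall.mapRing f A (c + 1) g) =
      FreeHall.mapRing f A c (FreeHall.transition S A c g) :=
  DFunLike.congr_fun (FreeHall.hom_ext
    (f := (FreeHall.transition T A c).comp (FreeHall.mapRing f A (c + 1)))
    (g := (FreeHall.mapRing f A c).comp (FreeHall.transition S A c))
    (fun x r => x ^ f r)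
    (fun x r => by
      simp only [MonoidHom.comp_apply, FreeHall.mapRing_rpow, FreeHall.transition_rpow])
    (fun x r => by
      simp only [MonoidHom.comp_apply, FreeHall.mapRing_rpow, FreeHall.transition_rpow])
    fun _ => rfl) g

variable (A) in
/-- The homomorphism of free pro-Hall groups induced by a homomorphism of the rings of
exponents. -/
def ProHall.mapRing : ProHall S A →* ProHall T A where
  toFun g := ⟨fun c => FreeHall.mapRing f A c (g.1 c), fun c => by
    rw [FreeHall.transition_mapRing, g.2 c]⟩
  map_one' := Subtype.ext (funext fun _ => map_one _)
  map_mul' _ _ := Subtype.ext (funext fun _ => map_mul _ _ _)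

end ChangeRing

/-! ### Normal forms in free Hall groups -/

section NormalForm

variable {A : Type*} [LinearOrder (FreeMagma A)] [Finite A]

lemma map_basicProd {S T G H : Type*} [Group G] [Group H] [Pow G S] [Pow H T] (g : G →* H)
    (e : S → T) (h : ∀ (x : G) (r : S), g (x ^ r) = g x ^ e r) (f : A → G)
    (α : BasicComm A → S) (c : ℕ) :
    g (basicProd f α c) = basicProd (fun a => g (f a)) (fun b => e (α b)) c := by
  rw [basicProd, map_list_prod, List.map_map]
  refine congrArg List.prod (List.map_congr_left fun b _ => ?_)
  rw [Function.comp_apply, h, map_commValue]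

section

variable {S : Type*} [CommRing S] [BinomialRing S] {c : ℕ} {G : Type*} [Group G] [Pow G S]

lemma levelProd_eq_one (hG : IsHallGroup S c G) (f : A → G) (α : BasicComm A → S) {w : ℕ}
    (hw : c < w) : levelProd f α w = 1 := by
  refine List.prod_eq_one fun x hx => ?_
  obtain ⟨b, hb, rfl⟩ := List.mem_map.1 hx
  have h := commValue_mem_hallSeries hG f b.1
  rw [mem_levelList.1 hb] at h
  have h' := hallSeries_antitone S (show c ≤ w - 1 by omega) h
  rw [hG.hallSeries_eq_bot, Subgroup.mem_bot] at h'
  rw [h', hG.one_rpow]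

lemma basicProd_eq_of_le (hG : IsHallGroup S c G)
    (hord : ∀ u v : FreeMagma A, u.length < v.length → u < v) (f : A → G)
    (α : BasicComm A → S) {d : ℕ} (hd : c ≤ d) : basicProd f α d = basicProd f α c := by
  induction d, hd using Nat.le_induction with
  | base => rfl
  | succ d hd ih => rw [basicProd_succ hord, levelProd_eq_one hG f α (by omega), mul_one, ih]

end

section

variable {S : Type*} [CommRing S] [BinomialRing S]
  (hord : ∀ u v : FreeMagma A, u.length < v.length → u < v)

include hord

lemma FreeHall.transition_basicProd (α : BasicComm A → S) (c : ℕ) :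
    FreeHall.transition S A c (basicProd FreeHall.of α (c + 1)) = basicProd FreeHall.of α c := by
  rw [map_basicProd (FreeHall.transition S A c) id FreeHall.transition_rpow]
  exact basicProd_eq_of_le (FreeHall.isHallGroup S A c) hord _ _ c.le_succ

/-- The infinite ordered product of powers of basic commutators. -/
noncomputable def ProHall.ofExp (α : BasicComm A → S) : ProHall S A :=
  ⟨fun c => basicProd FreeHall.of α c, fun c => FreeHall.transition_basicProd hord α c⟩

lemma isHallNormalForm_iff (g : ProHall S A) (α : BasicComm A → S) :
    IsHallNormalForm g α ↔ g = ProHall.ofExp hord α :=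
  ⟨fun h => Subtype.ext (funext h), fun h => h ▸ fun _ => rfl⟩

lemma ProHall.mapRing_ofExp {T : Type*} [CommRing T] [BinomialRing T] (f : S →+* T)
    (α : BasicComm A → S) :
    ProHall.mapRing f A (ProHall.ofExp hord α) = ProHall.ofExp hord fun b => f (α b) :=
  Subtype.ext (funext fun c => map_basicProd (FreeHall.mapRing f A c) f
    (FreeHall.mapRing_rpow f) FreeHall.of α c)

lemma FreeHall.exists_eq_basicProd {c : ℕ} (g : FreeHall S A c) :
    ∃ α : BasicComm A → S, g = basicProd FreeHall.of α c :=
  (FreeHall.isHallGroup S A c).exists_eq_basicProd hord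
    (fun _ hK h => FreeHall.eq_top_of_isPowClosed hK h) g

end

section Padic

variable {p : ℕ} [Fact p.Prime] (hord : ∀ u v : FreeMagma A, u.length < v.length → u < v)

include hord

/-- The exponents of an ordered product are determined by its images in finite `p`-groups. -/
lemma eq_of_basicProd_quotientGen_eq {β β' : BasicComm A → ℤ_[p]} {c : ℕ}
    (h : ∀ N : PIndex p A, (⊤ : Subgroup (FreeGroup A ⧸ N.1)).lowerCentralSeries c = ⊥ →
      basicProd (quotientGen N.1) β c = basicProd (quotientGen N.1) β' c)
    (b : BasicComm A) (hb : b.1.length ≤ c) : β b = β' b := by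
  induction hn : b.1.length using Nat.strong_induction_on generalizing b with
  | _ n ih =>
  subst hn
  by_contra hne
  -- At the least weight where the exponents disagree, the factors of smaller weight coincide and
  -- cancel, and those of larger weight vanish in a quotient of class at most this weight; the level
  -- products remain.
  obtain ⟨N, hN, hNe⟩ := exists_levelProd_ne hord hne
  have hbl := b.1.length_pos
  have hG := N.isHallGroup hN
  have h1 := h N (hG.mono hb).nilpotent
  rw [basicProd_eq_of_le hG hord _ _ hb, basicProd_eq_of_le hG hord _ _ hb,
    ← Nat.sub_add_cancel hbl, basicProd_succ hord, basicProd_succ hord,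
    basicProd_congr (quotientGen N.1) (α := β) (β := β') fun b' hb' =>
      ih _ (by omega) b' (by omega) rfl, Nat.sub_add_cancel hbl] at h1
  exact hNe (mul_left_cancel h1)

end Padic

section Evaluation

variable {p : ℕ} [Fact p.Prime]

/-- The evaluation of a free Hall group over the `p`-adic integers in a finite `p`-group. -/
noncomputable def PIndex.eval {A : Type*} (N : PIndex p A) {c : ℕ}
    (hc : (⊤ : Subgroup (FreeGroup A ⧸ N.1)).lowerCentralSeries c = ⊥) :
    FreeHall ℤ_[p] A c →* FreeGroup A ⧸ N.1 :=
  FreeHall.lift (N.isHallGroup hc) (quotientGen N.1)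

lemma PIndex.eval_rpow {A : Type*} (N : PIndex p A) {c : ℕ}
    (hc : (⊤ : Subgroup (FreeGroup A ⧸ N.1)).lowerCentralSeries c = ⊥) (g : FreeHall ℤ_[p] A c)
    (r : ℤ_[p]) : N.eval hc (g ^ r) = N.eval hc g ^ r :=
  FreeHall.lift_rpow (N.isHallGroup hc) _ g r

lemma PIndex.eval_basicProd (N : PIndex p A) {c : ℕ}
    (hc : (⊤ : Subgroup (FreeGroup A ⧸ N.1)).lowerCentralSeries c = ⊥) (β : BasicComm A → ℤ_[p])
    (d : ℕ) : N.eval hc (basicProd FreeHall.of β d) = basicProd (quotientGen N.1) β d :=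
  map_basicProd (N.eval hc) id (N.eval_rpow hc) FreeHall.of β d

end Evaluation

section Uniqueness

variable {S : Type*} [CommRing S] [BinomialRing S]
  (hord : ∀ u v : FreeMagma A, u.length < v.length → u < v) (p : ℕ) [Fact p.Prime]
  (hsep : ∀ x y : S, x ≠ y → ∃ f : S →+* ℤ_[p], f x ≠ f y)

include hord hsep

/-- Uniqueness of normal forms, if the ring of exponents is separated by homomorphisms to the
`p`-adic integers. -/
lemma FreeHall.eq_of_basicProd_eq {α α' : BasicComm A → S} {c : ℕ}
    (h : (basicProd FreeHall.of α c : FreeHall S A c) = basicProd FreeHall.of α' c)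
    (b : BasicComm A) (hb : b.1.length ≤ c) : α b = α' b := by
  by_contra hne
  obtain ⟨f, hf⟩ := hsep _ _ hne
  have h1 := congrArg (FreeHall.mapRing f A c) h
  rw [map_basicProd (FreeHall.mapRing f A c) f (FreeHall.mapRing_rpow f),
    map_basicProd (FreeHall.mapRing f A c) f (FreeHall.mapRing_rpow f)] at h1
  refine hf (eq_of_basicProd_quotientGen_eq hord (β := fun b => f (α b))
    (β' := fun b => f (α' b)) (fun N hN => ?_) b hb)
  have h2 := congrArg (N.eval hN) h1
  exact (N.eval_basicProd hN _ c).symm.trans (h2.trans (N.eval_basicProd hN _ c))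

lemma ProHall.ofExp_injective :
    Function.Injective (ProHall.ofExp hord : (BasicComm A → S) → ProHall S A) := fun _ _ h =>
  funext fun b => FreeHall.eq_of_basicProd_eq hord p hsep
    (congrFun (congrArg Subtype.val h) b.1.length) b le_rfl

/-- Uniqueness in each class makes the exponents of the components of `g` compatible, so the
exponent of `b` may be read off in the class equal to its weight. -/
lemma ProHall.ofExp_surjective :
    Function.Surjective (ProHall.ofExp hord : (BasicComm A → S) → ProHall S A) := by
  intro g
  choose α hα using fun c => FreeHall.exists_eq_basicProd hord (g.1 c)
  have hstep : ∀ c b, b.1.length ≤ c → α (c + 1) b = α c b := by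
    intro c b hb
    refine FreeHall.eq_of_basicProd_eq hord p hsep (c := c) ?_ b hb
    rw [← FreeHall.transition_basicProd hord, ← hα, ← hα, g.2 c]
  have hstab : ∀ b c, b.1.length ≤ c → α c b = α b.1.length b := by
    intro b c hc
    induction c, hc using Nat.le_induction with
    | base => rfl
    | succ c hc ih => rw [hstep c b hc, ih]
  refine ⟨fun b => α b.1.length b, Subtype.ext (funext fun c => ?_)⟩
  rw [hα c]
  exact basicProd_congr _ fun b hb => (hstab b c hb).symm

theorem ProHall.existsUnique_isHallNormalForm (g : ProHall S A) :
    ∃! α : BasicComm A → S, IsHallNormalForm g α := by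
  obtain ⟨α, rfl⟩ := ProHall.ofExp_surjective hord p hsep g
  refine ⟨α, (isHallNormalForm_iff hord _ _).2 rfl, fun α' h => ?_⟩
  exact (ProHall.ofExp_injective hord p hsep ((isHallNormalForm_iff hord _ _).1 h)).symm

end Uniqueness

end NormalForm

/-! ### The free pro-Hall group over the `p`-adic integers is the free pro-`p` group -/

section Comparison

variable {p : ℕ} [Fact p.Prime] {A : Type*}

lemma PIndex.map_rpow {N M : PIndex p A} (h : N.1 ≤ M.1) (x : FreeGroup A ⧸ N.1) (r : ℤ_[p]) :
    QuotientGroup.map N.1 M.1 (MonoidHom.id _) h (x ^ r) =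
      QuotientGroup.map N.1 M.1 (MonoidHom.id _) h x ^ r := by
  have hp := (Fact.out : p.Prime).one_lt
  have hle : Nat.log p M.1.index ≤ Nat.log p N.1.index := (Nat.pow_dvd_pow_iff_le_right hp).1 (by
    rw [N.pow_log_index, M.pow_log_index]; exact Subgroup.index_dvd_of_le h)
  rw [PIndex.rpow_def, map_pow, PIndex.rpow_def]
  refine (pow_appr_eq_pow (M.pow_eq_one _) ?_).symm
  have := PadicInt.appr_spec (Nat.log p N.1.index) r
  rw [Ideal.mem_span_singleton] at this ⊢
  exact (pow_dvd_pow _ hle).trans this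

lemma PIndex.eval_transition (N : PIndex p A) {c : ℕ}
    (hc : (⊤ : Subgroup (FreeGroup A ⧸ N.1)).lowerCentralSeries c = ⊥)
    (hc' : (⊤ : Subgroup (FreeGroup A ⧸ N.1)).lowerCentralSeries (c + 1) = ⊥)
    (g : FreeHall ℤ_[p] A (c + 1)) :
    N.eval hc (FreeHall.transition ℤ_[p] A c g) = N.eval hc' g :=
  DFunLike.congr_fun (FreeHall.hom_ext
    (f := (N.eval hc).comp (FreeHall.transition ℤ_[p] A c)) (g := N.eval hc') (fun x r => x ^ r)
    (fun x r => by
      simp only [MonoidHom.comp_apply, FreeHall.transition_rpow, PIndex.eval_rpow])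
    (fun x r => N.eval_rpow hc' x r) fun _ => rfl) g

lemma PIndex.eval_eq_of_le (N : PIndex p A) (g : ProHall ℤ_[p] A) {c d : ℕ} (hcd : c ≤ d)
    (hc : (⊤ : Subgroup (FreeGroup A ⧸ N.1)).lowerCentralSeries c = ⊥)
    (hd : (⊤ : Subgroup (FreeGroup A ⧸ N.1)).lowerCentralSeries d = ⊥) :
    N.eval hd (g.1 d) = N.eval hc (g.1 c) := by
  induction d, hcd using Nat.le_induction with
  | base => rfl
  | succ d hcd ih =>
    have h := ((N.isHallGroup hc).mono hcd).nilpotent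
    rw [← N.eval_transition h hd, g.2 d, ih h]

lemma PIndex.map_eval {N M : PIndex p A} (h : N.1 ≤ M.1) (g : ProHall ℤ_[p] A) {c d : ℕ}
    (hc : (⊤ : Subgroup (FreeGroup A ⧸ N.1)).lowerCentralSeries c = ⊥)
    (hd : (⊤ : Subgroup (FreeGroup A ⧸ M.1)).lowerCentralSeries d = ⊥) :
    QuotientGroup.map N.1 M.1 (MonoidHom.id _) h (N.eval hc (g.1 c)) = M.eval hd (g.1 d) := by
  have hc' := ((N.isHallGroup hc).mono (le_max_left c d)).nilpotent
  have hd' := ((M.isHallGroup hd).mono (le_max_right c d)).nilpotent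
  rw [← N.eval_eq_of_le g (le_max_left c d) hc hc', ← M.eval_eq_of_le g (le_max_right c d) hd hd']
  exact DFunLike.congr_fun (FreeHall.hom_ext
    (f := (QuotientGroup.map N.1 M.1 (MonoidHom.id _) h).comp (N.eval hc')) (g := M.eval hd')
    (fun x r => x ^ r)
    (fun x r => by simp only [MonoidHom.comp_apply, PIndex.eval_rpow, PIndex.map_rpow])
    (fun x r => M.eval_rpow hd' x r) fun _ => rfl) _

/-- The natural homomorphism from the free pro-Hall group over the `p`-adic integers to the free
pro-`p` group. -/
noncomputable def ProHall.toFreeProP (p : ℕ) [Fact p.Prime] (A : Type*) :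
    ProHall ℤ_[p] A →* FreeProP p A where
  toFun g := ⟨fun N => N.eval N.exists_lowerCentralSeries_eq_bot.choose_spec (g.1 _),
    fun _ _ h => PIndex.map_eval h g _ _⟩
  map_one' := Subtype.ext (funext fun N => map_one (N.eval _))
  map_mul' _ _ := Subtype.ext (funext fun N => map_mul (N.eval _) _ _)

/-- The value does not depend on the class bound chosen in the definition, so any bound valid for
the quotient may be used. -/
lemma ProHall.toFreeProP_apply (g : ProHall ℤ_[p] A) (N : PIndex p A) {c : ℕ}
    (hc : (⊤ : Subgroup (FreeGroup A ⧸ N.1)).lowerCentralSeries c = ⊥) :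
    (ProHall.toFreeProP p A g).1 N = N.eval hc (g.1 c) := by
  have h := N.exists_lowerCentralSeries_eq_bot.choose_spec
  change N.eval h (g.1 _) = _
  rcases le_total c N.exists_lowerCentralSeries_eq_bot.choose with hle | hle
  · exact N.eval_eq_of_le g hle hc h
  · exact (N.eval_eq_of_le g hle h hc).symm

/-- Any two normal subgroups of `p`-power index contain a third one. -/
lemma PIndex.exists_le_le (N M : PIndex p A) : ∃ L : PIndex p A, L.1 ≤ N.1 ∧ L.1 ≤ M.1 := by
  refine ⟨⟨N.1 ⊓ M.1, inferInstance, ?_⟩, inf_le_left, inf_le_right⟩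
  obtain ⟨k, hk⟩ := N.2.2
  obtain ⟨l, hl⟩ := M.2.2
  have h1 : (N.1 ⊓ M.1).relIndex M.1 * M.1.index = (N.1 ⊓ M.1).index :=
    Subgroup.relIndex_mul_index inf_le_right
  rw [Subgroup.inf_relIndex_right] at h1
  have h2 : N.1.relIndex M.1 ∣ p ^ k := hk ▸ Subgroup.relIndex_dvd_index_of_normal N.1 M.1
  obtain ⟨j, -, hj⟩ := (Nat.dvd_prime_pow (Fact.out : p.Prime)).1 h2
  exact ⟨j + l, by rw [← h1, hj, hl, pow_add]⟩

/-- The power depends only on `r` modulo the index of `N`, so it is locally constant and continuous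
for every topology on the quotient. -/
lemma PIndex.continuous_rpow (N : PIndex p A) [TopologicalSpace (FreeGroup A ⧸ N.1)]
    (x : FreeGroup A ⧸ N.1) : Continuous fun r : ℤ_[p] => x ^ r := by
  refine continuous_iff_continuousAt.2 fun r => ?_
  refine ContinuousAt.congr (f := fun _ => x ^ r.appr (Nat.log p N.1.index)) continuousAt_const ?_
  have hev : ∀ᶠ s in nhds r, ‖s - r‖ < (p : ℝ) ^ (-(Nat.log p N.1.index : ℕ) : ℤ) := by
    have hcont : Continuous fun s : ℤ_[p] => ‖s - r‖ := (continuous_id.sub continuous_const).norm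
    refine hcont.tendsto r (Iio_mem_nhds ?_)
    rw [sub_self, norm_zero]
    exact zpow_pos (by exact_mod_cast (Fact.out : p.Prime).pos) _
  filter_upwards [hev] with s hs
  refine (pow_appr_eq_pow (N.pow_eq_one x) ?_).symm
  have := add_mem ((PadicInt.norm_le_pow_iff_mem_span_pow _ _).1 hs.le)
    (PadicInt.appr_spec (Nat.log p N.1.index) r)
  rwa [sub_add_sub_cancel] at this

variable [LinearOrder (FreeMagma A)] [Finite A]

lemma isPadicNormalForm_iff {h : FreeProP p A} {β : BasicComm A → ℤ_[p]} :
    IsPadicNormalForm h β ↔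
      ∀ N : PIndex p A, ∀ᶠ c in Filter.atTop, h.1 N = basicProd (quotientGen N.1) β c := by
  refine forall_congr' fun N => Filter.eventually_congr (Filter.Eventually.of_forall fun c => ?_)
  let e : FreeProP p A →* FreeGroup A ⧸ N.1 :=
    { toFun := fun g => g.1 N, map_one' := rfl, map_mul' := fun _ _ => rfl }
  have : (((basicList A c).map fun b => FreeProP.padicPow
      (commValue (fun a => FreeProP.ofFreeGroup p A (FreeGroup.of a)) b.1) (β b)).prod).1 N =
      basicProd (quotientGen N.1) β c := by
    change e (List.prod _) = _
    rw [map_list_prod, List.map_map]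
    refine congrArg List.prod (List.map_congr_left fun b _ => ?_)
    change e (commValue (fun a => FreeProP.ofFreeGroup p A (FreeGroup.of a)) b.1) ^ β b = _
    rw [map_commValue]
    rfl
  rw [this]

lemma IsPadicNormalForm.eq {h h' : FreeProP p A} {β : BasicComm A → ℤ_[p]}
    (hh : IsPadicNormalForm h β) (hh' : IsPadicNormalForm h' β) : h = h' := by
  refine Subtype.ext (funext fun N => ?_)
  obtain ⟨c, h1, h2⟩ := ((isPadicNormalForm_iff.1 hh N).and (isPadicNormalForm_iff.1 hh' N)).exists
  rw [h1, h2]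

variable (hord : ∀ u v : FreeMagma A, u.length < v.length → u < v)

lemma ProHall.toFreeProP_ofExp_apply (β : BasicComm A → ℤ_[p]) (N : PIndex p A) {c : ℕ}
    (hc : (⊤ : Subgroup (FreeGroup A ⧸ N.1)).lowerCentralSeries c = ⊥) :
    (ProHall.toFreeProP p A (ProHall.ofExp hord β)).1 N = basicProd (quotientGen N.1) β c := by
  rw [ProHall.toFreeProP_apply _ N hc]
  exact N.eval_basicProd hc β c

lemma ProHall.isPadicNormalForm_toFreeProP (β : BasicComm A → ℤ_[p]) :
    IsPadicNormalForm (ProHall.toFreeProP p A (ProHall.ofExp hord β)) β := by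
  refine isPadicNormalForm_iff.2 fun N => ?_
  obtain ⟨c, hc⟩ := N.exists_lowerCentralSeries_eq_bot
  filter_upwards [Filter.eventually_ge_atTop c] with d hd
  exact ProHall.toFreeProP_ofExp_apply hord β N ((N.isHallGroup hc).mono hd).nilpotent

include hord in
lemma ProHall.toFreeProP_injective : Function.Injective (ProHall.toFreeProP p A) := by
  have hsep : ∀ x y : ℤ_[p], x ≠ y → ∃ f : ℤ_[p] →+* ℤ_[p], f x ≠ f y :=
    fun _ _ h => ⟨RingHom.id _, h⟩
  intro g g' h
  obtain ⟨β, rfl⟩ := ProHall.ofExp_surjective hord p hsep g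
  obtain ⟨β', rfl⟩ := ProHall.ofExp_surjective hord p hsep g'
  refine congrArg _ (funext fun b => eq_of_basicProd_quotientGen_eq hord (c := b.1.length)
    (fun N hN => ?_) b le_rfl)
  rw [← ProHall.toFreeProP_ofExp_apply hord β N hN, h, ProHall.toFreeProP_ofExp_apply hord β' N hN]

include hord in
-- Compactness: the exponent families that represent `h` in a given finite quotient form a nonempty
-- closed subset of a product of copies of `ℤ_[p]`. These sets are directed, so a single family
-- represents `h` in all quotients.
lemma ProHall.toFreeProP_surjective : Function.Surjective (ProHall.toFreeProP p A) := by
  intro h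
  let K : PIndex p A → Set (BasicComm A → ℤ_[p]) := fun N =>
    {β | (ProHall.toFreeProP p A (ProHall.ofExp hord β)).1 N = h.1 N}
  have hne : ∀ N, (K N).Nonempty := by
    intro N
    obtain ⟨c, hc⟩ := N.exists_lowerCentralSeries_eq_bot
    obtain ⟨x, hx⟩ := QuotientGroup.mk_surjective (h.1 N)
    -- A word representing `h` in the quotient has a normal form in the free Hall group, and its
    -- exponents serve as `β`.
    obtain ⟨β, hβ⟩ := FreeHall.exists_eq_basicProd hord
      (FreeGroup.lift (FreeHall.of : A → FreeHall ℤ_[p] A c) x)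
    refine ⟨β, ?_⟩
    change _ = _
    rw [ProHall.toFreeProP_ofExp_apply hord β N hc, ← N.eval_basicProd hc, ← hβ, ← hx]
    have : (N.eval hc).comp (FreeGroup.lift FreeHall.of) = QuotientGroup.mk' N.1 := by
      ext a
      simp only [MonoidHom.comp_apply, FreeGroup.lift_apply_of]
      rfl
    exact DFunLike.congr_fun this x
  have hcl : ∀ N, IsClosed (K N) := by
    intro N
    obtain ⟨c, hc⟩ := N.exists_lowerCentralSeries_eq_bot
    let _ : TopologicalSpace (FreeGroup A ⧸ N.1) := ⊥
    have : DiscreteTopology (FreeGroup A ⧸ N.1) := ⟨rfl⟩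
    have hcont : Continuous fun β : BasicComm A → ℤ_[p] => basicProd (quotientGen N.1) β c :=
      continuous_list_prod _ fun b _ => (N.continuous_rpow _).comp (continuous_apply b)
    have hK : K N = {β | basicProd (quotientGen N.1) β c = h.1 N} := by
      ext β
      change (_ = _) ↔ _
      rw [ProHall.toFreeProP_ofExp_apply hord β N hc]
      rfl
    rw [hK]
    exact isClosed_eq hcont continuous_const
  have hdir : Directed (· ⊇ ·) K := by
    have hmono : ∀ L N : PIndex p A, L.1 ≤ N.1 → K L ⊆ K N := by
      intro L N hLN β hβ
      have h1 := congrArg (QuotientGroup.map L.1 N.1 (MonoidHom.id _) hLN) hβ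
      rwa [h.2 L N hLN, (ProHall.toFreeProP p A (ProHall.ofExp hord β)).2 L N hLN] at h1
    intro N M
    obtain ⟨L, hLN, hLM⟩ := N.exists_le_le M
    exact ⟨L, hmono L N hLN, hmono L M hLM⟩
  have : Nonempty (PIndex p A) := ⟨⟨⊤, inferInstance, 0, by simp⟩⟩
  obtain ⟨β, hβ⟩ := IsCompact.nonempty_iInter_of_directed_nonempty_isCompact_isClosed K hdir hne
    (fun N => (hcl N).isCompact) hcl
  exact ⟨ProHall.ofExp hord β, Subtype.ext (funext fun N => Set.mem_iInter.1 hβ N)⟩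

end Comparison

/-! ### Ring homomorphisms from the binomial closure to the `p`-adic integers -/

lemma Ring.factorial_mul_choose_eq_prod {S : Type*} [CommRing S] [BinomialRing S] (a : S) (n : ℕ) :
    (n ! : S) * Ring.choose a n = ∏ j ∈ Finset.range n, (a - (j : S)) := by
  rw [← nsmul_eq_mul, ← Ring.descPochhammer_eq_factorial_smul_choose]
  induction n with
  | zero => simp
  | succ n ih =>
    rw [Finset.prod_range_succ, ← ih, descPochhammer_succ_right, Polynomial.smeval_mul]
    simp [Polynomial.smeval_sub, Polynomial.smeval_natCast]

namespace BinClosure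

variable {R : Type*} [CommRing R] {p : ℕ} [Fact p.Prime]

/-- Nonzero integers become invertible in `ℚ_[p]`, which has characteristic zero. -/
lemma exists_hom_loc (f : R →+* ℤ_[p]) :
    ∃ g : Loc R →+* ℚ_[p], ∀ r, g (algebraMap R (Loc R) r) = algebraMap ℤ_[p] ℚ_[p] (f r) := by
  have h : ∀ y : Algebra.algebraMapSubmonoid R ℤ⁰, IsUnit ((algebraMap ℤ_[p] ℚ_[p]).comp f y) := by
    rintro ⟨_, n, hn, rfl⟩
    have hn' : (n : ℤ) ≠ 0 := nonZeroDivisors.ne_zero hn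
    simpa using hn'
  exact ⟨IsLocalization.lift h, fun r => IsLocalization.lift_eq h r⟩

/-- If `g α` comes from `a : ℤ_[p]`, then the binomial coefficients of `α` go to those of `a`, which
are again `p`-adic integers; division by `n !` is legitimate in `ℚ_[p]`. -/
lemma stage_le_comap_range (g : Loc R →+* ℚ_[p])
    (hg : ∀ r, g (algebraMap R (Loc R) r) ∈ (algebraMap ℤ_[p] ℚ_[p]).range) (i : ℕ) :
    stage R i ≤ (algebraMap ℤ_[p] ℚ_[p]).range.comap g := by
  induction i with
  | zero =>
    rintro _ ⟨r, rfl⟩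
    exact hg r
  | succ i ih =>
    refine Subring.closure_le.2 (Set.union_subset ih ?_)
    rintro x ⟨α, hα, n, hx⟩
    obtain ⟨a, ha⟩ := ih hα
    refine ⟨Ring.choose a n, ?_⟩
    have h1 := congrArg g hx
    have h2 := congrArg (algebraMap ℤ_[p] ℚ_[p]) (Ring.factorial_mul_choose_eq_prod a n)
    simp only [map_mul, map_natCast, map_prod, map_sub, ← ha] at h1 h2
    rw [← h1] at h2
    exact mul_left_cancel₀ (Nat.cast_ne_zero.2 n.factorial_ne_zero) h2

/-- Homomorphisms to the `p`-adic integers extend to the binomial closure. -/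
theorem exists_extend (f : R →+* ℤ_[p]) :
    ∃ g : BinClosure R →+* ℤ_[p], ∀ r, g (BinClosure.of R r) = f r := by
  obtain ⟨g, hg⟩ := exists_hom_loc f
  have hinj : Function.Injective (algebraMap ℤ_[p] ℚ_[p]) := IsFractionRing.injective _ _
  let e : ℤ_[p] ≃+* (algebraMap ℤ_[p] ℚ_[p]).range :=
    RingEquiv.ofBijective (algebraMap ℤ_[p] ℚ_[p]).rangeRestrict
      ⟨fun _ _ h => hinj (Subtype.ext_iff.1 h :), RingHom.rangeRestrict_surjective _⟩
  have hmem : ∀ x : BinClosure R, (g.comp (carrier R).subtype) x ∈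
      (algebraMap ℤ_[p] ℚ_[p]).range := by
    rintro ⟨x, hx⟩
    obtain ⟨i, hi⟩ := (mem_carrier R).1 hx
    exact stage_le_comap_range g (fun r => ⟨f r, (hg r).symm⟩) i hi
  refine ⟨e.symm.toRingHom.comp ((g.comp (carrier R).subtype).codRestrict _ hmem), fun r => ?_⟩
  exact e.symm_apply_eq.2 (Subtype.ext (hg r))

lemma exists_mul_eq_of (x : BinClosure R) :
    ∃ n : ℕ, n ≠ 0 ∧ ∃ r : R, (n : BinClosure R) * x = BinClosure.of R r := by
  obtain ⟨⟨r, ⟨_, m, hm, rfl⟩⟩, h⟩ := IsLocalization.surj (Algebra.algebraMapSubmonoid R ℤ⁰) x.1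
  have hm' : (m : ℤ) ≠ 0 := nonZeroDivisors.ne_zero hm
  -- The sign of the integer denominator is moved to the numerator.
  refine ⟨m.natAbs, Int.natAbs_ne_zero.2 hm', (m.sign : R) * r, Subtype.ext ?_⟩
  have h' : x.1 * (m : Loc R) = algebraMap R (Loc R) r := by simpa using h
  have hs : (m.natAbs : Loc R) = (m.sign : Loc R) * (m : Loc R) := by
    rw [← Int.cast_natCast, ← Int.sign_mul_self_eq_natAbs, Int.cast_mul]
  have ho : (BinClosure.of R ((m.sign : R) * r)).1 = (m.sign : Loc R) * algebraMap R (Loc R) r := by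
    change algebraMap R (Loc R) _ = _
    rw [map_mul, map_intCast]
  rw [ho, ← h', Subring.coe_mul, Subring.coe_natCast, hs]
  ring

/-- Separating finitely many elements of the binomial closure amounts to separating finitely many
elements of the ring. -/
theorem exists_finset_injOn (C : Finset (BinClosure R)) :
    ∃ D : Finset R, ∀ f : R →+* ℤ_[p], Set.InjOn f (D : Set R) →
      ∀ g : BinClosure R →+* ℤ_[p], (∀ r, g (BinClosure.of R r) = f r) →
        Set.InjOn g (C : Set (BinClosure R)) := by
  classical
  choose n hn r hr using exists_mul_eq_of (R := R)
  -- After clearing denominators, each difference of elements of `C` becomes an element of `R`. The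
  -- presence of `0` forces `f` not to kill it when it is nonzero.
  refine ⟨insert 0 ((C ×ˢ C).image fun q => r (q.1 - q.2)), fun f hf g hg x hx y hy hxy => ?_⟩
  have h0 : f (r (x - y)) = f 0 := by
    rw [← hg, ← hr, map_mul, map_sub, hxy, sub_self, mul_zero, map_zero]
  have hr0 : r (x - y) = 0 := by
    refine hf (Finset.mem_coe.2 (Finset.mem_insert_of_mem ?_))
      (Finset.mem_coe.2 (Finset.mem_insert_self _ _)) h0
    exact Finset.mem_image.2 ⟨(x, y), Finset.mem_product.2 ⟨hx, hy⟩, rfl⟩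
  have h1 := hr (x - y)
  rw [hr0, map_zero] at h1
  have h2 := congrArg Subtype.val h1
  refine sub_eq_zero.1 (Subtype.ext ((isUnit_natCast R (hn (x - y))).mul_left_cancel ?_))
  simpa using h2

end BinClosure

/-! ### Residual properties of the free pro-Hall group -/

/-- The residual property mentions no order, but its proof through normal forms needs one. -/
lemma FreeMagma.exists_linearOrder_length_lt (A : Type*) :
    ∃ _ : LinearOrder (FreeMagma A), ∀ u v : FreeMagma A, u.length < v.length → u < v := by
  classical
  let o : LinearOrder (FreeMagma A) := LinearOrder.lift'
    (fun u : FreeMagma A => toLex (u.length, embeddingToCardinal u))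
    fun u v h => embeddingToCardinal.injective (congrArg (fun q => (ofLex q).2) h)
  exact ⟨o, fun u v h => Prod.Lex.toLex_lt_toLex.2 (Or.inl h)⟩

section Residual

variable {p : ℕ} [Fact p.Prime] {A : Type*} [LinearOrder (FreeMagma A)] [Finite A]
  {S : Type*} [CommRing S] [BinomialRing S]

/-- The homomorphism to the free pro-`p` group that is induced by a homomorphism to the `p`-adic
integers of the ring of exponents. -/
noncomputable def ProHall.evalPadic (f : S →+* ℤ_[p]) (A : Type*) :
    ProHall S A →* FreeProP p A :=
  (ProHall.toFreeProP p A).comp (ProHall.mapRing f A)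

variable (hord : ∀ u v : FreeMagma A, u.length < v.length → u < v)
include hord

lemma ProHall.isPadicNormalForm_evalPadic (f : S →+* ℤ_[p]) {g : ProHall S A}
    {α : BasicComm A → S} (h : IsHallNormalForm g α) :
    IsPadicNormalForm (ProHall.evalPadic f A g) fun b => f (α b) := by
  obtain rfl := (isHallNormalForm_iff hord g α).1 h
  change IsPadicNormalForm (ProHall.toFreeProP p A (ProHall.mapRing f A _)) _
  rw [ProHall.mapRing_ofExp]
  exact ProHall.isPadicNormalForm_toFreeProP hord _

/-- For two different elements it is enough that `f` separates the two exponents at one basic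
commutator where the normal forms differ; finitely many pairs thus involve finitely many ring
elements. -/
lemma ProHall.exists_finset_injOn_evalPadic
    (hsep : ∀ x y : S, x ≠ y → ∃ f : S →+* ℤ_[p], f x ≠ f y) (C : Finset (ProHall S A)) :
    ∃ E : Finset S, ∀ f : S →+* ℤ_[p], Set.InjOn f (E : Set S) →
      Set.InjOn (ProHall.evalPadic f A) (C : Set (ProHall S A)) := by
  classical
  have hpair : ∀ g h : ProHall S A, ∃ E : Finset S, ∀ f : S →+* ℤ_[p], Set.InjOn f (E : Set S) →
      ProHall.evalPadic f A g = ProHall.evalPadic f A h → g = h := by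
    intro g h
    obtain ⟨α, rfl⟩ := ProHall.ofExp_surjective hord p hsep g
    obtain ⟨β, rfl⟩ := ProHall.ofExp_surjective hord p hsep h
    by_cases hαβ : α = β
    · exact ⟨∅, fun _ _ _ => congrArg _ hαβ⟩
    · obtain ⟨b, hb⟩ := Function.ne_iff.1 hαβ
      refine ⟨{α b, β b}, fun f hf hfg => (hb (hf (by simp) (by simp) ?_)).elim⟩
      have h1 := ProHall.toFreeProP_injective hord hfg
      rw [ProHall.mapRing_ofExp, ProHall.mapRing_ofExp] at h1
      exact congrFun (ProHall.ofExp_injective hord p (fun _ _ h => ⟨RingHom.id _, h⟩) h1) b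
  choose E hE using hpair
  refine ⟨(C ×ˢ C).biUnion fun q => E q.1 q.2, fun f hf g hg h hh hgh => hE g h f ?_ hgh⟩
  exact hf.mono (Finset.coe_subset.2
    (Finset.subset_biUnion_of_mem (fun q => E q.1 q.2) (x := (g, h)) (Finset.mem_product.2 ⟨hg, hh⟩)))

/-- The ordered products over the basic commutators identify the free pro-Hall group over the
`p`-adic integers with the free pro-`p` group. -/
noncomputable def ProHall.equivFreeProP : ProHall ℤ_[p] A ≃* FreeProP p A :=
  MulEquiv.ofBijective (ProHall.toFreeProP p A)
    ⟨ProHall.toFreeProP_injective hord, ProHall.toFreeProP_surjective hord⟩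

/-- The homomorphism from the free pro-`p` group that is induced by a homomorphism from the `p`-adic
integers to the ring of exponents. -/
noncomputable def FreeProP.toProHall (j : ℤ_[p] →+* S) : FreeProP p A →* ProHall S A :=
  (ProHall.mapRing j A).comp (ProHall.equivFreeProP hord).symm.toMonoidHom

lemma FreeProP.toProHall_toFreeProP (j : ℤ_[p] →+* S) (g : ProHall ℤ_[p] A) :
    FreeProP.toProHall hord j (ProHall.toFreeProP p A g) = ProHall.mapRing j A g :=
  congrArg (ProHall.mapRing j A) ((ProHall.equivFreeProP hord).symm_apply_apply g)

lemma FreeProP.isHallNormalForm_toProHall (j : ℤ_[p] →+* S) {h : FreeProP p A}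
    {β : BasicComm A → ℤ_[p]} (hh : IsPadicNormalForm h β) :
    IsHallNormalForm (FreeProP.toProHall hord j h) fun b => j (β b) := by
  rw [hh.eq (ProHall.isPadicNormalForm_toFreeProP hord β), FreeProP.toProHall_toFreeProP,
    ProHall.mapRing_ofExp, isHallNormalForm_iff hord]

/-- On normal forms the composite applies `f ∘ j` to the exponents, and this is the identity. -/
lemma ProHall.evalPadic_toProHall {j : ℤ_[p] →+* S} {f : S →+* ℤ_[p]} (hfj : ∀ z, f (j z) = z)
    (h : FreeProP p A) : ProHall.evalPadic f A (FreeProP.toProHall hord j h) = h := by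
  obtain ⟨g, rfl⟩ := ProHall.toFreeProP_surjective hord h
  obtain ⟨β, rfl⟩ := ProHall.ofExp_surjective hord p (fun _ _ h => ⟨RingHom.id _, h⟩) g
  rw [FreeProP.toProHall_toFreeProP]
  change ProHall.toFreeProP p A (ProHall.mapRing f A _) = _
  simp only [ProHall.mapRing_ofExp, hfj]

end Residual

/-- If the homomorphisms `R → ℤ_[p]` with the property `P` separate finite sets, then normal forms
over the binomial closure of `R` exist uniquely, and the homomorphisms to the free pro-`p` group that
they induce separate finite sets. -/
lemma ProHall.exists_extend_injOn (p : ℕ) [Fact p.Prime] {A : Type*} [LinearOrder (FreeMagma A)]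
    [Finite A] {R : Type*} [CommRing R] (P : (R →+* ℤ_[p]) → Prop)
    (hP : ∀ D : Finset R, ∃ f : R →+* ℤ_[p], P f ∧ Set.InjOn f (D : Set R))
    (hord : ∀ u v : FreeMagma A, u.length < v.length → u < v) :
    (∀ g : ProHall (BinClosure R) A, ∃! α : BasicComm A → BinClosure R, IsHallNormalForm g α) ∧
    ∀ C : Finset (ProHall (BinClosure R) A), ∃ f : R →+* ℤ_[p], P f ∧
      ∃ f' : BinClosure R →+* ℤ_[p], (∀ r, f' (BinClosure.of R r) = f r) ∧
        Set.InjOn (ProHall.evalPadic f' A) (C : Set (ProHall (BinClosure R) A)) := by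
  have hext : ∀ E : Finset (BinClosure R), ∃ f : R →+* ℤ_[p], P f ∧
      ∃ f' : BinClosure R →+* ℤ_[p], (∀ r, f' (BinClosure.of R r) = f r) ∧
        Set.InjOn f' (E : Set (BinClosure R)) := by
    intro E
    obtain ⟨D, hD⟩ := BinClosure.exists_finset_injOn (p := p) E
    obtain ⟨f, hf, hfD⟩ := hP D
    obtain ⟨f', hf'⟩ := BinClosure.exists_extend f
    exact ⟨f, hf, f', hf', hD f hfD f' hf'⟩
  have hsep : ∀ x y : BinClosure R, x ≠ y → ∃ f : BinClosure R →+* ℤ_[p], f x ≠ f y := by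
    classical
    intro x y hxy
    obtain ⟨-, -, f', -, hf'⟩ := hext {x, y}
    exact ⟨f', fun h => hxy (hf' (by simp) (by simp) h)⟩
  refine ⟨fun g => ProHall.existsUnique_isHallNormalForm hord p hsep g, fun C => ?_⟩
  obtain ⟨E, hE⟩ := ProHall.exists_finset_injOn_evalPadic hord hsep C
  obtain ⟨f, hf, f', hf', hfE⟩ := hext E
  exact ⟨f, hf, f', hf', hE f' hfE⟩

/-! ### The main theorem -/

theorem mainTheorem1 (p : ℕ) [Fact p.Prime] (A : Type*) [Finite A] (R : Type*) [CommRing R] :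
    -- rings
    (FullyResiduallyRing R ℤ_[p] →
      FullyResiduallyGroup (ProHall (BinClosure R) A) (FreeProP p A) ∧
      ∀ _ : LinearOrder (FreeMagma A),
        (∀ u v : FreeMagma A, u.length < v.length → u < v) →
        (∀ g : ProHall (BinClosure R) A, ∃! α : BasicComm A → BinClosure R,
          IsHallNormalForm g α) ∧
        ∀ C : Finset (ProHall (BinClosure R) A),
          ∃ (f : BinClosure R →+* ℤ_[p]) (F : ProHall (BinClosure R) A →* FreeProP p A),
            Set.InjOn F (C : Set (ProHall (BinClosure R) A)) ∧
            ∀ g α, IsHallNormalForm g α → IsPadicNormalForm (F g) fun b => f (α b)) ∧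
    -- algebras over the `p`-adic integers
    (∀ _ : Algebra ℤ_[p] R, FullyResiduallyAlg ℤ_[p] R ℤ_[p] →
      FullyResiduallyGroup (ProHall (BinClosure R) A) (FreeProP p A) ∧
      ∀ _ : LinearOrder (FreeMagma A),
        (∀ u v : FreeMagma A, u.length < v.length → u < v) →
        (∀ g : ProHall (BinClosure R) A, ∃! α : BasicComm A → BinClosure R,
          IsHallNormalForm g α) ∧
        ∃ ι : FreeProP p A →* ProHall (BinClosure R) A,
          (∀ h β, IsPadicNormalForm h β →
            IsHallNormalForm (ι h) fun b => BinClosure.of R (algebraMap ℤ_[p] R (β b))) ∧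
          ∀ C : Finset (ProHall (BinClosure R) A),
            ∃ (f : BinClosure R →+* ℤ_[p]) (F : ProHall (BinClosure R) A →* FreeProP p A),
              (∀ z : ℤ_[p], f (BinClosure.of R (algebraMap ℤ_[p] R z)) = z) ∧
              Set.InjOn F (C : Set (ProHall (BinClosure R) A)) ∧
              (∀ g α, IsHallNormalForm g α → IsPadicNormalForm (F g) fun b => f (α b)) ∧
              ∀ h, F (ι h) = h) := by
  obtain ⟨o, ho⟩ := FreeMagma.exists_linearOrder_length_lt A
  have hgroup : ∀ P : (R →+* ℤ_[p]) → Prop,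
      (∀ D : Finset R, ∃ f : R →+* ℤ_[p], P f ∧ Set.InjOn f (D : Set R)) →
      FullyResiduallyGroup (ProHall (BinClosure R) A) (FreeProP p A) := by
    intro P hP C
    obtain ⟨-, -, f', -, hinj⟩ := (ProHall.exists_extend_injOn p P hP ho).2 C
    exact ⟨_, hinj⟩
  refine ⟨fun hR => ?_, fun _ hR => ?_⟩
  · have hP : ∀ D : Finset R, ∃ f : R →+* ℤ_[p], True ∧ Set.InjOn f (D : Set R) := fun D =>
      (hR D).imp fun f hf => ⟨trivial, hf⟩
    refine ⟨hgroup _ hP, fun _ hord => ?_⟩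
    obtain ⟨h1, h2⟩ := ProHall.exists_extend_injOn p _ hP hord
    refine ⟨h1, fun C => ?_⟩
    obtain ⟨-, -, f', -, hinj⟩ := h2 C
    exact ⟨f', ProHall.evalPadic f' A, hinj,
      fun _ _ h => ProHall.isPadicNormalForm_evalPadic hord f' h⟩
  -- An algebra homomorphism fixes the scalars `ℤ_[p]`. This property is carried through the
  -- extension to the binomial closure and makes `ι` a section.
  · have hP : ∀ D : Finset R, ∃ f : R →+* ℤ_[p], (∀ z, f (algebraMap ℤ_[p] R z) = z) ∧
        Set.InjOn f (D : Set R) := fun D =>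
      let ⟨f, hf⟩ := hR D
      ⟨f, f.commutes, hf⟩
    refine ⟨hgroup _ hP, fun _ hord => ?_⟩
    obtain ⟨h1, h2⟩ := ProHall.exists_extend_injOn p _ hP hord
    refine ⟨h1, FreeProP.toProHall hord ((BinClosure.of R).comp (algebraMap ℤ_[p] R)),
      fun _ _ h => FreeProP.isHallNormalForm_toProHall hord _ h, fun C => ?_⟩
    obtain ⟨f, hf, f', hf', hinj⟩ := h2 C
    have hid : ∀ z, f' (BinClosure.of R (algebraMap ℤ_[p] R z)) = z := fun z =>
      (hf' _).trans (hf z)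
    exact ⟨f', ProHall.evalPadic f' A, hid, hinj,
      fun _ _ h => ProHall.isPadicNormalForm_evalPadic hord f' h,
      fun h => ProHall.evalPadic_toProHall hord hid h⟩
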